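/- Let $u^+,\nu^-,k,f,\omega,d,D>0$ be constants and, for $U=(p^+,p^-,c)^T$, put $$A(U)=\begin{pmatrix}-u^+c&0&-u^+p^+\\0&\nu^-&0\\0&0&0\end{pmatrix},\quad B(U)=\begin{pmatrix}-f&\omega c&0\\ f&-\omega c&0\\-u^+c&\nu^-&-k\end{pmatrix},\quad C=\mathrm{diag}(d,d,D).$$ Let $\bar U=(\bar p^+,\bar p^-,\bar c):[0,\infty)\to[0,\infty)^3$ be of class $C^2$ and solve the steady-state equation $A(\bar U)\bar U_x+B(\bar U)\bar U+C\bar U_{xx}=0$ on $x>0$, with $\bar U(x)\to U_+$ as $x\to+\infty$, with prescribed values $\bar p^\pm(0)=\bar p^\pm_0$, and with either the Dirichlet condition $\bar c(0)=\bar c_0$ or the Neumann condition $\bar c_x(0)=0$. Let $$LU:=A(x)U_x+B(x)U+CU_{xx},\qquad A(x):=A(\bar U(x)),$$ $$B(x)=\begin{pmatrix}-f-u^+\bar c_x&\omega\bar c&\omega\bar p^--u^+\bar p^+_x\\ f&-\omega\bar c&-\omega\bar p^-\\-u^+\bar c&\nu^-&-k-u^+\bar p^+\end{pmatrix}(x),$$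 be the linearization about $\bar U$, i.e. $B(x)V=B(\bar U)V+(dB(\bar U)V)\bar U+(dA(\bar U)V)\bar U_x$, with the linearized boundary conditions at $x=0$: $(p^+,p^-,c)=(0,0,0)$ in the Dirichlet case and $(p^+,p^-,c_x)=(0,0,0)$ in the Neumann case. For $\eta>0$ let $\mathcal B_\eta$ be the Banach space of functions $U:(0,\infty)\to\mathbb C^3$ with $\|U\|_\eta:=\|e^{\eta x}U\|_{W^{1,\infty}(0,\infty)}<\infty$, where $\|g\|_{W^{1,\infty}}=\sup|g|+\sup|g'|$ (weak derivative, essential suprema). The domain of $L$ on $\mathcal B_\eta$ consists of the $U\in\mathcal B_\eta$ with $LU\in\mathcal B_\eta$ (weak derivatives) that satisfy the boundary conditions, and the spectrum of $L$ with respect to $\mathcal B_\eta$ is the set of $\lambda\in\mathbb C$ for which $\lambda-L$ does not possess a bounded inverse on $\mathcal B_\eta$. Put $\delta:=\min\{d,D\}$, $\alpha:=\sup_{x\ge0}|A(x)|$, $\beta:=\sup_{x\ge0}|B(x)|$, where $|M|$ is the Euclidean operator norm of a matrix. Then $\alpha,\beta<\infty$, and there is $\eta_0>0$ such that for all $0<\eta<\eta_0$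 the spectrum of $L$ with respect to $\mathcal B_\eta$ contains no $\lambda$ with $$\operatorname{Re}\lambda+|\operatorname{Im}\lambda|>\frac{\alpha^2}{\delta}+\beta .$$ -/

import Mathlib

noncomputable section

namespace Microtubule

open MeasureTheory Set Filter Topology
open scoped ENNReal NNReal Matrix

/-- The positive constants of the model: `u = u⁺`, `v = ν⁻`, `k`, `f = f⁻₊`, `w = ω`, and the
diffusion constants `d` (microtubule densities) and `D` (tubulin concentration). -/
structure Params where
  u : ℝ
  v : ℝ
  k : ℝ
  f : ℝ
  w : ℝ
  d : ℝ
  D : ℝ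
  u_pos : 0 < u
  v_pos : 0 < v
  k_pos : 0 < k
  f_pos : 0 < f
  w_pos : 0 < w
  d_pos : 0 < d
  D_pos : 0 < D

/-- The condition imposed on the concentration at `x = 0`: a Dirichlet condition
`c(0) = c₀`, or the homogeneous Neumann condition `c'(0) = 0`. -/
inductive TubulinBC where
  | dirichlet (c₀ : ℝ)
  | neumann

/-! The state is `U = (p⁺, p⁻, c)`, with coordinates `U 0`, `U 1`, `U 2`.
The model is `U_t = A(U) U_x + B(U) U + C U_xx` on `x > 0`. -/

def matA (P : Params) (U : Fin 3 → ℝ) : Matrix (Fin 3) (Fin 3) ℝ :=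
  !![-P.u * U 2, 0, -P.u * U 0;
     0, P.v, 0;
     0, 0, 0]

def matB (P : Params) (U : Fin 3 → ℝ) : Matrix (Fin 3) (Fin 3) ℝ :=
  !![-P.f, P.w * U 2, 0;
     P.f, -P.w * U 2, 0;
     -P.u * U 2, P.v, -P.k]

def matC (P : Params) : Matrix (Fin 3) (Fin 3) ℝ :=
  !![P.d, 0, 0;
     0, P.d, 0;
     0, 0, P.D]

/-- The first derivative of a profile on `[0, ∞)`, one-sided at `0`. -/
def profileDeriv (Ubar : ℝ → Fin 3 → ℝ) (x : ℝ) : Fin 3 → ℝ :=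
  derivWithin Ubar (Ici 0) x

/-- `Ubar` (only its values on `[0, ∞)` matter) is a nonnegative, asymptotically constant steady
state of the model, with limit `Uplus`, satisfying the boundary conditions at `x = 0`. -/
structure IsSteadyState (P : Params) (p₀ q₀ : ℝ) (bc : TubulinBC)
    (Ubar : ℝ → Fin 3 → ℝ) (Uplus : Fin 3 → ℝ) : Prop where
  contDiffOn : ContDiffOn ℝ 2 Ubar (Ici 0)
  nonneg : ∀ x, 0 ≤ x → ∀ i, 0 ≤ Ubar x i
  ode : ∀ x, 0 < x →
    matA P (Ubar x) *ᵥ profileDeriv Ubar x + matB P (Ubar x) *ᵥ Ubar x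
      + matC P *ᵥ derivWithin (profileDeriv Ubar) (Ici 0) x = 0
  tendsto : Tendsto Ubar atTop (𝓝 Uplus)
  bc_pplus : Ubar 0 0 = p₀
  bc_pminus : Ubar 0 1 = q₀
  bc_c : match bc with
    | .dirichlet c₀ => Ubar 0 2 = c₀
    | .neumann => profileDeriv Ubar 0 2 = 0

/-- The zeroth order coefficient of the linearization at a state `U` with `x`-derivative `W`:
`V ↦ B(U) V + (dB(U) V) U + (dA(U) V) W`; see `hasDerivAt_lowerOrder` below. -/
def linB (P : Params) (U W : Fin 3 → ℝ) : Matrix (Fin 3) (Fin 3) ℝ :=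
  !![-P.f - P.u * W 2, P.w * U 2, P.w * U 1 - P.u * W 0;
     P.f, -P.w * U 2, -P.w * U 1;
     -P.u * U 2, P.v, -P.k - P.u * U 0]

/-- `matA` and `linB` are indeed the coefficients of the linearization of
`(U, U_x) ↦ A(U) U_x + B(U) U`. -/
theorem hasDerivAt_lowerOrder (P : Params) (U W V V' : Fin 3 → ℝ) :
    HasDerivAt (fun s : ℝ => matA P (U + s • V) *ᵥ (W + s • V') + matB P (U + s • V) *ᵥ (U + s • V))
      (matA P U *ᵥ V' + linB P U W *ᵥ V) 0 := by
  have key : ∀ a b c : ℝ, HasDerivAt (fun s : ℝ => a + s * b + s ^ 2 * c) b 0 := by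
    intro a b c
    have h1 : HasDerivAt (fun s : ℝ => s * b) (1 * b) 0 := (hasDerivAt_id (0 : ℝ)).mul_const b
    have h2 : HasDerivAt (fun s : ℝ => s ^ 2 * c) ((2 : ℕ) * (0 : ℝ) ^ (2 - 1) * c) 0 :=
      (hasDerivAt_pow 2 (0 : ℝ)).mul_const c
    have h3 := (h1.const_add a).add h2
    have h4 : (1 * b + ((2 : ℕ) * (0 : ℝ) ^ (2 - 1) * c)) = b := by norm_num
    rw [h4] at h3
    exact h3
  rw [hasDerivAt_pi]
  intro i
  fin_cases i
  · refine (key ((matA P U *ᵥ W + matB P U *ᵥ U) 0) ((matA P U *ᵥ V' + linB P U W *ᵥ V) 0)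
      (-P.u * V 2 * V' 0 - P.u * V 0 * V' 2 + P.w * V 2 * V 1)).congr_of_eventuallyEq (Eventually.of_forall fun s => ?_)
    simp [matA, matB, linB, Matrix.mulVec, dotProduct, Fin.sum_univ_three]
    ring
  · refine (key ((matA P U *ᵥ W + matB P U *ᵥ U) 1) ((matA P U *ᵥ V' + linB P U W *ᵥ V) 1)
      (-P.w * V 2 * V 1)).congr_of_eventuallyEq (Eventually.of_forall fun s => ?_)
    simp [matA, matB, linB, Matrix.mulVec, dotProduct, Fin.sum_univ_three]
    ring
  · refine (key ((matA P U *ᵥ W + matB P U *ᵥ U) 2) ((matA P U *ᵥ V' + linB P U W *ᵥ V) 2)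
      (-P.u * V 2 * V 0)).congr_of_eventuallyEq (Eventually.of_forall fun s => ?_)
    simp [matA, matB, linB, Matrix.mulVec, dotProduct, Fin.sum_univ_three]
    ring

/-- The coefficient `A(x) = A(Ubar(x))` of the linearized operator. -/
def coefA (P : Params) (Ubar : ℝ → Fin 3 → ℝ) (x : ℝ) : Matrix (Fin 3) (Fin 3) ℝ :=
  matA P (Ubar x)

/-- The coefficient `B(x)` of the linearized operator. -/
def coefB (P : Params) (Ubar : ℝ → Fin 3 → ℝ) (x : ℝ) : Matrix (Fin 3) (Fin 3) ℝ :=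
  linB P (Ubar x) (profileDeriv Ubar x)

/-- The Euclidean operator norm of a real matrix. -/
def opNorm (M : Matrix (Fin 3) (Fin 3) ℝ) : ℝ :=
  ‖Matrix.toEuclideanCLM (n := Fin 3) (𝕜 := ℝ) M‖

/-- The supremum over the half-line `[0, ∞)` of the operator norm of a matrix function. -/
def supNorm (M : ℝ → Matrix (Fin 3) (Fin 3) ℝ) : ℝ :=
  ⨆ x : Ici (0 : ℝ), opNorm (M x)

/-- The values of the perturbations: `ℂ³` with its Euclidean norm. -/
abbrev Val : Type := EuclideanSpace ℂ (Fin 3)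

/-- Lebesgue measure on the half-line. -/
def halfLine : Measure ℝ := volume.restrict (Ioi 0)

/-- `g` is a weak derivative of `f` on `(0, ∞)`. -/
def IsWeakDeriv (f g : ℝ → Val) : Prop :=
  LocallyIntegrableOn f (Ioi 0) ∧ LocallyIntegrableOn g (Ioi 0) ∧
    ∀ φ : ℝ → ℝ, ContDiff ℝ (⊤ : ℕ∞) φ → HasCompactSupport φ → tsupport φ ⊆ Ioi 0 →
      ∫ x, deriv φ x • f x ∂halfLine = - ∫ x, φ x • g x ∂halfLine

/-- The `W^{1,∞}` norm on the half-line, `sup |f| + sup |f'|` (essential suprema);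
it is `∞` when `f` is not in `W^{1,∞}`. -/
def w1infNorm (f : ℝ → Val) : ℝ≥0∞ :=
  ⨅ (g : ℝ → Val) (_ : IsWeakDeriv f g), eLpNorm f ∞ halfLine + eLpNorm g ∞ halfLine

/-- The weighted norm `‖e^{ηx} U‖` in `W^{1,∞}`. -/
def weightedNorm (η : ℝ) (U : ℝ → Val) : ℝ≥0∞ :=
  w1infNorm fun x => Real.exp (η * x) • U x

/-- Membership in the weighted Banach space (functions are identified almost everywhere). -/
def MemWeighted (η : ℝ) (U : ℝ → Val) : Prop :=
  weightedNorm η U < ∞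

/-- The scalar function `h` on the half-line has a representative that is continuous up to the
boundary and vanishes at `0`. -/
def ZeroTrace (h : ℝ → ℂ) : Prop :=
  ∃ g : ℝ → ℂ, ContinuousOn g (Ici 0) ∧ g =ᵐ[halfLine] h ∧ g 0 = 0

/-- `LinOp P bc Ubar η U G`: the function `U` lies in the domain of the linearized operator
`L U = A(x) U_x + B(x) U + C U_xx` on the weighted space, and `L U = G`. The domain is the set of
all `U` in the space with `L U` in the space that satisfy the linearized boundary conditions. -/
def LinOp (P : Params) (bc : TubulinBC) (Ubar : ℝ → Fin 3 → ℝ) (η : ℝ) (U G : ℝ → Val) : Prop :=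
  MemWeighted η U ∧ MemWeighted η G ∧
    ∃ U₁ U₂ : ℝ → Val, IsWeakDeriv U U₁ ∧ IsWeakDeriv U₁ U₂ ∧
      (∀ᵐ x ∂halfLine,
        (G x).ofLp = (coefA P Ubar x).map Complex.ofReal *ᵥ (U₁ x).ofLp
          + (coefB P Ubar x).map Complex.ofReal *ᵥ (U x).ofLp
          + (matC P).map Complex.ofReal *ᵥ (U₂ x).ofLp) ∧
      ZeroTrace (fun x => U x 0) ∧ ZeroTrace (fun x => U x 1) ∧
      match bc with
      | .dirichlet _ => ZeroTrace (fun x => U x 2)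
      | .neumann => ZeroTrace (fun x => U₁ x 2)

/-- `U` is in the domain of `L` and `(z - L) U = F`. -/
def SolvesResolvent (P : Params) (bc : TubulinBC) (Ubar : ℝ → Fin 3 → ℝ) (η : ℝ) (z : ℂ)
    (U F : ℝ → Val) : Prop :=
  ∃ G : ℝ → Val, LinOp P bc Ubar η U G ∧ F =ᵐ[halfLine] fun x => z • U x - G x

/-- `z - L` has a bounded inverse on the weighted space. -/
def HasBoundedInverse (P : Params) (bc : TubulinBC) (Ubar : ℝ → Fin 3 → ℝ) (η : ℝ) (z : ℂ) :
    Prop :=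
  ∃ K : ℝ≥0, ∀ F : ℝ → Val, MemWeighted η F →
    ∃ U : ℝ → Val, SolvesResolvent P bc Ubar η z U F ∧
      weightedNorm η U ≤ K * weightedNorm η F ∧
      ∀ V : ℝ → Val, SolvesResolvent P bc Ubar η z V F → V =ᵐ[halfLine] U

/-- The spectrum of the linearized operator on the weighted space. -/
def spectrumL (P : Params) (bc : TubulinBC) (Ubar : ℝ → Fin 3 → ℝ) (η : ℝ) : Set ℂ :=
  {z | ¬ HasBoundedInverse P bc Ubar η z}

end Microtubule

end

/-!
Why the spectrum avoids the region `Re z + |Im z| > α² / δ + β`.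

*Numerical range.* Put `κ = 1 ∓ i`, with the sign for which `Re (κ z) = Re z + |Im z|`. Taking the
real part of `κ` times the scalar product of the resolvent equation with `U`, the transport terms
cost `√2 α |U| |U'|`, and as `Re κ = 1` Young's inequality absorbs them with `α² / (2 δ) |U|²`: only
half of the allowed amount. The zeroth order terms are the difficulty, because `|κ| = √2` gives only
`√2 β |U|²`. The structure of the reaction matrix saves the factor `√2`: `reaction_real` shows that
`Re ⟨κ B U, U⟩ ≤ N |U|²` for matrices with the sign pattern of `B`, where `N` only has to dominate
the Euclidean lengths of a few pairs of entries, which the operator norm does.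

*Signs.* The diagonal entry `-f - u c'` and the corner entry `ω p⁻ - u (p⁺)'` have no sign. The term
`u c'` disappears when the flux of the first component is integrated by parts. The corner entry is
treated by integrating by parts only the remainder `n - w` of `n = u p⁺`; with `w` from
`exists_flux_split` the new corner entry `ω p⁻ - w'` is nonnegative and not larger in modulus than
the old one, and the transport bound is preserved up to an arbitrarily small `ε` because it is
affine in `w` (`transport_real`). All this is the pointwise inequality `energy_pointwise`; the
boundary conditions make its boundary term vanish at `0`.

*Weighted sup norms.* The energy inequality is multiplied by `e^{2ηx} / (1 + μ² (x - x₀)²)`. The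
exponential compensates the decay of the solution, and the second factor is integrable; its
logarithmic derivative is at most `μ`, so for small `η` and `μ` the slack in the transport estimate
absorbs the error. This bounds the energy on the unit interval to the right of `x₀`, and the
equation turns the bound into a pointwise one (`exists_apriori`), with a threshold for `η` that does
not depend on `z`.

*Existence.* For `z + T` with `T` large the lower order terms are a small perturbation of
`T - C ∂²`, whose inverse is an explicit Green function (`solvable_of_large`). The ray
`z + [0, ∞)` stays in the region, where the a priori estimate is uniform on bounded sets, and the
continuity method leads from `z + T` back to `z` (`exists_solvable`).

*Weak solutions.* By the lemma of du Bois-Reymond, elements of the weighted space have continuous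
representatives, and weak solutions are classical (`SolvesResolvent.exists_classical`). Hence the a
priori estimate also gives uniqueness and the bound of the inverse (`hasBoundedInverse_of_apriori`).
-/

noncomputable section

namespace Microtubule

open MeasureTheory Set Filter Topology
open scoped ENNReal NNReal Matrix ComplexConjugate

/-! ### The reaction inequality -/

/-- The part of `symbol_det` that absorbs the square of the larger of the two diagonal entries, with
`t = √(N² - g²)`; it rests on `N ≤ t + g`. -/
theorem symbol_aux {N t s a y g : ℝ} (ha : 0 ≤ a) (hy : 0 ≤ y) (ht : 0 ≤ t)
    (hN : 0 ≤ N) (hts : t ^ 2 = s) (htg : N ≤ t + g) (hat : a ≤ t) (hyt : y ≤ t) :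
    0 ≤ N * (s - y ^ 2) + a * (s + y * g) - N * a ^ 2 := by
  subst hts
  have h1 : 0 ≤ N * (t - y) * y := mul_nonneg (mul_nonneg hN (by linarith)) hy
  have h2 : 0 ≤ a * y * (t + g - N) := mul_nonneg (mul_nonneg ha hy) (by linarith)
  have h3 : 0 ≤ a * t * (t - y) := mul_nonneg (mul_nonneg ha ht) (by linarith)
  have h4 : 0 ≤ N * (t - y) * (t - a) :=
    mul_nonneg (mul_nonneg hN (by linarith)) (by linarith)
  have h5 : 0 ≤ N * y * a := mul_nonneg (mul_nonneg hN hy) ha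
  by_cases hya : a ≤ y
  · nlinarith [mul_nonneg (mul_nonneg hN ha) (sub_nonneg.2 hya),
      mul_nonneg (mul_nonneg hN ht) (sub_nonneg.2 hyt)]
  · push Not at hya
    nlinarith [mul_nonneg (mul_nonneg hN ha) (sub_nonneg.2 hat),
      mul_nonneg (mul_nonneg hN (sub_nonneg.2 hyt)) (sub_nonneg.2 hat)]

theorem symbol_sqrt {N g : ℝ} (hg : 0 ≤ g) (h : g ^ 2 ≤ N ^ 2) :
    √(N ^ 2 - g ^ 2) ^ 2 = N ^ 2 - g ^ 2 ∧ N ≤ √(N ^ 2 - g ^ 2) + g := by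
  have h1 := Real.sq_sqrt (sub_nonneg.2 h)
  refine ⟨h1, ?_⟩
  have := Real.sqrt_nonneg (N ^ 2 - g ^ 2)
  nlinarith

/-- The determinant of the `2 × 2` Hermitian form that remains in `reaction_real` after the third
component is eliminated, divided by `8 N`, is nonnegative. -/
theorem symbol_det {N a b y g e v : ℝ} (hN : 0 ≤ N) (ha : 0 ≤ a) (hb : 0 ≤ b) (hy : 0 ≤ y)
    (hg : 0 ≤ g) (he : 0 ≤ e) (hv : 0 ≤ v) (h1 : y ^ 2 + g ^ 2 ≤ N ^ 2)
    (h2 : e ^ 2 + v ^ 2 ≤ N ^ 2) (h3 : a ^ 2 + g ^ 2 ≤ N ^ 2) (h4 : b ^ 2 + y ^ 2 ≤ N ^ 2) :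
    0 ≤ N * (2 * N ^ 2 - y ^ 2 - g ^ 2 - e ^ 2 - v ^ 2)
      + a * (2 * N ^ 2 - g ^ 2 - v ^ 2 + y * g + y * v + e * v - e * g)
      + b * (2 * N ^ 2 - y ^ 2 - e ^ 2 + y * g + e * g + e * v - y * v) - N * (a - b) ^ 2 := by
  have hyN : y ≤ N := abs_le_of_sq_le_sq' (by nlinarith) hN |>.2
  have hgN : g ≤ N := abs_le_of_sq_le_sq' (by nlinarith) hN |>.2
  have heN : e ≤ N := abs_le_of_sq_le_sq' (by nlinarith) hN |>.2
  have hvN : v ≤ N := abs_le_of_sq_le_sq' (by nlinarith) hN |>.2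
  have hcA : 0 ≤ N ^ 2 - v ^ 2 + e * v - e * g := by
    nlinarith [mul_nonneg (sub_nonneg.2 hvN) (by linarith : 0 ≤ N + v - e),
      mul_nonneg he (sub_nonneg.2 hgN)]
  have hcB : 0 ≤ N ^ 2 - e ^ 2 + e * v - y * v := by
    nlinarith [mul_nonneg (sub_nonneg.2 heN) (by linarith : 0 ≤ N + e - v),
      mul_nonneg hv (sub_nonneg.2 hyN)]
  have hS2 : 0 ≤ N * (N ^ 2 - e ^ 2 - v ^ 2) := mul_nonneg hN (by linarith)
  obtain ⟨hs1, ht1⟩ := symbol_sqrt (N := N) hg (by nlinarith)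
  obtain ⟨hs2, ht2⟩ := symbol_sqrt (N := N) hy (by nlinarith)
  have hyg := mul_nonneg hy hg
  have hyv := mul_nonneg hy hv
  have heg := mul_nonneg he hg
  have hab := mul_nonneg ha hb
  -- `(a - b)²` is at most the square of the larger entry, which `symbol_aux` absorbs
  rcases le_total b a with hba | hba
  · have hm := symbol_aux (N := N) (g := g) (a := a) (y := y) ha hy (Real.sqrt_nonneg _) hN hs1 ht1
      (Real.le_sqrt_of_sq_le (by linarith)) (Real.le_sqrt_of_sq_le (by linarith))
    have hsq : N * (a - b) ^ 2 ≤ N * a ^ 2 := mul_le_mul_of_nonneg_left (by nlinarith) hN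
    have hA : 0 ≤ a * (y * v + (N ^ 2 - v ^ 2 + e * v - e * g)) := mul_nonneg ha (by linarith)
    have hB : 0 ≤ b * ((N ^ 2 - y ^ 2) + y * g + e * g + (N ^ 2 - e ^ 2 + e * v - y * v)) :=
      mul_nonneg hb (by nlinarith)
    linarith
  · have hm := symbol_aux (N := N) (g := y) (a := b) (y := g) hb hg (Real.sqrt_nonneg _) hN hs2 ht2
      (Real.le_sqrt_of_sq_le (by linarith)) (Real.le_sqrt_of_sq_le (by linarith))
    have hsq : N * (a - b) ^ 2 ≤ N * b ^ 2 := mul_le_mul_of_nonneg_left (by nlinarith) hN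
    have hA : 0 ≤ a * ((N ^ 2 - g ^ 2) + y * g + y * v + (N ^ 2 - v ^ 2 + e * v - e * g)) :=
      mul_nonneg ha (by nlinarith)
    have hB : 0 ≤ b * (e * g + (N ^ 2 - e ^ 2 + e * v - y * v)) := mul_nonneg hb (by linarith)
    linarith

/-- A Hermitian `2 × 2` form with nonnegative diagonal and determinant is nonnegative; here the
off-diagonal entry is `m₁ + i m₂`. -/
theorem hermitian_form_nonneg {A B m₁ m₂ : ℝ} (hA : 0 ≤ A) (hB : 0 ≤ B)
    (h : m₁ ^ 2 + m₂ ^ 2 ≤ A * B) (p₁ p₂ q₁ q₂ : ℝ) :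
    2 * (m₁ * (p₁ * q₁ + p₂ * q₂) - m₂ * (p₁ * q₂ - p₂ * q₁))
      ≤ A * (p₁ ^ 2 + p₂ ^ 2) + B * (q₁ ^ 2 + q₂ ^ 2) := by
  set x := m₁ * (p₁ * q₁ + p₂ * q₂) - m₂ * (p₁ * q₂ - p₂ * q₁) with hx
  have hx2 : x ^ 2 ≤ (A * (p₁ ^ 2 + p₂ ^ 2)) * (B * (q₁ ^ 2 + q₂ ^ 2)) := by
    have h1 : x ^ 2 + (m₁ * (p₁ * q₂ - p₂ * q₁) + m₂ * (p₁ * q₁ + p₂ * q₂)) ^ 2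
        = (m₁ ^ 2 + m₂ ^ 2) * ((p₁ ^ 2 + p₂ ^ 2) * (q₁ ^ 2 + q₂ ^ 2)) := by rw [hx]; ring
    have h2 := mul_le_mul_of_nonneg_right h
      (by positivity : 0 ≤ (p₁ ^ 2 + p₂ ^ 2) * (q₁ ^ 2 + q₂ ^ 2))
    nlinarith [sq_nonneg (m₁ * (p₁ * q₂ - p₂ * q₁) + m₂ * (p₁ * q₁ + p₂ * q₂))]
  have h3 : (2 * x) ^ 2 ≤ (A * (p₁ ^ 2 + p₂ ^ 2) + B * (q₁ ^ 2 + q₂ ^ 2)) ^ 2 := by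
    nlinarith [sq_nonneg (A * (p₁ ^ 2 + p₂ ^ 2) - B * (q₁ ^ 2 + q₂ ^ 2))]
  exact (abs_le_of_sq_le_sq' h3 (by positivity)).2

/-- The reaction inequality `Re ⟨κ B V, V⟩ ≤ N |V|²` with `κ = 1 + σ i`, `σ = ±1`, for
`B = !![-a, b, y; a, -b, -g; -e, v, -h]` and `V = (P, Q, C)`, written out in the real and imaginary
parts. Completing the square in `C` leaves a Hermitian form in `(P, Q)`, which is nonnegative by
`symbol_det`. -/
theorem reaction_real {N a b y g e v h σ : ℝ} (hσ : σ = 1 ∨ σ = -1) (hN : 0 < N) (ha : 0 ≤ a)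
    (hb : 0 ≤ b) (hy : 0 ≤ y)
    (hg : 0 ≤ g) (he : 0 ≤ e) (hv : 0 ≤ v) (hh : 0 ≤ h) (h1 : y ^ 2 + g ^ 2 ≤ N ^ 2)
    (h2 : e ^ 2 + v ^ 2 ≤ N ^ 2) (h3 : a ^ 2 + g ^ 2 ≤ N ^ 2) (h4 : b ^ 2 + y ^ 2 ≤ N ^ 2)
    (p₁ p₂ q₁ q₂ c₁ c₂ : ℝ) :
    (-a * (p₁ ^ 2 + p₂ ^ 2) - b * (q₁ ^ 2 + q₂ ^ 2) - h * (c₁ ^ 2 + c₂ ^ 2)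
      + (a + b) * (p₁ * q₁ + p₂ * q₂) + (y - e) * (c₁ * p₁ + c₂ * p₂)
      + (v - g) * (c₁ * q₁ + c₂ * q₂))
      - σ * (b * (q₂ * p₁ - q₁ * p₂) + y * (c₂ * p₁ - c₁ * p₂) + a * (p₂ * q₁ - p₁ * q₂)
      - g * (c₂ * q₁ - c₁ * q₂) - e * (p₂ * c₁ - p₁ * c₂) + v * (q₂ * c₁ - q₁ * c₂))
      ≤ N * (p₁ ^ 2 + p₂ ^ 2 + (q₁ ^ 2 + q₂ ^ 2) + (c₁ ^ 2 + c₂ ^ 2)) := by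
  have hdet := symbol_det hN.le ha hb hy hg he hv h1 h2 h3 h4
  have hD1 : 0 ≤ 4 * N ^ 2 + 4 * N * a - 2 * (y ^ 2 + e ^ 2) := by nlinarith [mul_nonneg hN.le ha]
  have hD2 : 0 ≤ 4 * N ^ 2 + 4 * N * b - 2 * (g ^ 2 + v ^ 2) := by nlinarith [mul_nonneg hN.le hb]
  have hM := hermitian_form_nonneg (m₁ := -2 * (y * g + e * v) + 2 * N * (a + b))
    (m₂ := -σ * (2 * (e * g - y * v) + 2 * N * (a - b))) hD1 hD2 (by
      rw [mul_pow, neg_sq, show σ ^ 2 = 1 by rcases hσ with rfl | rfl <;> norm_num]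
      linarith [mul_nonneg hN.le hdet]) p₁ p₂ q₁ q₂
  -- completing the square in the third component
  have hsq := add_nonneg
    (sq_nonneg (2 * N * c₁ - ((y - e) * p₁ + σ * (y + e) * p₂ + (v - g) * q₁ - σ * (g + v) * q₂)))
    (sq_nonneg (2 * N * c₂ - ((y - e) * p₂ - σ * (y + e) * p₁ + (v - g) * q₂ + σ * (g + v) * q₁)))
  have hhc : 0 ≤ N * h * (c₁ ^ 2 + c₂ ^ 2) := by positivity
  have key : 0 ≤ 4 * N * (N * (p₁ ^ 2 + p₂ ^ 2 + (q₁ ^ 2 + q₂ ^ 2) + (c₁ ^ 2 + c₂ ^ 2))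
      - ((-a * (p₁ ^ 2 + p₂ ^ 2) - b * (q₁ ^ 2 + q₂ ^ 2) - h * (c₁ ^ 2 + c₂ ^ 2)
      + (a + b) * (p₁ * q₁ + p₂ * q₂) + (y - e) * (c₁ * p₁ + c₂ * p₂)
      + (v - g) * (c₁ * q₁ + c₂ * q₂))
      - σ * (b * (q₂ * p₁ - q₁ * p₂) + y * (c₂ * p₁ - c₁ * p₂) + a * (p₂ * q₁ - p₁ * q₂)
      - g * (c₂ * q₁ - c₁ * q₂) - e * (p₂ * c₁ - p₁ * c₂) + v * (q₂ * c₁ - q₁ * c₂)))) := by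
    rcases hσ with rfl | rfl <;> linarith
  exact sub_nonneg.1 (nonneg_of_mul_nonneg_right key (by linarith))

/-! ### The pointwise energy inequality -/

/-- The Euclidean norm of a triple of complex numbers. -/
def nrm (P Q C : ℂ) : ℝ := √(‖P‖ ^ 2 + ‖Q‖ ^ 2 + ‖C‖ ^ 2)

theorem nrm_nonneg (P Q C : ℂ) : 0 ≤ nrm P Q C := Real.sqrt_nonneg _

theorem nrm_sq (P Q C : ℂ) : nrm P Q C ^ 2 = ‖P‖ ^ 2 + ‖Q‖ ^ 2 + ‖C‖ ^ 2 :=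
  Real.sq_sqrt (by positivity)

/-- The complex form of `reaction_real`. -/
theorem reaction_bound {N a b y g e v h σ : ℝ} (hσ : σ = 1 ∨ σ = -1) (hN : 0 < N) (ha : 0 ≤ a)
    (hb : 0 ≤ b) (hy : 0 ≤ y)
    (hg : 0 ≤ g) (he : 0 ≤ e) (hv : 0 ≤ v) (hh : 0 ≤ h) (h1 : y ^ 2 + g ^ 2 ≤ N ^ 2)
    (h2 : e ^ 2 + v ^ 2 ≤ N ^ 2) (h3 : a ^ 2 + g ^ 2 ≤ N ^ 2) (h4 : b ^ 2 + y ^ 2 ≤ N ^ 2)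
    (P Q C : ℂ) :
    ((1 + σ * Complex.I) * ((-a * P + b * Q + y * C) * conj P + (a * P - b * Q - g * C) * conj Q
      + (-e * P + v * Q - h * C) * conj C)).re ≤ N * nrm P Q C ^ 2 := by
  have := reaction_real hσ hN ha hb hy hg he hv hh h1 h2 h3 h4 P.re P.im Q.re Q.im C.re C.im
  rw [nrm_sq]
  simp only [Complex.sq_norm, Complex.normSq_apply]
  simp
  linarith

theorem cauchy_two (x y a b : ℝ) : x * a + y * b ≤ √(x ^ 2 + y ^ 2) * √(a ^ 2 + b ^ 2) := by
  rw [← Real.sqrt_mul (by positivity)]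
  exact Real.le_sqrt_of_sq_le (by nlinarith [sq_nonneg (x * b - y * a)])

/-- Splitting the flux `n c` into a part `w` that is differentiated and a part `n - w` that is
moved to the other factor does not increase the transport bound. -/
theorem transport_real {α e n v w p q c p₁ q₁ c₁ : ℝ} (hα : 0 ≤ α) (hv : v ≤ α)
    (h : e ^ 2 + n ^ 2 ≤ α ^ 2) (hw : 0 ≤ w) (hwn : w ≤ n) (hp : 0 ≤ p)
    (hq : 0 ≤ q) (hp₁ : 0 ≤ p₁) (hq₁ : 0 ≤ q₁) :
    e * p * p₁ + w * p * c₁ + (n - w) * c * p₁ + v * q * q₁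
      ≤ α * (√(p ^ 2 + q ^ 2 + c ^ 2) * √(p₁ ^ 2 + q₁ ^ 2 + c₁ ^ 2)) := by
  set A := √(p ^ 2 + c ^ 2) with hA
  set B := √(p₁ ^ 2 + c₁ ^ 2) with hB
  have hA2 : A ^ 2 = p ^ 2 + c ^ 2 := Real.sq_sqrt (by positivity)
  have hB2 : B ^ 2 = p₁ ^ 2 + c₁ ^ 2 := Real.sq_sqrt (by positivity)
  have hA0 : 0 ≤ A := Real.sqrt_nonneg _
  have hB0 : 0 ≤ B := Real.sqrt_nonneg _
  have hpA : p ≤ A := abs_le_of_sq_le_sq' (by nlinarith) hA0 |>.2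
  have hpB : p₁ ≤ B := abs_le_of_sq_le_sq' (by nlinarith) hB0 |>.2
  have hen : √(e ^ 2 + n ^ 2) ≤ α := Real.sqrt_le_iff.2 ⟨hα, h⟩
  have hAB : e * p * p₁ + w * p * c₁ + (n - w) * c * p₁ ≤ α * (A * B) := by
    -- the left side is affine in `w`, so it is largest at `w = 0` or at `w = n`
    rcases le_total (p * c₁) (c * p₁) with hle | hle
    · have h1 : e * p + n * c ≤ α * A :=
        (cauchy_two e n p c).trans (mul_le_mul_of_nonneg_right hen hA0)
      have h2 := mul_le_mul_of_nonneg_right h1 hp₁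
      have h3 := mul_le_mul_of_nonneg_left hpB (mul_nonneg hα hA0)
      nlinarith [mul_le_mul_of_nonneg_left hle hw]
    · have h1 : e * p₁ + n * c₁ ≤ α * B :=
        (cauchy_two e n p₁ c₁).trans (mul_le_mul_of_nonneg_right hen hB0)
      have h2 := mul_le_mul_of_nonneg_left h1 hp
      have h3 := mul_le_mul_of_nonneg_right hpA (mul_nonneg hα hB0)
      nlinarith [mul_le_mul_of_nonneg_left hle (sub_nonneg.2 hwn)]
  have h5 : v * q * q₁ ≤ α * (q * q₁) := by
    nlinarith [mul_le_mul_of_nonneg_right hv (mul_nonneg hq hq₁)]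
  have h6 := cauchy_two A q B q₁
  rw [hA2, hB2, add_right_comm, add_right_comm (p₁ ^ 2)] at h6
  nlinarith [mul_le_mul_of_nonneg_left h6 hα]

theorem norm_kappa {σ : ℝ} (hσ : σ = 1 ∨ σ = -1) : ‖(1 + σ * Complex.I : ℂ)‖ = √2 := by
  rw [Complex.norm_def, Complex.normSq_apply]
  congr 1
  rcases hσ with rfl | rfl <;> simp <;> norm_num

theorem re_kappa_mul_le {σ : ℝ} (hσ : σ = 1 ∨ σ = -1) (x : ℂ) :
    ((1 + σ * Complex.I) * x).re ≤ √2 * ‖x‖ := by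
  rw [← norm_kappa hσ, ← norm_mul]
  exact Complex.re_le_norm _

/-- The first order terms that remain after integrating the flux `e P + (n - w) C` by parts. With
`w ≤ n + ε` in place of `w ≤ n` the bound `α` only becomes `α + 2 ε`. -/
theorem transport_bound {α ε e n v w σ : ℝ} (hσ : σ = 1 ∨ σ = -1) (hα : 0 ≤ α) (hε : 0 ≤ ε)
    (he : 0 ≤ e) (hv0 : 0 ≤ v) (hv : v ≤ α)
    (h : e ^ 2 + n ^ 2 ≤ α ^ 2) (hw : 0 ≤ w) (hwn : w ≤ n + ε) (P Q C P₁ Q₁ C₁ : ℂ) :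
    ((1 + σ * Complex.I) * (e * P * conj P₁ - w * C₁ * conj P + (n - w) * C * conj P₁
      + v * Q₁ * conj Q)).re ≤ √2 * (α + 2 * ε) * (nrm P Q C * nrm P₁ Q₁ C₁) := by
  refine (re_kappa_mul_le hσ _).trans ?_
  rw [mul_assoc √2]
  refine mul_le_mul_of_nonneg_left ?_ (Real.sqrt_nonneg _)
  have h1 : ‖(e * P * conj P₁ - w * C₁ * conj P + (n - w) * C * conj P₁ + v * Q₁ * conj Q : ℂ)‖
      ≤ e * ‖P‖ * ‖P₁‖ + w * ‖C₁‖ * ‖P‖ + |n - w| * ‖C‖ * ‖P₁‖ + v * ‖Q₁‖ * ‖Q‖ := by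
    refine (norm_add_le _ _).trans (add_le_add ((norm_add_le _ _).trans
      (add_le_add ((norm_sub_le _ _).trans (add_le_add ?_ ?_)) ?_)) ?_)
    · simp [abs_of_nonneg he]
    · simp [abs_of_nonneg hw]
    · rw [norm_mul, norm_mul, ← Complex.ofReal_sub, Complex.norm_real]; simp
    · simp [abs_of_nonneg hv0]
  have h2 : |n - w| ≤ (n + ε - w) + ε := abs_le.2 ⟨by linarith, by linarith⟩
  have hmain := transport_real (α := α + ε) (e := e) (n := n + ε) (v := v) (w := w) (p := ‖P‖)
    (q := ‖Q‖) (c := ‖C‖) (p₁ := ‖P₁‖) (q₁ := ‖Q₁‖) (c₁ := ‖C₁‖) (by linarith) (by linarith)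
    (by have := (abs_le_of_sq_le_sq' (show n ^ 2 ≤ α ^ 2 by nlinarith) hα).2
        nlinarith [mul_le_mul_of_nonneg_right this hε])
    hw hwn (norm_nonneg _) (norm_nonneg _) (norm_nonneg _) (norm_nonneg _)
  have hC : ‖C‖ ≤ nrm P Q C := Real.le_sqrt_of_sq_le (by nlinarith [sq_nonneg ‖P‖, sq_nonneg ‖Q‖])
  have hP : ‖P₁‖ ≤ nrm P₁ Q₁ C₁ :=
    Real.le_sqrt_of_sq_le (by nlinarith [sq_nonneg ‖Q₁‖, sq_nonneg ‖C₁‖])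
  have h3 := mul_le_mul hC hP (norm_nonneg _) (nrm_nonneg P Q C)
  have h4 := mul_le_mul_of_nonneg_right h2 (mul_nonneg (norm_nonneg C) (norm_nonneg P₁))
  unfold nrm at *
  nlinarith [mul_le_mul_of_nonneg_left h3 hε]

theorem forcing_bound {σ : ℝ} (hσ : σ = 1 ∨ σ = -1) (F G H P Q C : ℂ) :
    ((1 + σ * Complex.I) * (F * conj P + G * conj Q + H * conj C)).re
      ≤ √2 * (nrm F G H * nrm P Q C) := by
  refine (re_kappa_mul_le hσ _).trans (mul_le_mul_of_nonneg_left ?_ (Real.sqrt_nonneg _))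
  refine (norm_add₃_le ..).trans ?_
  simp only [norm_mul, RCLike.norm_conj, nrm]
  rw [← Real.sqrt_mul (by positivity)]
  refine Real.le_sqrt_of_sq_le ?_
  nlinarith [sq_nonneg (‖F‖ * ‖Q‖ - ‖G‖ * ‖P‖), sq_nonneg (‖F‖ * ‖C‖ - ‖H‖ * ‖P‖),
    sq_nonneg (‖G‖ * ‖C‖ - ‖H‖ * ‖Q‖)]

/-- The numerical range estimate at a point. The right side is the derivative of the boundary term,
the real part of `1 + σ i` times `d P' P̄ + d Q' Q̄ + D C' C̄ - (e P + (n - w) C) P̄`, along a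
solution of the resolvent equation, where `m = n'`, `s = e'`, and `P₁`, `P₂` stand for `P'`, `P''`;
its derivative-free part is the reaction matrix with corner entry `g - w'` in place of `g - m`. -/
theorem energy_pointwise {α β δ ε d D a b g e v h n m s w w₁ σ : ℝ} {z : ℂ}
    {P Q C P₁ Q₁ C₁ P₂ Q₂ C₂ F G H : ℂ}
    (hσ : σ = 1 ∨ σ = -1) (hα : 0 ≤ α) (hβ : 0 < β) (hε : 0 ≤ ε)
    (hd : δ ≤ d) (hD : δ ≤ D) (ha : 0 ≤ a) (hb : 0 ≤ b) (hg : 0 ≤ g) (he : 0 ≤ e) (hv : 0 ≤ v)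
    (hh : 0 ≤ h) (hw : 0 ≤ w) (hwn : w ≤ n + ε) (hw₁ : 0 ≤ g - w₁)
    (hw₁' : (g - w₁) ^ 2 ≤ (g - m) ^ 2) (hvα : v ≤ α) (henα : e ^ 2 + n ^ 2 ≤ α ^ 2)
    (h1 : (g - m) ^ 2 + g ^ 2 ≤ β ^ 2) (h2 : e ^ 2 + v ^ 2 ≤ β ^ 2) (h3 : a ^ 2 + g ^ 2 ≤ β ^ 2)
    (h4 : b ^ 2 + (g - m) ^ 2 ≤ β ^ 2)
    (eP : d * P₂ = z * P - F - (-e * P₁ - n * C₁) - ((-a - s) * P + b * Q + (g - m) * C))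
    (eQ : d * Q₂ = z * Q - G - v * Q₁ - (a * P - b * Q - g * C))
    (eC : D * C₂ = z * C - H - (-e * P + v * Q - h * C)) :
    (z.re - σ * z.im - β) * nrm P Q C ^ 2 + δ * nrm P₁ Q₁ C₁ ^ 2 - √2 * (nrm F G H * nrm P Q C)
      - √2 * (α + 2 * ε) * (nrm P Q C * nrm P₁ Q₁ C₁)
    ≤ ((1 + σ * Complex.I) * (d * (P₂ * conj P + P₁ * conj P₁) + d * (Q₂ * conj Q + Q₁ * conj Q₁)
      + D * (C₂ * conj C + C₁ * conj C₁)
      - ((s * P + e * P₁ + ((m - w₁) * C + (n - w) * C₁)) * conj P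
        + (e * P + (n - w) * C) * conj P₁))).re := by
  have hR := reaction_bound (y := g - w₁) hσ hβ ha hb hw₁ hg he hv hh (by linarith) h2 h3
    (by linarith) P Q C
  have hT := transport_bound hσ hα hε he hv hvα henα hw hwn P Q C P₁ Q₁ C₁
  have hF := forcing_bound hσ F G H P Q C
  have hid : (d * (P₂ * conj P + P₁ * conj P₁) + d * (Q₂ * conj Q + Q₁ * conj Q₁)
      + D * (C₂ * conj C + C₁ * conj C₁)
      - ((s * P + e * P₁ + ((m - w₁) * C + (n - w) * C₁)) * conj P
        + (e * P + (n - w) * C) * conj P₁) : ℂ)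
      = z * (P * conj P + Q * conj Q + C * conj C)
        + (d * (P₁ * conj P₁) + d * (Q₁ * conj Q₁) + D * (C₁ * conj C₁))
        - (F * conj P + G * conj Q + H * conj C)
        - (e * P * conj P₁ - w * C₁ * conj P + (n - w) * C * conj P₁ + v * Q₁ * conj Q)
        - ((-a * P + b * Q + (g - w₁ : ℝ) * C) * conj P + (a * P - b * Q - g * C) * conj Q
          + (-e * P + v * Q - h * C) * conj C) := by
    push_cast
    linear_combination conj P * eP + conj Q * eQ + conj C * eC
  rw [hid, mul_sub, mul_sub, mul_sub, mul_add (1 + (σ : ℂ) * Complex.I), Complex.sub_re,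
    Complex.sub_re, Complex.sub_re, Complex.add_re]
  have hz : ((1 + σ * Complex.I) * (z * (P * conj P + Q * conj Q + C * conj C))).re
      = (z.re - σ * z.im) * nrm P Q C ^ 2 := by
    rw [nrm_sq]
    simp only [Complex.mul_conj, ← Complex.sq_norm]
    rw [← Complex.ofReal_add, ← Complex.ofReal_add, ← mul_assoc, Complex.re_mul_ofReal]
    simp
  have hg1 : ((1 + σ * Complex.I) * (d * (P₁ * conj P₁) + d * (Q₁ * conj Q₁)
      + D * (C₁ * conj C₁))).re = d * ‖P₁‖ ^ 2 + d * ‖Q₁‖ ^ 2 + D * ‖C₁‖ ^ 2 := by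
    simp only [Complex.mul_conj, ← Complex.sq_norm]
    rw [← Complex.ofReal_mul, ← Complex.ofReal_mul, ← Complex.ofReal_mul, ← Complex.ofReal_add,
      ← Complex.ofReal_add, Complex.re_mul_ofReal]
    simp
  have hg2 : δ * nrm P₁ Q₁ C₁ ^ 2 ≤ d * ‖P₁‖ ^ 2 + d * ‖Q₁‖ ^ 2 + D * ‖C₁‖ ^ 2 := by
    rw [nrm_sq]
    nlinarith [mul_le_mul_of_nonneg_right hd (sq_nonneg ‖P₁‖),
      mul_le_mul_of_nonneg_right hd (sq_nonneg ‖Q₁‖),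
      mul_le_mul_of_nonneg_right hD (sq_nonneg ‖C₁‖)]
  rw [hz, hg1]
  linarith

/-! ### Bounds for the profile and the coefficients -/

theorem sum_sq_mulVec_le (M : Matrix (Fin 3) (Fin 3) ℝ) (x : Fin 3 → ℝ) :
    ∑ i, (M *ᵥ x) i ^ 2 ≤ opNorm M ^ 2 * ∑ i, x i ^ 2 := by
  have h := (Matrix.toEuclideanCLM (n := Fin 3) (𝕜 := ℝ) M).le_opNorm (WithLp.toLp 2 x)
  have h2 := pow_le_pow_left₀ (norm_nonneg _) h 2
  rw [mul_pow, EuclideanSpace.norm_sq_eq, EuclideanSpace.norm_sq_eq] at h2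
  simpa [opNorm, Matrix.toEuclideanCLM_toLp] using h2

theorem opNorm_nonneg (M : Matrix (Fin 3) (Fin 3) ℝ) : 0 ≤ opNorm M := norm_nonneg _

theorem opNorm_le_sum (M : Matrix (Fin 3) (Fin 3) ℝ) : opNorm M ≤ ∑ i, ∑ j, |M i j| := by
  refine ContinuousLinearMap.opNorm_le_bound _ (by positivity) fun x => ?_
  have hx : ∀ j, |x j| ≤ ‖x‖ := fun j => by simpa using PiLp.norm_apply_le x j
  have hsum : ‖(Matrix.toEuclideanCLM (n := Fin 3) (𝕜 := ℝ) M) x‖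
      ≤ ∑ i, |((Matrix.toEuclideanCLM (n := Fin 3) (𝕜 := ℝ) M) x) i| := by
    rw [EuclideanSpace.norm_eq]
    refine Real.sqrt_le_iff.2 ⟨by positivity, ?_⟩
    simpa using Finset.sum_sq_le_sq_sum_of_nonneg (s := Finset.univ)
      (f := fun i => |((Matrix.toEuclideanCLM (n := Fin 3) (𝕜 := ℝ) M) x) i|) (by simp)
  refine hsum.trans ?_
  rw [Finset.sum_mul]
  refine Finset.sum_le_sum fun i _ => ?_
  rw [Finset.sum_mul]
  have : ((Matrix.toEuclideanCLM (n := Fin 3) (𝕜 := ℝ) M) x) i = ∑ j, M i j * x j := rfl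
  rw [this]
  refine (Finset.abs_sum_le_sum_abs _ _).trans (Finset.sum_le_sum fun j _ => ?_)
  rw [abs_mul]
  exact mul_le_mul_of_nonneg_left (hx j) (abs_nonneg _)

/-- A partial row has Euclidean length at most the operator norm: `x` is row `i` of `M` with some
entries replaced by `0`, as the hypothesis `(M x)ᵢ = |x|²` says. -/
theorem partial_row_le {M : Matrix (Fin 3) (Fin 3) ℝ} {N : ℝ} (hN : opNorm M ≤ N) (i : Fin 3)
    (x : Fin 3 → ℝ) (hx : (M *ᵥ x) i = ∑ j, x j ^ 2) : ∑ j, x j ^ 2 ≤ N ^ 2 := by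
  have h := sum_sq_mulVec_le M x
  have h1 : (M *ᵥ x) i ^ 2 ≤ ∑ i, (M *ᵥ x) i ^ 2 :=
    Finset.single_le_sum (f := fun i => (M *ᵥ x) i ^ 2) (fun _ _ => sq_nonneg _) (Finset.mem_univ i)
  have h2 : opNorm M ^ 2 ≤ N ^ 2 := pow_le_pow_left₀ (opNorm_nonneg M) hN 2
  have h0 : 0 ≤ ∑ j, x j ^ 2 := by positivity
  rw [hx] at h1
  by_contra hlt
  push Not at hlt
  nlinarith [sq_nonneg N, mul_le_mul_of_nonneg_right h2 h0]

theorem coefA_bounds {P : Params} {U : Fin 3 → ℝ} {α : ℝ} (hα : opNorm (matA P U) ≤ α) :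
    P.v ≤ α ∧ (P.u * U 2) ^ 2 + (P.u * U 0) ^ 2 ≤ α ^ 2 := by
  have h1 := partial_row_le hα 1 ![0, P.v, 0] (by
    simp [matA, Matrix.mulVec, dotProduct, Fin.sum_univ_three, pow_two])
  have h2 := partial_row_le hα 0 ![-P.u * U 2, 0, -P.u * U 0] (by
    simp [matA, Matrix.mulVec, dotProduct, Fin.sum_univ_three, pow_two])
  simp [Fin.sum_univ_three] at h1 h2
  exact ⟨(abs_le_of_sq_le_sq' h1 ((opNorm_nonneg _).trans hα)).2, by nlinarith⟩

/-- The pairs of entries of `B` that the reaction inequality needs; each lies in one row or one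
column. -/
theorem linB_bounds {P : Params} {U W : Fin 3 → ℝ} {β : ℝ} (hβ : opNorm (linB P U W) ≤ β) :
    (P.w * U 1 - P.u * W 0) ^ 2 + (P.w * U 1) ^ 2 ≤ β ^ 2 ∧ (P.u * U 2) ^ 2 + P.v ^ 2 ≤ β ^ 2 ∧
      P.f ^ 2 + (P.w * U 1) ^ 2 ≤ β ^ 2 ∧
      (P.w * U 2) ^ 2 + (P.w * U 1 - P.u * W 0) ^ 2 ≤ β ^ 2 := by
  have h1 := (sum_sq_mulVec_le (linB P U W) ![0, 0, 1]).trans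
    (mul_le_mul_of_nonneg_right (pow_le_pow_left₀ (opNorm_nonneg _) hβ 2) (by positivity))
  have h2 := partial_row_le hβ 2 ![-P.u * U 2, P.v, 0] (by
    simp [linB, Matrix.mulVec, dotProduct, Fin.sum_univ_three, pow_two])
  have h3 := partial_row_le hβ 1 ![P.f, 0, -P.w * U 1] (by
    simp [linB, Matrix.mulVec, dotProduct, Fin.sum_univ_three, pow_two])
  have h4 := partial_row_le hβ 0 ![0, P.w * U 2, P.w * U 1 - P.u * W 0] (by
    simp [linB, Matrix.mulVec, dotProduct, Fin.sum_univ_three, pow_two])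
  simp [linB, Matrix.mulVec, dotProduct, Fin.sum_univ_three] at h1 h2 h3 h4
  refine ⟨?_, ?_, ?_, ?_⟩ <;> nlinarith [sq_nonneg (-P.k - P.u * U 0)]

section Profile

variable {P : Params} {p₀ q₀ : ℝ} {bc : TubulinBC} {Ubar : ℝ → Fin 3 → ℝ} {Uplus : Fin 3 → ℝ}

theorem IsSteadyState.hasDerivWithinAt (hU : IsSteadyState P p₀ q₀ bc Ubar Uplus) {x : ℝ}
    (hx : 0 ≤ x) (i : Fin 3) :
    HasDerivWithinAt (fun t => Ubar t i) (profileDeriv Ubar x i) (Ici 0) x :=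
  hasDerivWithinAt_pi.1
    ((hU.contDiffOn.differentiableOn (by norm_num) x hx).hasDerivWithinAt) i

theorem IsSteadyState.contDiffOn_deriv (hU : IsSteadyState P p₀ q₀ bc Ubar Uplus) :
    ContDiffOn ℝ 1 (profileDeriv Ubar) (Ici 0) :=
  hU.contDiffOn.derivWithin (uniqueDiffOn_Ici 0) (by norm_num)

theorem IsSteadyState.hasDerivWithinAt_deriv (hU : IsSteadyState P p₀ q₀ bc Ubar Uplus) {x : ℝ}
    (hx : 0 ≤ x) (i : Fin 3) :
    HasDerivWithinAt (fun t => profileDeriv Ubar t i)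
      (derivWithin (profileDeriv Ubar) (Ici 0) x i) (Ici 0) x :=
  hasDerivWithinAt_pi.1
    ((hU.contDiffOn_deriv.differentiableOn (by norm_num) x hx).hasDerivWithinAt) i

theorem IsSteadyState.continuousOn (hU : IsSteadyState P p₀ q₀ bc Ubar Uplus) (i : Fin 3) :
    ContinuousOn (fun t => Ubar t i) (Ici 0) :=
  fun _ hx => (hU.hasDerivWithinAt hx i).continuousWithinAt

theorem IsSteadyState.continuousOn_deriv (hU : IsSteadyState P p₀ q₀ bc Ubar Uplus) (i : Fin 3) :
    ContinuousOn (fun t => profileDeriv Ubar t i) (Ici 0) :=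
  fun _ hx => (hU.hasDerivWithinAt_deriv hx i).continuousWithinAt

theorem IsSteadyState.exists_bound (hU : IsSteadyState P p₀ q₀ bc Ubar Uplus) :
    ∃ S, 0 ≤ S ∧ ∀ x, 0 ≤ x → ∀ i, |Ubar x i| ≤ S := by
  obtain ⟨R, hR⟩ := eventually_atTop.1
    (hU.tendsto.norm.eventually (gt_mem_nhds (lt_add_one ‖Uplus‖)))
  obtain ⟨K, hK⟩ := (isCompact_Icc (a := (0 : ℝ)) (b := R)).exists_bound_of_continuousOn
    (hU.contDiffOn.continuousOn.mono Icc_subset_Ici_self)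
  refine ⟨max K (‖Uplus‖ + 1), le_max_of_le_right (by positivity), fun x hx i => ?_⟩
  refine (norm_le_pi_norm (Ubar x) i).trans ?_
  rcases le_total x R with h | h
  · exact le_max_of_le_left (hK x ⟨hx, h⟩)
  · exact le_max_of_le_right (hR x h).le

/-- A bounded function `f` has a bounded derivative if `κ f' + φ` is Lipschitz and `φ` is
bounded: by the mean value theorem `f'` is bounded at some point of every unit interval. -/
theorem deriv_bounded_of_flux {f f' φ G' : ℝ → ℝ} {κ S S' M : ℝ} (hκ : 0 < κ)
    (hf : ∀ x, 0 ≤ x → HasDerivWithinAt f (f' x) (Ici 0) x)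
    (hG : ∀ x, 0 ≤ x → HasDerivWithinAt (fun t => κ * f' t + φ t) (G' x) (Ici 0) x)
    (hS : ∀ x, 0 ≤ x → |f x| ≤ S) (hS' : ∀ x, 0 ≤ x → |φ x| ≤ S')
    (hM : ∀ x, 0 < x → |G' x| ≤ M) {x : ℝ} (hx : 0 ≤ x) :
    |f' x| ≤ (κ * (2 * S) + 2 * S' + M) / κ := by
  have hat : ∀ {g : ℝ → ℝ} {g' y : ℝ}, HasDerivWithinAt g g' (Ici 0) y → x < y →
      HasDerivAt g g' y :=
    fun h hy => h.hasDerivAt (Ici_mem_nhds (hx.trans_lt hy))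
  have hsub : Icc x (x + 1) ⊆ Ici 0 := fun y hy => hx.trans hy.1
  obtain ⟨ξ, hξ, hξe⟩ := exists_hasDerivAt_eq_slope f f' (by linarith : x < x + 1)
    (fun y hy => ((hf y (hsub hy)).continuousWithinAt).mono hsub)
    (fun y hy => hat (hf y (hx.trans hy.1.le)) hy.1)
  have h1 : |f' ξ| ≤ 2 * S := by
    rw [hξe, add_sub_cancel_left, div_one]
    have h1 := hS x hx
    have h2 := hS (x + 1) (by linarith)
    rw [abs_le] at *
    constructor <;> linarith
  obtain ⟨ζ, hζ, hζe⟩ := exists_hasDerivAt_eq_slope (fun t => κ * f' t + φ t) G' hξ.1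
    (fun y hy => ((hG y (hx.trans hy.1)).continuousWithinAt).mono fun y hy => hx.trans hy.1)
    (fun y hy => hat (hG y (hx.trans hy.1.le)) hy.1)
  have h2 := hM ζ (hx.trans_lt hζ.1)
  have h3 := hS' x hx
  have h4 := hS' ξ (hx.trans hξ.1.le)
  have hξ2 := hξ.2
  have hpos : 0 < ξ - x := sub_pos.2 hξ.1
  rw [eq_div_iff hpos.ne'] at hζe
  have h5 : |G' ζ * (ξ - x)| ≤ M := by
    rw [abs_mul, abs_of_pos hpos]
    nlinarith [abs_nonneg (G' ζ)]
  rw [hζe] at h5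
  rw [le_div_iff₀ hκ, ← abs_of_pos hκ, ← abs_mul, abs_of_pos hκ]
  have h6 : |κ * f' ξ| ≤ κ * (2 * S) := by
    rw [abs_mul, abs_of_pos hκ]; exact mul_le_mul_of_nonneg_left h1 hκ.le
  rw [abs_le] at *
  rw [mul_comm (f' x)]
  constructor <;> linarith

/-- Each equation of the steady state system is of the form `(κ f' + φ)' = G` with `φ` and `G`
polynomials in the bounded profile; no decay of the derivatives is assumed. -/
theorem IsSteadyState.exists_bound_deriv (hU : IsSteadyState P p₀ q₀ bc Ubar Uplus) :
    ∃ S, 0 ≤ S ∧ ∀ x, 0 ≤ x → ∀ i, |profileDeriv Ubar x i| ≤ S := by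
  obtain ⟨S, hS0, hS⟩ := hU.exists_bound
  have hu := P.u_pos
  have hv := P.v_pos
  have hw := P.w_pos
  have hf := P.f_pos
  have hk := P.k_pos
  have hd := fun {x : ℝ} (hx : 0 ≤ x) (i : Fin 3) => hU.hasDerivWithinAt hx i
  have hd2 := fun {x : ℝ} (hx : 0 ≤ x) (i : Fin 3) => hU.hasDerivWithinAt_deriv hx i
  have hprod : ∀ x, 0 ≤ x → ∀ i j, |Ubar x i * Ubar x j| ≤ S ^ 2 := fun x hx i j => by
    rw [abs_mul, pow_two]
    exact mul_le_mul (hS x hx i) (hS x hx j) (abs_nonneg _) hS0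
  have hode : ∀ x : ℝ, 0 < x → ∀ i, _ := fun x hx i => congrFun (hU.ode x hx) i
  obtain ⟨K0, hB0⟩ : ∃ K, ∀ x, 0 ≤ x → |profileDeriv Ubar x 0| ≤ K :=
    ⟨_, fun x hx => deriv_bounded_of_flux (f := fun t => Ubar t 0) (κ := P.d)
    (φ := fun t => -P.u * (Ubar t 0 * Ubar t 2)) (S := S) (S' := P.u * S ^ 2)
    (M := P.f * S + P.w * S ^ 2) P.d_pos (fun _ hx => hd hx 0)
    (fun x hx => ((hd2 hx 0).const_mul P.d).add (((hd hx 0).mul (hd hx 2)).const_mul (-P.u)))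
    (fun x hx => hS x hx 0)
    (fun x hx => by
      rw [abs_mul, abs_neg, abs_of_pos hu]
      exact mul_le_mul_of_nonneg_left (hprod x hx 0 2) hu.le)
    (fun x hx => by
      have h0 := hode x hx 0
      simp [matA, matB, matC, dotProduct, Fin.sum_univ_three] at h0
      have h1 := hprod x hx.le 1 2
      have h2 := hS x hx.le 0
      have e : P.d * derivWithin (profileDeriv Ubar) (Ici 0) x 0 + -P.u *
          (profileDeriv Ubar x 0 * Ubar x 2 + Ubar x 0 * profileDeriv Ubar x 2)
          = P.f * Ubar x 0 - P.w * (Ubar x 1 * Ubar x 2) := by linarith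
      rw [e]
      rw [abs_le] at *
      constructor <;> nlinarith) (x := x) hx⟩
  obtain ⟨K1, hB1⟩ : ∃ K, ∀ x, 0 ≤ x → |profileDeriv Ubar x 1| ≤ K :=
    ⟨_, fun x hx => deriv_bounded_of_flux (f := fun t => Ubar t 1) (κ := P.d)
    (φ := fun t => P.v * Ubar t 1) (S := S) (S' := P.v * S)
    (M := P.f * S + P.w * S ^ 2) P.d_pos (fun x hx => hd hx 1)
    (fun x hx => ((hd2 hx 1).const_mul P.d).add ((hd hx 1).const_mul P.v))
    (fun x hx => hS x hx 1)
    (fun x hx => by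
      rw [abs_mul, abs_of_pos hv]
      exact mul_le_mul_of_nonneg_left (hS x hx 1) hv.le)
    (fun x hx => by
      have h0 := hode x hx 1
      simp [matA, matB, matC, dotProduct, Fin.sum_univ_three] at h0
      have h1 := hprod x hx.le 1 2
      have h2 := hS x hx.le 0
      have e : P.d * derivWithin (profileDeriv Ubar) (Ici 0) x 1 + P.v * profileDeriv Ubar x 1
          = -P.f * Ubar x 0 + P.w * (Ubar x 1 * Ubar x 2) := by linarith
      rw [e]
      rw [abs_le] at *
      constructor <;> nlinarith) (x := x) hx⟩
  obtain ⟨K2, hB2⟩ : ∃ K, ∀ x, 0 ≤ x → |profileDeriv Ubar x 2| ≤ K :=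
    ⟨_, fun x hx => deriv_bounded_of_flux (f := fun t => Ubar t 2) (κ := P.D)
    (φ := fun _ => 0) (S := S) (S' := 0)
    (M := P.u * S ^ 2 + P.v * S + P.k * S) P.D_pos (fun x hx => hd hx 2)
    (fun x hx => ((hd2 hx 2).const_mul P.D).add (hasDerivWithinAt_const x _ 0))
    (fun x hx => hS x hx 2)
    (fun x hx => by simp)
    (fun x hx => by
      have h0 := hode x hx 2
      simp [matA, matB, matC, dotProduct, Fin.sum_univ_three] at h0
      have h1 := hprod x hx.le 0 2
      have h2 := hS x hx.le 1
      have h3 := hS x hx.le 2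
      have e : P.D * derivWithin (profileDeriv Ubar) (Ici 0) x 2 + 0
          = P.u * (Ubar x 0 * Ubar x 2) - P.v * Ubar x 1 + P.k * Ubar x 2 := by linarith
      rw [e]
      rw [abs_le] at *
      constructor <;> nlinarith) (x := x) hx⟩
  refine ⟨max K0 (max K1 (max K2 0)),
    le_max_of_le_right (le_max_of_le_right (le_max_right _ _)), fun x hx i => ?_⟩
  fin_cases i
  · exact le_max_of_le_left (hB0 x hx)
  · exact le_max_of_le_right (le_max_of_le_left (hB1 x hx))
  · exact le_max_of_le_right (le_max_of_le_right (le_max_of_le_left (hB2 x hx)))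

theorem exists_bound_entries (hU : IsSteadyState P p₀ q₀ bc Ubar Uplus) :
    ∃ K, 0 ≤ K ∧ ∀ x, 0 ≤ x → ∀ i j, |coefA P Ubar x i j| ≤ K ∧ |coefB P Ubar x i j| ≤ K := by
  obtain ⟨S, hS0, hS⟩ := hU.exists_bound
  obtain ⟨T, hT0, hT⟩ := hU.exists_bound_deriv
  have hu := P.u_pos
  have hv := P.v_pos
  have hw := P.w_pos
  have hf := P.f_pos
  have hk := P.k_pos
  refine ⟨P.u * S + P.w * S + P.u * T + P.v + P.f + P.k, by positivity, fun x hx i j => ?_⟩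
  have hus : ∀ i, |P.u * Ubar x i| ≤ P.u * S := fun i => by
    rw [abs_mul, abs_of_pos hu]; exact mul_le_mul_of_nonneg_left (hS x hx i) hu.le
  have hws : ∀ i, |P.w * Ubar x i| ≤ P.w * S := fun i => by
    rw [abs_mul, abs_of_pos hw]; exact mul_le_mul_of_nonneg_left (hS x hx i) hw.le
  have hut : ∀ i, |P.u * profileDeriv Ubar x i| ≤ P.u * T := fun i => by
    rw [abs_mul, abs_of_pos hu]; exact mul_le_mul_of_nonneg_left (hT x hx i) hu.le
  have a0 := abs_le.1 (hus 0)
  have a2 := abs_le.1 (hus 2)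
  have b1 := abs_le.1 (hws 1)
  have b2 := abs_le.1 (hws 2)
  have c0 := abs_le.1 (hut 0)
  have c2 := abs_le.1 (hut 2)
  have s1 : 0 ≤ P.u * S := by positivity
  have s2 : 0 ≤ P.w * S := by positivity
  have s3 : 0 ≤ P.u * T := by positivity
  constructor <;> rw [abs_le] <;> fin_cases i <;> fin_cases j <;>
    simp [coefA, matA, coefB, linB] <;> constructor <;> linarith

theorem bddAbove_opNorm {M : ℝ → Matrix (Fin 3) (Fin 3) ℝ} {K : ℝ}
    (hK : ∀ x, 0 ≤ x → ∀ i j, |M x i j| ≤ K) :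
    BddAbove (range fun x : Ici (0 : ℝ) => opNorm (M x)) := by
  refine ⟨∑ _i : Fin 3, ∑ _j : Fin 3, K, ?_⟩
  rintro _ ⟨x, rfl⟩
  exact (opNorm_le_sum _).trans
    (Finset.sum_le_sum fun i _ => Finset.sum_le_sum fun j _ => hK x x.2 i j)

theorem opNorm_le_supNorm {M : ℝ → Matrix (Fin 3) (Fin 3) ℝ}
    (h : BddAbove (range fun x : Ici (0 : ℝ) => opNorm (M x))) {x : ℝ} (hx : 0 ≤ x) :
    opNorm (M x) ≤ supNorm M :=
  le_ciSup h ⟨x, hx⟩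

end Profile

/-! ### Calculus on the half-line -/

theorem continuous_extend {E : Type*} [TopologicalSpace E] {f : ℝ → E}
    (hf : ContinuousOn f (Ici 0)) : Continuous fun x => f (max x 0) :=
  hf.comp_continuous (continuous_id.max continuous_const) fun _ => mem_Ici.2 (le_max_right _ _)

theorem exists_primitive {E : Type*} [NormedAddCommGroup E] [NormedSpace ℝ E] [CompleteSpace E]
    {f : ℝ → E} (hf : ContinuousOn f (Ici 0)) :
    ∃ G : ℝ → E, G 0 = 0 ∧ ∀ x, 0 ≤ x → HasDerivWithinAt G (f x) (Ici 0) x := by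
  refine ⟨fun x => ∫ t in (0 : ℝ)..x, f (max t 0), by simp, fun x hx => ?_⟩
  have := ((continuous_extend hf).integral_hasStrictDerivAt 0 x).hasDerivAt
  rw [max_eq_left hx] at this
  exact this.hasDerivWithinAt

theorem le_of_hasDerivWithinAt_nonneg {f f' : ℝ → ℝ} {a b : ℝ} (ha : 0 ≤ a) (hab : a ≤ b)
    (hf : ∀ x, 0 ≤ x → HasDerivWithinAt f (f' x) (Ici 0) x)
    (h : ∀ x, a < x → x < b → 0 ≤ f' x) : f a ≤ f b := by
  have hsub : Icc a b ⊆ Ici 0 := fun x hx => ha.trans hx.1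
  refine monotoneOn_of_hasDerivWithinAt_nonneg (f' := f') (convex_Icc a b)
    (fun x hx => ((hf x (hsub hx)).continuousWithinAt).mono hsub) ?_ ?_ (left_mem_Icc.2 hab)
    (right_mem_Icc.2 hab) hab
  · intro x hx
    exact (hf x (hsub (interior_subset hx))).mono (interior_subset.trans hsub)
  · intro x hx
    rw [interior_Icc] at hx
    exact h x hx.1 hx.2

/-- The flux split. The function `w` solves the linear equation `w' = g - (g - n')₊ w / (n + ε)`
with `w 0 = n 0 + ε`. It stays between `0` and `n + ε`, and `g - w'` lies between `0` and the
positive part of `g - n'`: so replacing `n'` by `w'` never makes the corner entry `g - n'` of the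
reaction matrix negative, and does not increase its modulus. -/
theorem exists_flux_split {n n₁ g : ℝ → ℝ} {ε : ℝ} (hε : 0 < ε)
    (hn : ∀ x, 0 ≤ x → HasDerivWithinAt n (n₁ x) (Ici 0) x) (hn₁ : ContinuousOn n₁ (Ici 0))
    (hg : ContinuousOn g (Ici 0)) (hn0 : ∀ x, 0 ≤ x → 0 ≤ n x) (hg0 : ∀ x, 0 ≤ x → 0 ≤ g x) :
    ∃ w w₁ : ℝ → ℝ, (∀ x, 0 ≤ x → HasDerivWithinAt w (w₁ x) (Ici 0) x) ∧
      ∀ x, 0 ≤ x → 0 ≤ w x ∧ w x ≤ n x + ε ∧ 0 ≤ g x - w₁ x ∧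
        (g x - w₁ x) ^ 2 ≤ (g x - n₁ x) ^ 2 := by
  have hnc : ContinuousOn n (Ici 0) := fun x hx => (hn x hx).continuousWithinAt
  set r : ℝ → ℝ := fun x => max (g x - n₁ x) 0 with hr
  have hpos : ∀ x, 0 ≤ x → 0 < n x + ε := fun x hx => by linarith [hn0 x hx]
  obtain ⟨Φ, hΦ0, hΦ⟩ := exists_primitive (f := fun x => r x / (n x + ε))
    (((hg.sub hn₁).sup continuousOn_const).div (hnc.add continuousOn_const)
      fun x hx => (hpos x hx).ne')
  have hΦc : ContinuousOn Φ (Ici 0) := fun x hx => (hΦ x hx).continuousWithinAt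
  obtain ⟨G, hG0, hG⟩ := exists_primitive (f := fun x => g x * Real.exp (Φ x)) (hg.mul hΦc.rexp)
  set w : ℝ → ℝ := fun x => Real.exp (-Φ x) * (n 0 + ε + G x) with hw
  have hexp : ∀ x, Real.exp (-Φ x) * Real.exp (Φ x) = 1 := fun x => by
    rw [← Real.exp_add]; simp
  have hwd : ∀ x, 0 ≤ x → HasDerivWithinAt w (g x - r x / (n x + ε) * w x) (Ici 0) x := by
    intro x hx
    have h1 := (hΦ x hx).neg.exp.mul ((hG x hx).const_add (n 0 + ε))
    refine h1.congr_deriv ?_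
    simp only [hw]
    linear_combination g x * hexp x
  have hwexp : ∀ x, w x * Real.exp (Φ x) = n 0 + ε + G x := fun x => by
    simp only [hw]; linear_combination (n 0 + ε + G x) * hexp x
  have hGn : ∀ x, 0 ≤ x → 0 ≤ G x := fun x hx => by
    have := le_of_hasDerivWithinAt_nonneg le_rfl hx hG
      (fun y hy _ => mul_nonneg (hg0 y hy.le) (Real.exp_nonneg _))
    rwa [hG0] at this
  have hw0 : ∀ x, 0 ≤ x → 0 ≤ w x := fun x hx =>
    mul_nonneg (Real.exp_nonneg _) (by linarith [hGn x hx, hn0 0 le_rfl])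
  have hwn : ∀ x, 0 ≤ x → w x ≤ n x + ε := by
    intro x hx
    have hd : ∀ y, 0 ≤ y → HasDerivWithinAt (fun y => (n y + ε) * Real.exp (Φ y) - (n 0 + ε + G y))
        ((n₁ y + r y - g y) * Real.exp (Φ y)) (Ici 0) y := by
      intro y hy
      have h1 := (((hn y hy).add_const ε).mul (hΦ y hy).exp).sub ((hG y hy).const_add (n 0 + ε))
      refine h1.congr_deriv ?_
      field_simp [(hpos y hy).ne']
    have := le_of_hasDerivWithinAt_nonneg le_rfl hx hd (fun y _ _ => mul_nonneg
      (by linarith [le_max_left (g y - n₁ y) 0]) (Real.exp_nonneg _))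
    simp only [hΦ0, Real.exp_zero, hG0] at this
    rw [← hwexp x] at this
    have h2 : 0 ≤ (n x + ε - w x) * Real.exp (Φ x) := by linarith
    linarith [nonneg_of_mul_nonneg_left h2 (Real.exp_pos _)]
  refine ⟨w, _, hwd, fun x hx => ⟨hw0 x hx, hwn x hx, ?_, ?_⟩⟩
  · rw [sub_sub_cancel]
    exact mul_nonneg (div_nonneg (le_max_right _ _) (hpos x hx).le) (hw0 x hx)
  · rw [sub_sub_cancel]
    have h1 : r x / (n x + ε) * w x ≤ r x := by
      rw [div_mul_eq_mul_div, div_le_iff₀ (hpos x hx)]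
      exact mul_le_mul_of_nonneg_left (hwn x hx) (le_max_right _ _)
    have h0 : 0 ≤ r x / (n x + ε) * w x :=
      mul_nonneg (div_nonneg (le_max_right _ _) (hpos x hx).le) (hw0 x hx)
    have h2 : r x ≤ |g x - n₁ x| := max_le (le_abs_self _) (abs_nonneg _)
    rw [← sq_abs (g x - n₁ x)]
    exact pow_le_pow_left₀ h0 (h1.trans h2) 2

/-! ### Classical solutions of the resolvent equation -/

/-- The diffusion constants `(d, d, D)`. -/
def diffusion (P : Params) : Fin 3 → ℝ := ![P.d, P.d, P.D]

/-- The lower order part `A(x) U' + B(x) U` of the linearized operator. -/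
def lowerOrder (P : Params) (Ubar : ℝ → Fin 3 → ℝ) (x : ℝ) (U U₁ : Val) : Val :=
  WithLp.toLp 2 ((coefA P Ubar x).map Complex.ofReal *ᵥ U₁.ofLp
    + (coefB P Ubar x).map Complex.ofReal *ᵥ U.ofLp)

/-- Division by the diffusion constants. -/
def diffInv (P : Params) (V : Val) : Val := WithLp.toLp 2 fun i => V i / diffusion P i

/-- `U` is a twice differentiable solution of `(z - L) U = F` on `[0, ∞)` with derivative `U₁`,
which satisfies the boundary conditions and decays with `U₁` like `e^{-ηx}`. -/
structure IsClassicalSol (P : Params) (bc : TubulinBC) (Ubar : ℝ → Fin 3 → ℝ) (η : ℝ) (z : ℂ)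
    (F U U₁ : ℝ → Val) : Prop where
  deriv : ∀ x, 0 ≤ x → HasDerivWithinAt U (U₁ x) (Ici 0) x
  deriv₂ : ∀ x, 0 ≤ x → HasDerivWithinAt U₁
    (diffInv P (z • U x - F x - lowerOrder P Ubar x (U x) (U₁ x))) (Ici 0) x
  bc_pplus : U 0 0 = 0
  bc_pminus : U 0 1 = 0
  bc_c : match bc with
    | .dirichlet _ => U 0 2 = 0
    | .neumann => U₁ 0 2 = 0
  decay : ∃ M, ∀ x, 0 ≤ x → ‖U x‖ ≤ M * Real.exp (-η * x) ∧ ‖U₁ x‖ ≤ M * Real.exp (-η * x)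

theorem Params.delta_pos (P : Params) : 0 < min P.d P.D := lt_min P.d_pos P.D_pos

theorem diffusion_pos (P : Params) (i : Fin 3) : 0 < diffusion P i := by
  fin_cases i
  · exact P.d_pos
  · exact P.d_pos
  · exact P.D_pos

theorem delta_le_diffusion (P : Params) (i : Fin 3) : min P.d P.D ≤ diffusion P i := by
  fin_cases i
  · exact min_le_left _ _
  · exact min_le_left _ _
  · exact min_le_right _ _

theorem norm_apply_le_norm (V : Val) (i : Fin 3) : ‖V i‖ ≤ ‖V‖ := PiLp.norm_apply_le V i

theorem norm_le_of_apply_le {V : Val} {r : ℝ} (h : ∀ i, ‖V i‖ ≤ r) : ‖V‖ ≤ 3 * r := by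
  have hr : 0 ≤ r := (norm_nonneg _).trans (h 0)
  rw [EuclideanSpace.norm_eq]
  refine Real.sqrt_le_iff.2 ⟨by positivity, ?_⟩
  rw [Fin.sum_univ_three]
  have h2 := fun i => pow_le_pow_left₀ (norm_nonneg _) (h i) 2
  nlinarith [h2 0, h2 1, h2 2, sq_nonneg r]

theorem norm_diffInv_le (P : Params) (V : Val) : ‖diffInv P V‖ ≤ 3 * (‖V‖ / min P.d P.D) := by
  refine norm_le_of_apply_le fun i => ?_
  have : ‖diffInv P V i‖ = ‖V i‖ / diffusion P i := by
    simp [diffInv, abs_of_pos (diffusion_pos P i)]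
  rw [this]
  exact div_le_div₀ (norm_nonneg _) (norm_apply_le_norm V i) P.delta_pos (delta_le_diffusion P i)

theorem norm_lowerOrder_le {P : Params} {Ubar : ℝ → Fin 3 → ℝ} {K x : ℝ}
    (hK : ∀ i j, |coefA P Ubar x i j| ≤ K ∧ |coefB P Ubar x i j| ≤ K) (U U₁ : Val) :
    ‖lowerOrder P Ubar x U U₁‖ ≤ 9 * K * (‖U‖ + ‖U₁‖) := by
  have hsum : ∀ (M : Matrix (Fin 3) (Fin 3) ℝ) (V : Val) (i : Fin 3), (∀ i j, |M i j| ≤ K) →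
      ‖(M.map Complex.ofReal *ᵥ V.ofLp) i‖ ≤ 3 * (K * ‖V‖) := by
    intro M V i hM
    rw [Matrix.mulVec, dotProduct]
    refine (norm_sum_le _ _).trans ?_
    have : ∀ j, ‖M.map Complex.ofReal i j * V.ofLp j‖ ≤ K * ‖V‖ := fun j => by
      rw [norm_mul, Matrix.map_apply, Complex.norm_real, Real.norm_eq_abs]
      exact mul_le_mul (hM i j) (norm_apply_le_norm V j) (norm_nonneg _)
        ((abs_nonneg _).trans (hM i j))
    rw [Fin.sum_univ_three]
    linarith [this 0, this 1, this 2]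
  have := norm_le_of_apply_le (V := lowerOrder P Ubar x U U₁) (r := 3 * (K * ‖U₁‖) + 3 * (K * ‖U‖))
    fun i => (norm_add_le _ _).trans (add_le_add (hsum _ _ _ fun i j => (hK i j).1)
      (hsum _ _ _ fun i j => (hK i j).2))
  linarith

theorem norm_eq_nrm (V : Val) : ‖V‖ = nrm (V 0) (V 1) (V 2) := by
  rw [EuclideanSpace.norm_eq, Fin.sum_univ_three, nrm]

/-! ### The energy flux and the localized weight -/

theorem hasDerivWithinAt_apply {U : ℝ → Val} {U' : Val} {s : Set ℝ} {x : ℝ}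
    (h : HasDerivWithinAt U U' s x) (i : Fin 3) : HasDerivWithinAt (fun t => U t i) (U' i) s x :=
  (((EuclideanSpace.proj (𝕜 := ℂ) i).restrictScalars ℝ).hasFDerivAt
    (x := U x)).comp_hasDerivWithinAt x h

theorem hasDerivWithinAt_conj {f : ℝ → ℂ} {f' : ℂ} {s : Set ℝ} {x : ℝ}
    (h : HasDerivWithinAt f f' s x) : HasDerivWithinAt (fun t => conj (f t)) (conj f') s x :=
  (Complex.conjCLE.toContinuousLinearMap.hasFDerivAt (x := f x)).comp_hasDerivWithinAt x h

theorem hasDerivWithinAt_re {f : ℝ → ℂ} {f' : ℂ} {s : Set ℝ} {x : ℝ}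
    (h : HasDerivWithinAt f f' s x) : HasDerivWithinAt (fun t => (f t).re) f'.re s x :=
  (Complex.reCLM.hasFDerivAt (x := f x)).comp_hasDerivWithinAt x h

/-- The boundary term of the energy identity: the diffusive flux minus the transport flux
`e P + (n - w) C` of the first component, paired with the state. -/
def bdryTerm (d D e n w : ℝ) (P Q C P₁ Q₁ C₁ : ℂ) : ℂ :=
  d * (P₁ * conj P) + d * (Q₁ * conj Q) + D * (C₁ * conj C) - (e * P + (n - w) * C) * conj P

theorem norm_bdryTerm_le {d D e n w α ε : ℝ} (hd : 0 ≤ d) (hD : 0 ≤ D) (hα : 0 ≤ α) (hε : 0 ≤ ε)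
    (he : 0 ≤ e) (hen : e ^ 2 + n ^ 2 ≤ α ^ 2) (hw : 0 ≤ w) (hwn : w ≤ n + ε)
    (P Q C P₁ Q₁ C₁ : ℂ) :
    ‖bdryTerm d D e n w P Q C P₁ Q₁ C₁‖
      ≤ (2 * d + D + 2 * α + ε) * (nrm P Q C * (nrm P Q C + nrm P₁ Q₁ C₁)) := by
  have hX : ‖P‖ ≤ nrm P Q C ∧ ‖Q‖ ≤ nrm P Q C ∧ ‖C‖ ≤ nrm P Q C := by
    refine ⟨?_, ?_, ?_⟩ <;> refine Real.le_sqrt_of_sq_le ?_ <;>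
      nlinarith [sq_nonneg ‖P‖, sq_nonneg ‖Q‖, sq_nonneg ‖C‖]
  have hX₁ : ‖P₁‖ ≤ nrm P₁ Q₁ C₁ ∧ ‖Q₁‖ ≤ nrm P₁ Q₁ C₁ ∧ ‖C₁‖ ≤ nrm P₁ Q₁ C₁ := by
    refine ⟨?_, ?_, ?_⟩ <;> refine Real.le_sqrt_of_sq_le ?_ <;>
      nlinarith [sq_nonneg ‖P₁‖, sq_nonneg ‖Q₁‖, sq_nonneg ‖C₁‖]
  set X := nrm P Q C
  set X₁ := nrm P₁ Q₁ C₁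
  have hX0 : 0 ≤ X := nrm_nonneg _ _ _
  have hX₁0 : 0 ≤ X₁ := nrm_nonneg _ _ _
  have heα : e ≤ α := (abs_le_of_sq_le_sq' (by nlinarith) hα).2
  have hnα := abs_le_of_sq_le_sq' (show n ^ 2 ≤ α ^ 2 by nlinarith) hα
  have hnw : |n - w| ≤ α + ε := abs_le.2 ⟨by linarith, by linarith⟩
  have h1 : ‖bdryTerm d D e n w P Q C P₁ Q₁ C₁‖
      ≤ d * (X₁ * X) + d * (X₁ * X) + D * (X₁ * X) + (α * X + (α + ε) * X) * X := by
    refine (norm_sub_le _ _).trans (add_le_add ((norm_add₃_le ..).trans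
      (add_le_add (add_le_add ?_ ?_) ?_)) ?_)
    · simp only [norm_mul, Complex.norm_real, RCLike.norm_conj, Real.norm_eq_abs, abs_of_nonneg hd]
      gcongr <;> tauto
    · simp only [norm_mul, Complex.norm_real, RCLike.norm_conj, Real.norm_eq_abs, abs_of_nonneg hd]
      gcongr <;> tauto
    · simp only [norm_mul, Complex.norm_real, RCLike.norm_conj, Real.norm_eq_abs, abs_of_nonneg hD]
      gcongr <;> tauto
    · rw [norm_mul, RCLike.norm_conj]
      refine mul_le_mul ((norm_add_le _ _).trans (add_le_add ?_ ?_)) hX.1 (norm_nonneg _)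
        (by positivity)
      · rw [norm_mul, Complex.norm_real, Real.norm_eq_abs, abs_of_nonneg he]
        exact mul_le_mul heα hX.1 (norm_nonneg _) hα
      · rw [norm_mul, ← Complex.ofReal_sub, Complex.norm_real]
        exact mul_le_mul hnw hX.2.2 (norm_nonneg _) (by positivity)
  refine h1.trans ?_
  nlinarith [mul_nonneg hX0 hX₁0, mul_nonneg hX0 hX0, mul_nonneg hd (mul_nonneg hX0 hX0),
    mul_nonneg hD (mul_nonneg hX0 hX0), mul_nonneg hα (mul_nonneg hX0 hX₁0),
    mul_nonneg hε (mul_nonneg hX0 hX₁0)]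

/-- Absorption of all cross terms, with `s = α² / δ`: the gradient term uses half of `s`, which
leaves room for the errors `ε` and `ν K`. -/
theorem energy_absorb {α s δ ε κ γ X X₁ L : ℝ} (hδ : 0 < δ) (hα : 0 < α) (hs : 0 < s)
    (hsδ : s * δ = α ^ 2) (hγ : s ≤ γ) (hε : ε = α / 100) (hκα : κ ≤ α / 25)
    (hκs : κ ≤ s / 10) (hX : 0 ≤ X) (hX₁ : 0 ≤ X₁) :
    s / 10 * X ^ 2 + δ / 10 * X₁ ^ 2 - 10 / s * L ^ 2
      ≤ γ * X ^ 2 + δ * X₁ ^ 2 - √2 * (L * X) - √2 * (α + 2 * ε) * (X * X₁)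
        - κ * (X * (X + X₁)) := by
  have h2 : √2 ≤ 1.415 := Real.sqrt_le_iff.2 ⟨by norm_num, by norm_num⟩
  have hXX : 0 ≤ X * X₁ := mul_nonneg hX hX₁
  have h3 : √2 * (α + 2 * ε) * (X * X₁) + κ * (X * X₁) ≤ 3 / 2 * α * (X * X₁) := by
    rw [← add_mul]
    refine mul_le_mul_of_nonneg_right ?_ hXX
    subst hε
    nlinarith
  have h4 : 2 * α * (X * X₁) ≤ s * X ^ 2 + δ * X₁ ^ 2 := by
    have h5 : (2 * α * (X * X₁)) ^ 2 ≤ (s * X ^ 2 + δ * X₁ ^ 2) ^ 2 := by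
      have : (2 * α * (X * X₁)) ^ 2 = 4 * (s * δ) * (X * X₁) ^ 2 := by rw [hsδ]; ring
      rw [this]
      nlinarith [sq_nonneg (s * X ^ 2 - δ * X₁ ^ 2)]
    exact (abs_le_of_sq_le_sq' h5 (by positivity)).2
  have h6 : √2 * (L * X) ≤ s / 20 * X ^ 2 + 10 / s * L ^ 2 := by
    have h7 : 0 ≤ (s * X - 20 * (√2 / 2) * L) ^ 2 := sq_nonneg _
    have h8 : √2 ^ 2 = 2 := Real.sq_sqrt (by norm_num)
    have h9 : s / 20 * X ^ 2 + 10 / s * L ^ 2 - √2 * (L * X)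
        = (s * X - 20 * (√2 / 2) * L) ^ 2 / (20 * s) := by
      field_simp
      ring_nf
      rw [h8]
      ring
    have : 0 ≤ (s * X - 20 * (√2 / 2) * L) ^ 2 / (20 * s) := by positivity
    linarith
  have h10 : κ * X ^ 2 ≤ s / 10 * X ^ 2 := mul_le_mul_of_nonneg_right hκs (sq_nonneg _)
  have h11 : s * X ^ 2 ≤ γ * X ^ 2 := mul_le_mul_of_nonneg_right hγ (sq_nonneg _)
  nlinarith [mul_nonneg hδ.le (sq_nonneg X₁)]

/-- The exponential weight `e^{2ηx}`, localized near `x₀` by an integrable factor. -/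
def weight (η μ x₀ x : ℝ) : ℝ := Real.exp (2 * η * x) / (1 + (μ * (x - x₀)) ^ 2)

theorem weight_pos (η μ x₀ x : ℝ) : 0 < weight η μ x₀ x := by unfold weight; positivity

/-- The logarithmic derivative `θ` of the weight is small with `η` and `μ`. -/
theorem hasDerivAt_weight (η μ x₀ x : ℝ) : ∃ θ, |θ| ≤ 2 * |η| + |μ| ∧
    HasDerivAt (weight η μ x₀) (θ * weight η μ x₀ x) x := by
  set s := μ * (x - x₀) with hs
  refine ⟨2 * η - μ * (2 * s / (1 + s ^ 2)), ?_, ?_⟩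
  · have h1 : |2 * s / (1 + s ^ 2)| ≤ 1 := by
      rw [abs_div, abs_of_pos (by positivity : 0 < 1 + s ^ 2), div_le_one (by positivity), abs_le]
      constructor <;> nlinarith [sq_nonneg (s - 1), sq_nonneg (s + 1)]
    refine (abs_sub _ _).trans (add_le_add (by simp [abs_mul]) ?_)
    rw [abs_mul]
    nlinarith [abs_nonneg μ]
  · have h1 : HasDerivAt (fun x => Real.exp (2 * η * x)) (Real.exp (2 * η * x) * (2 * η * 1)) x :=
      ((hasDerivAt_id x).const_mul (2 * η)).exp
    have h2 : HasDerivAt (fun x => 1 + (μ * (x - x₀)) ^ 2) (2 * s ^ 1 * (μ * 1)) x :=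
      ((((hasDerivAt_id x).sub_const x₀).const_mul μ).pow 2).const_add 1
    have h3 := h1.div h2 (by positivity)
    refine h3.congr_deriv ?_
    unfold weight
    rw [← hs]
    field_simp

/-! ### The weighted energy estimate -/

section APriori

variable {P : Params} {p₀ q₀ : ℝ} {bc : TubulinBC} {Ubar : ℝ → Fin 3 → ℝ} {Uplus : Fin 3 → ℝ}

theorem diffInv_mul (P : Params) (V : Val) (i : Fin 3) :
    (diffusion P i : ℂ) * diffInv P V i = V i := by
  have : (diffusion P i : ℂ) ≠ 0 := Complex.ofReal_ne_zero.2 (diffusion_pos P i).ne'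
  simp [diffInv, mul_div_cancel₀, this]

theorem lowerOrder_apply (P : Params) (Ubar : ℝ → Fin 3 → ℝ) (x : ℝ) (U U₁ : Val) :
    lowerOrder P Ubar x U U₁ 0 = (-((P.u * Ubar x 2 : ℝ) : ℂ) * U₁ 0 - (P.u * Ubar x 0 : ℝ) * U₁ 2)
        + ((-(P.f : ℂ) - (P.u * profileDeriv Ubar x 2 : ℝ)) * U 0 + (P.w * Ubar x 2 : ℝ) * U 1
          + ((P.w * Ubar x 1 : ℝ) - (P.u * profileDeriv Ubar x 0 : ℝ)) * U 2) ∧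
    lowerOrder P Ubar x U U₁ 1 = P.v * U₁ 1
        + (P.f * U 0 - (P.w * Ubar x 2 : ℝ) * U 1 - (P.w * Ubar x 1 : ℝ) * U 2) ∧
    lowerOrder P Ubar x U U₁ 2 = -((P.u * Ubar x 2 : ℝ) : ℂ) * U 0 + P.v * U 1
        - (P.k + P.u * Ubar x 0 : ℝ) * U 2 := by
  refine ⟨?_, ?_, ?_⟩ <;>
    simp [lowerOrder, coefA, matA, coefB, linB, Matrix.mulVec, dotProduct,
      Fin.sum_univ_three, Matrix.map_apply] <;> ring

/-- `energy_pointwise` along a classical solution: the derivative of the boundary term dominates the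
energy density. -/
theorem energy_deriv (hU : IsSteadyState P p₀ q₀ bc Ubar Uplus) {η α β ε σ : ℝ} {z : ℂ}
    {F U U₁ : ℝ → Val} (hs : IsClassicalSol P bc Ubar η z F U U₁) {w w₁ : ℝ → ℝ}
    (hw : ∀ x, 0 ≤ x → HasDerivWithinAt w (w₁ x) (Ici 0) x)
    (hw' : ∀ x, 0 ≤ x → 0 ≤ w x ∧ w x ≤ P.u * Ubar x 0 + ε ∧ 0 ≤ P.w * Ubar x 1 - w₁ x ∧
        (P.w * Ubar x 1 - w₁ x) ^ 2 ≤ (P.w * Ubar x 1 - P.u * profileDeriv Ubar x 0) ^ 2)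
    (hσ : σ = 1 ∨ σ = -1) (hα0 : 0 ≤ α) (hβ0 : 0 < β) (hε : 0 ≤ ε)
    (hα : ∀ x, 0 ≤ x → opNorm (coefA P Ubar x) ≤ α)
    (hβ : ∀ x, 0 ≤ x → opNorm (coefB P Ubar x) ≤ β) {x : ℝ} (hx : 0 ≤ x) :
    ∃ y, HasDerivWithinAt (fun t => ((1 + σ * Complex.I) * bdryTerm P.d P.D (P.u * Ubar t 2)
        (P.u * Ubar t 0) (w t) (U t 0) (U t 1) (U t 2) (U₁ t 0) (U₁ t 1) (U₁ t 2)).re) y (Ici 0) x ∧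
      (z.re - σ * z.im - β) * ‖U x‖ ^ 2 + min P.d P.D * ‖U₁ x‖ ^ 2 - √2 * (‖F x‖ * ‖U x‖)
      - √2 * (α + 2 * ε) * (‖U x‖ * ‖U₁ x‖) ≤ y := by
  have dU := hasDerivWithinAt_apply (hs.deriv x hx)
  have dU₁ := hasDerivWithinAt_apply (hs.deriv₂ x hx)
  have de := ((hU.hasDerivWithinAt hx 2).const_mul P.u).ofReal_comp
  have dn := ((hU.hasDerivWithinAt hx 0).const_mul P.u).ofReal_comp
  have dw := (hw x hx).ofReal_comp
  have heq := diffInv_mul P (z • U x - F x - lowerOrder P Ubar x (U x) (U₁ x))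
  obtain ⟨l0, l1, l2⟩ := lowerOrder_apply P Ubar x (U x) (U₁ x)
  have e0 := heq 0
  have e1 := heq 1
  have e2 := heq 2
  set V := diffInv P (z • U x - F x - lowerOrder P Ubar x (U x) (U₁ x))
  simp only [PiLp.sub_apply, PiLp.smul_apply, smul_eq_mul] at e0 e1 e2
  rw [l0] at e0
  rw [l1] at e1
  rw [l2] at e2
  obtain ⟨hvα, hen⟩ := coefA_bounds (hα x hx)
  obtain ⟨b1, b2, b3, b4⟩ := linB_bounds (hβ x hx)
  obtain ⟨w0, wn, y0, y1⟩ := hw' x hx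
  have hnn := hU.nonneg x hx
  have key := energy_pointwise (P := U x 0) (Q := U x 1) (C := U x 2) (P₁ := U₁ x 0)
    (Q₁ := U₁ x 1) (C₁ := U₁ x 2) (P₂ := V 0) (Q₂ := V 1) (C₂ := V 2)
    (F := F x 0) (G := F x 1) (H := F x 2) (z := z) (a := P.f) (h := P.k + P.u * Ubar x 0)
    (s := P.u * profileDeriv Ubar x 2) hσ hα0 hβ0 hε (min_le_left P.d P.D) (min_le_right P.d P.D)
    P.f_pos.le (mul_nonneg P.w_pos.le (hnn 2)) (mul_nonneg P.w_pos.le (hnn 1))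
    (mul_nonneg P.u_pos.le (hnn 2)) P.v_pos.le
    (add_nonneg P.k_pos.le (mul_nonneg P.u_pos.le (hnn 0))) w0 wn y0 y1 hvα hen b1 b2 b3 b4
    (by rw [show (P.d : ℂ) = diffusion P 0 from rfl, e0]; ring)
    (by rw [show (P.d : ℂ) = diffusion P 1 from rfl, e1]; ring)
    (by rw [show (P.D : ℂ) = diffusion P 2 from rfl, e2])
  rw [← norm_eq_nrm, ← norm_eq_nrm, ← norm_eq_nrm] at key
  refine ⟨_, hasDerivWithinAt_re (HasDerivWithinAt.const_mul _
    (((((dU₁ 0).mul (hasDerivWithinAt_conj (dU 0))).const_mul (P.d : ℂ)).add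
      (((dU₁ 1).mul (hasDerivWithinAt_conj (dU 1))).const_mul (P.d : ℂ))).add
      (((dU₁ 2).mul (hasDerivWithinAt_conj (dU 2))).const_mul (P.D : ℂ)) |>.sub
      (((de.mul (dU 0)).add ((dn.sub dw).mul (dU 2))).mul (hasDerivWithinAt_conj (dU 0))))),
    key⟩

/-- The localized energy estimate: a bounded function `Z` whose derivative dominates the weighted
energy density. -/
theorem weighted_energy (hU : IsSteadyState P p₀ q₀ bc Ubar Uplus) {η μ α β s κ m x₀ : ℝ} {z : ℂ}
    {F U U₁ : ℝ → Val} (hs : IsClassicalSol P bc Ubar η z F U U₁)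
    (hα0 : 0 < α) (hβ0 : 0 < β) (hs0 : 0 < s) (hsδ : s * min P.d P.D = α ^ 2)
    (hα : ∀ x, 0 ≤ x → opNorm (coefA P Ubar x) ≤ α)
    (hβ : ∀ x, 0 ≤ x → opNorm (coefB P Ubar x) ≤ β)
    (hz : s + β < z.re + |z.im|) (hη : 0 < η) (hμ : 0 < μ)
    (hκ : κ = (2 * η + μ) * (√2 * (2 * P.d + P.D + 2 * α + α / 100)))
    (hκα : κ ≤ α / 25) (hκs : κ ≤ s / 10) (hF : ∀ x, 0 ≤ x → ‖F x‖ ≤ m * Real.exp (-η * x)) :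
    ∃ Z Z' : ℝ → ℝ, (∀ x, 0 ≤ x → HasDerivWithinAt Z (Z' x) (Ici 0) x) ∧
      (∀ x, 0 ≤ x → weight η μ x₀ x * (s / 10 * ‖U x‖ ^ 2 + min P.d P.D / 10 * ‖U₁ x‖ ^ 2) ≤ Z' x) ∧
      ∀ x, 0 ≤ x → |Z x| ≤ 20 / s * m ^ 2 / μ := by
  obtain ⟨σ, hσ, hσz⟩ : ∃ σ : ℝ, (σ = 1 ∨ σ = -1) ∧ |z.im| = -(σ * z.im) := by
    rcases abs_choice z.im with h | h
    · exact ⟨-1, Or.inr rfl, by rw [h]; ring⟩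
    · exact ⟨1, Or.inl rfl, by rw [h]; ring⟩
  obtain ⟨w, w₁, hw, hw'⟩ := exists_flux_split (n := fun x => P.u * Ubar x 0)
    (g := fun x => P.w * Ubar x 1) (ε := α / 100) (by positivity)
    (fun x hx => (hU.hasDerivWithinAt hx 0).const_mul P.u)
    ((hU.continuousOn_deriv 0).const_smul P.u) ((hU.continuousOn 1).const_smul P.w)
    (fun x hx => mul_nonneg P.u_pos.le (hU.nonneg x hx 0))
    (fun x hx => mul_nonneg P.w_pos.le (hU.nonneg x hx 1))
  have hder := fun x hx => energy_deriv (x := x) hU hs hw hw' hσ hα0.le hβ0 (by positivity) hα hβ hx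
  set Bd : ℝ → ℝ := fun t => ((1 + σ * Complex.I) * bdryTerm P.d P.D (P.u * Ubar t 2)
    (P.u * Ubar t 0) (w t) (U t 0) (U t 1) (U t 2) (U₁ t 0) (U₁ t 1) (U₁ t 2)).re with hBd
  choose! y hy hyle using hder
  have hBd_le : ∀ x, 0 ≤ x → |Bd x| ≤ √2 * (2 * P.d + P.D + 2 * α + α / 100)
      * (‖U x‖ * (‖U x‖ + ‖U₁ x‖)) := by
    intro x hx
    refine (Complex.abs_re_le_norm _).trans ?_
    rw [norm_mul, norm_kappa hσ, mul_assoc]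
    refine mul_le_mul_of_nonneg_left ?_ (Real.sqrt_nonneg _)
    rw [norm_eq_nrm (U x), norm_eq_nrm (U₁ x)]
    exact norm_bdryTerm_le P.d_pos.le P.D_pos.le hα0.le (by positivity)
      (mul_nonneg P.u_pos.le (hU.nonneg x hx 2)) (coefA_bounds (hα x hx)).2 (hw' x hx).1
      (hw' x hx).2.1 _ _ _ _ _ _
  have hBd0 : Bd 0 = 0 := by
    have h3 : U₁ 0 2 * conj (U 0 2) = 0 := by
      have h := hs.bc_c
      cases bc with
      | dirichlet c => simp only at h; rw [h]; simp
      | neumann => simp only at h; rw [h]; simp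
    simp only [hBd, bdryTerm]
    rw [hs.bc_pplus, hs.bc_pminus, h3]
    simp
  choose θ hθ hρ using hasDerivAt_weight η μ x₀
  rw [abs_of_pos hη, abs_of_pos hμ] at hθ
  set ρ := weight η μ x₀ with hρdef
  have hρpos : ∀ x, 0 < ρ x := weight_pos η μ x₀
  -- the arctangent is a primitive of the localizing factor, and pays for the forcing term
  set Kf := 10 / s * m ^ 2 with hKf
  have hKf0 : 0 ≤ Kf := by positivity
  have hlow : ∀ x, 0 ≤ x → ρ x * (s / 10 * ‖U x‖ ^ 2 + min P.d P.D / 10 * ‖U₁ x‖ ^ 2)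
      ≤ θ x * ρ x * Bd x + ρ x * y x + Kf / μ * (1 / (1 + (μ * (x - x₀)) ^ 2) * μ) := by
    intro x hx
    have h1 := energy_absorb (X := ‖U x‖) (X₁ := ‖U₁ x‖) (L := ‖F x‖) (ε := α / 100) (κ := κ)
      (γ := z.re - σ * z.im - β) P.delta_pos hα0 hs0 hsδ (by linarith) rfl hκα hκs
      (norm_nonneg _) (norm_nonneg _)
    have h2 : |θ x * Bd x| ≤ κ * (‖U x‖ * (‖U x‖ + ‖U₁ x‖)) := by
      rw [abs_mul, hκ, mul_assoc]
      exact mul_le_mul (hθ x) (hBd_le x hx) (abs_nonneg _) (by positivity)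
    have h3 := (abs_le.1 h2).1
    have h4 := hyle x hx
    have h5 : ρ x * ‖F x‖ ^ 2 ≤ m ^ 2 / (1 + (μ * (x - x₀)) ^ 2) := by
      have h6 := pow_le_pow_left₀ (norm_nonneg _) (hF x hx) 2
      rw [hρdef, weight, div_mul_eq_mul_div]
      refine div_le_div_of_nonneg_right ?_ (by positivity)
      have h7 : Real.exp (2 * η * x) * Real.exp (-η * x) ^ 2 = 1 := by
        rw [← Real.exp_nat_mul, ← Real.exp_add]
        simp only [Nat.cast_ofNat]
        ring_nf
        simp
      calc Real.exp (2 * η * x) * ‖F x‖ ^ 2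
          ≤ Real.exp (2 * η * x) * (m * Real.exp (-η * x)) ^ 2 := by gcongr
        _ = m ^ 2 * (Real.exp (2 * η * x) * Real.exp (-η * x) ^ 2) := by ring
        _ = m ^ 2 := by rw [h7, mul_one]
    have h8 : Kf / μ * (1 / (1 + (μ * (x - x₀)) ^ 2) * μ)
        = 10 / s * (m ^ 2 / (1 + (μ * (x - x₀)) ^ 2)) := by
      rw [hKf]; field_simp
    rw [h8]
    have h9 := mul_le_mul_of_nonneg_left h5 (by positivity : 0 ≤ 10 / s)
    have h10 : s / 10 * ‖U x‖ ^ 2 + min P.d P.D / 10 * ‖U₁ x‖ ^ 2 - 10 / s * ‖F x‖ ^ 2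
        ≤ θ x * Bd x + y x := by linarith
    have h11 := mul_le_mul_of_nonneg_left h10 (hρpos x).le
    linarith
  have hZd : ∀ x, 0 ≤ x → HasDerivWithinAt
      (fun x => ρ x * Bd x + Kf / μ * Real.arctan (μ * (x - x₀)))
      (θ x * ρ x * Bd x + ρ x * y x + Kf / μ * (1 / (1 + (μ * (x - x₀)) ^ 2) * μ)) (Ici 0) x := by
    intro x hx
    have h1 := (hρ x).hasDerivWithinAt.mul (hy x hx)
    have h2 : HasDerivAt (fun x => Real.arctan (μ * (x - x₀)))
        (1 / (1 + (μ * (x - x₀)) ^ 2) * (μ * 1)) x :=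
      (((hasDerivAt_id x).sub_const x₀).const_mul μ).arctan
    rw [mul_one] at h2
    exact h1.add (h2.hasDerivWithinAt.const_mul _)
  have hmono : ∀ a b : ℝ, 0 ≤ a → a ≤ b → _ := fun a b ha hab =>
    le_of_hasDerivWithinAt_nonneg ha hab hZd fun x hxa _ =>
      (mul_nonneg (hρpos x).le (add_nonneg (mul_nonneg (by positivity) (sq_nonneg _))
        (mul_nonneg (by have := P.delta_pos; positivity) (sq_nonneg _)))).trans
      (hlow x (ha.trans hxa.le))
  have hatan : ∀ t, |Real.arctan t| ≤ 2 := fun t => abs_le.2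
    ⟨by linarith [Real.neg_pi_div_two_lt_arctan t, Real.pi_lt_d2],
      by linarith [Real.arctan_lt_pi_div_two t, Real.pi_lt_d2]⟩
  have hKμ : 0 ≤ Kf / μ := by positivity
  have hend : 20 / s * m ^ 2 / μ = Kf / μ * 2 := by rw [hKf]; ring
  refine ⟨_, _, hZd, hlow, fun x hx => ?_⟩
  rw [hend]
  refine abs_le.2 ⟨?_, ?_⟩
  · have h1 := hmono 0 x le_rfl hx
    simp only [hBd0, mul_zero, zero_add] at h1
    have h2 := mul_le_mul_of_nonneg_left (abs_le.1 (hatan (μ * (0 - x₀)))).1 hKμ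
    linarith
  · -- the boundary term vanishes at infinity because the solution decays
    obtain ⟨M, hM⟩ := hs.decay
    set K₁ := √2 * (2 * P.d + P.D + 2 * α + α / 100)
    have hK₁ : 0 ≤ K₁ := by
      have := P.d_pos; have := P.D_pos; positivity
    have htend : Tendsto (fun R => K₁ * (2 * M ^ 2) / (1 + (μ * (R - x₀)) ^ 2) + Kf / μ * 2) atTop
        (𝓝 (0 + Kf / μ * 2)) := by
      refine Tendsto.add_const _ (Tendsto.const_div_atTop ?_ _)
      refine tendsto_atTop_add_const_left _ _ ((tendsto_pow_atTop two_ne_zero).comp ?_)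
      exact (tendsto_atTop_add_const_right _ (-x₀) tendsto_id).const_mul_atTop hμ
    rw [zero_add] at htend
    refine ge_of_tendsto htend ?_
    filter_upwards [eventually_ge_atTop x] with R hR
    have hR0 := hx.trans hR
    refine (hmono x R hx hR).trans (add_le_add ?_
      (mul_le_mul_of_nonneg_left (abs_le.1 (hatan _)).2 hKμ))
    obtain ⟨hM1, hM2⟩ := hM R hR0
    have h1 : ‖U R‖ * (‖U R‖ + ‖U₁ R‖)
        ≤ (M * Real.exp (-η * R)) * (M * Real.exp (-η * R) + M * Real.exp (-η * R)) :=
      mul_le_mul hM1 (add_le_add hM1 hM2) (by positivity) ((norm_nonneg _).trans hM1)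
    have h7 : Real.exp (2 * η * R) * Real.exp (-η * R) ^ 2 = 1 := by
      rw [← Real.exp_nat_mul, ← Real.exp_add]
      simp only [Nat.cast_ofNat]
      ring_nf
      simp
    have h2 : Bd R ≤ K₁ * (2 * M ^ 2 * Real.exp (-η * R) ^ 2) :=
      (le_abs_self _).trans ((hBd_le R hR0).trans
        (mul_le_mul_of_nonneg_left (h1.trans_eq (by ring)) hK₁))
    have h3 := mul_le_mul_of_nonneg_left h2 (hρpos R).le
    refine h3.trans_eq ?_
    rw [hρdef, weight]
    linear_combination K₁ * (2 * M ^ 2) / (1 + (μ * (R - x₀)) ^ 2) * h7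

end APriori

/-! ### The a priori estimate in the weighted supremum norm -/

section APriori

variable {P : Params} {p₀ q₀ : ℝ} {bc : TubulinBC} {Ubar : ℝ → Fin 3 → ℝ} {Uplus : Fin 3 → ℝ}

/-- A density `E` that changes at a controlled relative rate is bounded pointwise by its integral
over a unit interval; the integral enters through a function `J` with `E ≤ J'`. -/
theorem le_of_deriv_control {E E' J J' : ℝ → ℝ} {Λ f₀ x₀ : ℝ} (hx₀ : 0 ≤ x₀) (hf₀ : 0 ≤ f₀)
    (hΛ : 0 ≤ Λ) (hE0 : ∀ x, 0 ≤ E x)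
    (hE : ∀ x, 0 ≤ x → HasDerivWithinAt E (E' x) (Ici 0) x)
    (hJ : ∀ x, 0 ≤ x → HasDerivWithinAt J (J' x) (Ici 0) x)
    (hE' : ∀ x, x₀ < x → x < x₀ + 1 → -(Λ * E x + f₀) ≤ E' x)
    (hJ' : ∀ x, x₀ < x → x < x₀ + 1 → E x ≤ J' x) :
    E x₀ ≤ (1 + Λ) * (J (x₀ + 1) - J x₀) + f₀ := by
  have hd : ∀ x, 0 ≤ x → HasDerivWithinAt
      (fun x => (x₀ + 1 - x) * E x + (1 + Λ) * J x + f₀ * x)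
      (-1 * E x + (x₀ + 1 - x) * E' x + (1 + Λ) * J' x + f₀ * 1) (Ici 0) x := fun x hx =>
    ((((hasDerivWithinAt_id x _).const_sub (x₀ + 1)).mul (hE x hx)).add
      ((hJ x hx).const_mul _)).add ((hasDerivWithinAt_id x _).const_mul f₀)
  have h := le_of_hasDerivWithinAt_nonneg hx₀ (by linarith : x₀ ≤ x₀ + 1) hd (fun x h1 h2 => by
    have a1 := mul_le_mul_of_nonneg_left (hE' x h1 h2) (by linarith : 0 ≤ x₀ + 1 - x)
    have a2 := mul_le_mul_of_nonneg_left (hJ' x h1 h2) (by linarith : 0 ≤ 1 + Λ)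
    have a3 : 0 ≤ (x - x₀) * (Λ * E x + f₀) :=
      mul_nonneg (by linarith) (add_nonneg (mul_nonneg hΛ (hE0 x)) hf₀)
    linarith)
  simp only [sub_self, zero_mul, zero_add] at h
  linarith

theorem hasDerivWithinAt_norm_sq {U : ℝ → Val} {V : Val} {s : Set ℝ} {x : ℝ}
    (h : HasDerivWithinAt U V s x) :
    ∃ y, |y| ≤ 2 * (‖U x‖ * ‖V‖) ∧ HasDerivWithinAt (fun t => ‖U t‖ ^ 2) y s x := by
  refine ⟨2 * inner ℝ (U x) V, ?_, h.norm_sq⟩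
  rw [abs_mul, abs_two]
  exact mul_le_mul_of_nonneg_left (abs_real_inner_le_norm _ _) zero_le_two

/-- Young's inequality for the growth of `|U'|²` along the equation. -/
theorem growth_aux {R S : ℝ} (hR : 0 ≤ R) (hS : 0 ≤ S) (X Y f : ℝ) :
    Y * (R * X + f + 9 * S * (X + Y)) ≤ (R + 18 * S + 1) * (X ^ 2 + Y ^ 2) + f ^ 2 := by
  have hXY : X * Y ≤ X ^ 2 + Y ^ 2 := by nlinarith [sq_nonneg (X - Y)]
  have hYf : Y * f ≤ Y ^ 2 + f ^ 2 := by nlinarith [sq_nonneg (Y - f)]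
  have h1 := mul_le_mul_of_nonneg_left hXY hR
  have h2 := mul_le_mul_of_nonneg_left hXY hS
  have h3 := mul_nonneg hS (sq_nonneg X)
  linarith [sq_nonneg X]

/-- A weighted energy bound implies a pointwise bound with the same exponential rate. -/
theorem pointwise_of_weighted {η μ c B R S m x₀ : ℝ} {z : ℂ} {F U U₁ : ℝ → Val} {Z Z' : ℝ → ℝ}
    (hS0 : 0 ≤ S)
    (hS : ∀ x, 0 ≤ x → ∀ i j, |coefA P Ubar x i j| ≤ S ∧ |coefB P Ubar x i j| ≤ S)
    (hη : 0 < η) (hc0 : 0 < c) (hR : 0 ≤ R) (hzR : ‖z‖ ≤ R) (hm : 0 ≤ m)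
    (hF : ∀ x, 0 ≤ x → ‖F x‖ ≤ m * Real.exp (-η * x))
    (hsol : IsClassicalSol P bc Ubar η z F U U₁)
    (hZ : ∀ x, 0 ≤ x → HasDerivWithinAt Z (Z' x) (Ici 0) x)
    (hZ' : ∀ x, 0 ≤ x → weight η μ x₀ x * (c * (‖U x‖ ^ 2 + ‖U₁ x‖ ^ 2)) ≤ Z' x)
    (hZb : ∀ x, 0 ≤ x → |Z x| ≤ B * m ^ 2) (hx₀ : 0 ≤ x₀) :
    ‖U x₀‖ ^ 2 + ‖U₁ x₀‖ ^ 2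
      ≤ ((1 + (1 + 6 / min P.d P.D * (R + 18 * S + 1))) * ((1 + μ ^ 2) / c * (2 * B))
        + 6 / min P.d P.D) * (m * Real.exp (-η * x₀)) ^ 2 := by
  have hδ := P.delta_pos
  set δ := min P.d P.D
  set Λ := 1 + 6 / δ * (R + 18 * S + 1) with hΛ
  have hΛ0 : 0 ≤ Λ := by positivity
  choose! y₀ hy₀ hdy₀ using fun x hx => hasDerivWithinAt_norm_sq (hsol.deriv x hx)
  choose! y₁ hy₁ hdy₁ using fun x hx => hasDerivWithinAt_norm_sq (hsol.deriv₂ x hx)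
  set e := Real.exp (-η * x₀) with he
  have he0 : 0 < e := Real.exp_pos _
  have hexp : Real.exp (2 * η * x₀) * e ^ 2 = 1 := by
    rw [he, ← Real.exp_nat_mul, ← Real.exp_add]
    simp only [Nat.cast_ofNat]
    ring_nf
    simp
  have hFe : ∀ x, x₀ < x → ‖F x‖ ≤ m * e := fun x hx =>
    (hF x (hx₀.trans hx.le)).trans (mul_le_mul_of_nonneg_left
      (Real.exp_le_exp.2 (by nlinarith)) hm)
  have hE := le_of_deriv_control (E := fun x => ‖U x‖ ^ 2 + ‖U₁ x‖ ^ 2)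
    (J := fun x => (1 + μ ^ 2) / c * e ^ 2 * Z x) (Λ := Λ) (f₀ := 6 / δ * (m * e) ^ 2) hx₀
    (by positivity) hΛ0 (fun x => by positivity) (fun x hx => (hdy₀ x hx).add (hdy₁ x hx))
    (fun x hx => (hZ x hx).const_mul _)
    (fun x h1 h2 => by
      have hx := hx₀.trans h1.le
      have a0 := (abs_le.1 (hy₀ x hx)).1
      have a1 := (abs_le.1 (hy₁ x hx)).1
      have b1 := norm_diffInv_le P (z • U x - F x - lowerOrder P Ubar x (U x) (U₁ x))
      have b2 : ‖z • U x - F x - lowerOrder P Ubar x (U x) (U₁ x)‖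
          ≤ R * ‖U x‖ + m * e + 9 * S * (‖U x‖ + ‖U₁ x‖) := by
        refine (norm_sub_le _ _).trans (add_le_add ((norm_sub_le _ _).trans (add_le_add ?_
          (hFe x h1))) (norm_lowerOrder_le (hS x hx) _ _))
        rw [norm_smul]
        exact mul_le_mul_of_nonneg_right hzR (norm_nonneg _)
      have b3 := b1.trans (mul_le_mul_of_nonneg_left (div_le_div_of_nonneg_right b2 hδ.le)
        (by norm_num : (0 : ℝ) ≤ 3))
      have b4 := mul_le_mul_of_nonneg_left b3 (norm_nonneg (U₁ x))
      have hXY : ‖U x‖ * ‖U₁ x‖ ≤ (‖U x‖ ^ 2 + ‖U₁ x‖ ^ 2) / 2 := by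
        linarith [sq_nonneg (‖U x‖ - ‖U₁ x‖)]
      have b5 : ‖U₁ x‖ * (3 * ((R * ‖U x‖ + m * e + 9 * S * (‖U x‖ + ‖U₁ x‖)) / δ))
          ≤ 3 / δ * ((R + 18 * S + 1) * (‖U x‖ ^ 2 + ‖U₁ x‖ ^ 2) + (m * e) ^ 2) := by
        have : ‖U₁ x‖ * (3 * ((R * ‖U x‖ + m * e + 9 * S * (‖U x‖ + ‖U₁ x‖)) / δ))
            = 3 / δ * (‖U₁ x‖ * (R * ‖U x‖ + m * e + 9 * S * (‖U x‖ + ‖U₁ x‖))) := by ring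
        rw [this]
        refine mul_le_mul_of_nonneg_left ?_ (by positivity)
        exact growth_aux hR hS0 _ _ _
      have b6 : Λ * (‖U x‖ ^ 2 + ‖U₁ x‖ ^ 2) = ‖U x‖ ^ 2 + ‖U₁ x‖ ^ 2
          + 2 * (3 / δ * ((R + 18 * S + 1) * (‖U x‖ ^ 2 + ‖U₁ x‖ ^ 2))) := by rw [hΛ]; ring
      rw [b6]
      have b7 : 6 / δ * (m * e) ^ 2 = 2 * (3 / δ * (m * e) ^ 2) := by ring
      rw [b7]
      linarith)
    (fun x h1 h2 => by
      have hx := hx₀.trans h1.le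
      have hw : (1 + μ ^ 2)⁻¹ * Real.exp (2 * η * x₀) ≤ weight η μ x₀ x := by
        rw [weight, inv_mul_eq_div]
        refine div_le_div₀ (Real.exp_nonneg _) (Real.exp_le_exp.2 (by nlinarith)) (by positivity) ?_
        have : (x - x₀) ^ 2 ≤ 1 := pow_le_one₀ (by linarith) (by linarith)
        rw [mul_pow]
        linarith [mul_le_mul_of_nonneg_left this (sq_nonneg μ)]
      have h3 := hZ' x hx
      have h5 := (mul_le_mul_of_nonneg_right hw (by positivity)).trans h3
      have h6 := mul_le_mul_of_nonneg_left h5 (by positivity : 0 ≤ (1 + μ ^ 2) / c * e ^ 2)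
      refine le_trans (le_of_eq ?_) h6
      have : (1 + μ ^ 2) / c * e ^ 2 * ((1 + μ ^ 2)⁻¹ * Real.exp (2 * η * x₀)
          * (c * (‖U x‖ ^ 2 + ‖U₁ x‖ ^ 2)))
          = (Real.exp (2 * η * x₀) * e ^ 2) * (‖U x‖ ^ 2 + ‖U₁ x‖ ^ 2) := by
        field_simp
      rw [this, hexp, one_mul])
  refine hE.trans ?_
  have h1 := (abs_le.1 (hZb (x₀ + 1) (by linarith))).2
  have h2 := (abs_le.1 (hZb x₀ hx₀)).1
  have h3 : (1 + μ ^ 2) / c * e ^ 2 * Z (x₀ + 1) - (1 + μ ^ 2) / c * e ^ 2 * Z x₀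
      ≤ (1 + μ ^ 2) / c * e ^ 2 * (2 * (B * m ^ 2)) := by
    rw [← mul_sub]
    refine mul_le_mul_of_nonneg_left ?_ (by positivity)
    linarith
  have h4 := mul_le_mul_of_nonneg_left h3 (by positivity : 0 ≤ 1 + Λ)
  refine (add_le_add_left h4 _).trans_eq ?_
  rw [hΛ]
  ring

/-- The a priori estimate in the weighted sup norm. The threshold for the weight does not depend
on `z`, and the constant is uniform for bounded `z`. -/
theorem exists_apriori (hU : IsSteadyState P p₀ q₀ bc Ubar Uplus) :
    ∃ η₀ : ℝ, 0 < η₀ ∧ ∀ η, 0 < η → η < η₀ → ∀ R, 0 ≤ R → ∃ K, 0 ≤ K ∧ ∀ z : ℂ,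
      supNorm (coefA P Ubar) ^ 2 / min P.d P.D + supNorm (coefB P Ubar) < z.re + |z.im| →
      ‖z‖ ≤ R → ∀ (F U U₁ : ℝ → Val) (m : ℝ), 0 ≤ m →
      (∀ x, 0 ≤ x → ‖F x‖ ≤ m * Real.exp (-η * x)) → IsClassicalSol P bc Ubar η z F U U₁ →
      ∀ x, 0 ≤ x → ‖U x‖ ≤ K * m * Real.exp (-η * x) ∧ ‖U₁ x‖ ≤ K * m * Real.exp (-η * x) := by
  obtain ⟨S, hS0, hS⟩ := exists_bound_entries hU
  have hα := fun x hx => opNorm_le_supNorm (M := coefA P Ubar)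
    (bddAbove_opNorm fun x hx i j => (hS x hx i j).1) (x := x) hx
  have hβ := fun x hx => opNorm_le_supNorm (M := coefB P Ubar)
    (bddAbove_opNorm fun x hx i j => (hS x hx i j).2) (x := x) hx
  set α := supNorm (coefA P Ubar)
  set β := supNorm (coefB P Ubar)
  have hα0 : 0 < α := P.v_pos.trans_le (coefA_bounds (hα 0 le_rfl)).1
  have hβ0 : 0 < β := by
    have h1 := (linB_bounds (hβ 0 le_rfl)).2.1
    have h2 : 0 ≤ β := (opNorm_nonneg _).trans (hβ 0 le_rfl)
    have := P.v_pos
    exact h2.lt_of_ne fun h => by rw [← h] at h1; nlinarith [sq_nonneg (P.u * Ubar 0 2)]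
  have hδ := P.delta_pos
  have hd := P.d_pos
  have hD := P.D_pos
  set δ := min P.d P.D
  set s := α ^ 2 / δ with hs
  have hs0 : 0 < s := by positivity
  -- the bound for the boundary term relative to the energy density
  set K₁ := √2 * (2 * P.d + P.D + 2 * α + α / 100) with hK₁
  have hK₁0 : 0 < K₁ := by positivity
  set ν := min (α / 25) (s / 10) / K₁ with hν
  have hν0 : 0 < ν := div_pos (lt_min (by positivity) (by positivity)) hK₁0
  refine ⟨ν / 4, by positivity, fun η hη hην R hR => ?_⟩
  set μ := ν / 2 with hμ
  have hμ0 : 0 < μ := by positivity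
  set c := min (s / 10) (δ / 10) with hc
  have hc0 : 0 < c := lt_min (by positivity) (by positivity)
  set Λ := 1 + 6 / δ * (R + 18 * S + 1) with hΛ
  have hΛ0 : 0 ≤ Λ := by positivity
  -- the constant of `pointwise_of_weighted`
  set T := (1 + Λ) * ((1 + μ ^ 2) / c * (2 * (20 / s / μ))) + 6 / δ with hT
  have hT0 : 0 ≤ T := by positivity
  refine ⟨√T, Real.sqrt_nonneg _, fun z hz hzR F U U₁ m hm hF hsol x₀ hx₀ => ?_⟩
  have hκle : (2 * η + μ) * K₁ ≤ min (α / 25) (s / 10) := by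
    have h1 : (2 * η + μ) ≤ ν := by linarith
    exact (mul_le_mul_of_nonneg_right h1 hK₁0.le).trans_eq (div_mul_cancel₀ _ hK₁0.ne')
  obtain ⟨Z, Z', hZ, hZ', hZb⟩ := weighted_energy (x₀ := x₀) hU hsol hα0 hβ0 hs0
    (div_mul_cancel₀ _ hδ.ne') hα hβ hz hη hμ0 rfl (hκle.trans (min_le_left _ _))
    (hκle.trans (min_le_right _ _)) hF
  have hbound := pointwise_of_weighted (c := c) (B := 20 / s / μ) hS0 hS hη hc0 hR hzR hm hF hsol hZ
    (fun x hx => (mul_le_mul_of_nonneg_left (by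
      rw [mul_add]
      exact add_le_add (mul_le_mul_of_nonneg_right (min_le_left _ _) (sq_nonneg _))
        (mul_le_mul_of_nonneg_right (min_le_right _ _) (sq_nonneg _)))
      (weight_pos _ _ _ _).le).trans (hZ' x hx))
    (fun x hx => (hZb x hx).trans_eq (by ring)) hx₀
  set e := Real.exp (-η * x₀) with he
  have he0 : 0 < e := Real.exp_pos _
  have hfin : ∀ t : ℝ, 0 ≤ t → t ^ 2 ≤ T * (m * e) ^ 2 → t ≤ √T * m * e := by
    intro t ht h
    refine (abs_le_of_sq_le_sq' ?_ (by positivity)).2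
    rw [mul_assoc, mul_pow, Real.sq_sqrt hT0]
    exact h
  exact ⟨hfin _ (norm_nonneg _) (by linarith [sq_nonneg ‖U₁ x₀‖]),
    hfin _ (norm_nonneg _) (by linarith [sq_nonneg ‖U x₀‖])⟩

end APriori

/-! ### The Green function of `r² - ∂²` on the half-line -/

/-- `f` is continuous on `[0, ∞)` and bounded there by `m e^{-ηx}`. -/
structure IsDecaying {E : Type*} [NormedAddCommGroup E] (η m : ℝ) (f : ℝ → E) : Prop where
  cont : ContinuousOn f (Ici 0)
  bound : ∀ x, 0 ≤ x → ‖f x‖ ≤ m * Real.exp (-η * x)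

theorem IsDecaying.nonneg {E : Type*} [NormedAddCommGroup E] {η m : ℝ} {f : ℝ → E}
    (h : IsDecaying η m f) : 0 ≤ m := by
  simpa using (norm_nonneg _).trans (h.bound 0 le_rfl)

/-- The causal part `∫₀ˣ e^{-r(x-t)} f(t) dt` of the Green function. -/
def greenFwd (r : ℝ) (f : ℝ → ℂ) (x : ℝ) : ℂ :=
  Real.exp (-r * x) • ∫ t in (0 : ℝ)..x, Real.exp (r * t) • f (max t 0)

/-- The anticausal part `∫ₓ^∞ e^{-r(t-x)} f(t) dt` of the Green function. -/
def greenBwd (r : ℝ) (f : ℝ → ℂ) (x : ℝ) : ℂ :=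
  Real.exp (r * x) • ∫ t in Ioi x, Real.exp (-r * t) • f (max t 0)

section Green

variable {r η m m' : ℝ} {f g : ℝ → ℂ}

theorem norm_exp_smul_le (a : ℝ) (hf : IsDecaying η m f) {t : ℝ} (ht : 0 ≤ t) :
    ‖Real.exp (a * t) • f (max t 0)‖ ≤ m * Real.exp ((a - η) * t) := by
  rw [norm_smul, Real.norm_eq_abs, Real.abs_exp, max_eq_left ht]
  refine (mul_le_mul_of_nonneg_left (hf.bound t ht) (Real.exp_nonneg _)).trans_eq ?_
  rw [mul_left_comm, ← Real.exp_add]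
  ring_nf

theorem continuous_exp_smul (a : ℝ) (hf : IsDecaying η m f) :
    Continuous fun t => Real.exp (a * t) • f (max t 0) :=
  (by fun_prop : Continuous fun t => Real.exp (a * t)).smul (continuous_extend hf.cont)

theorem integrableOn_greenBwd (hr : 0 < r + η) (hf : IsDecaying η m f) {x : ℝ} (hx : 0 ≤ x) :
    IntegrableOn (fun t => Real.exp (-r * t) • f (max t 0)) (Ioi x) := by
  refine Integrable.mono' ((integrableOn_exp_mul_Ioi (a := -r - η) (by linarith) x).const_mul m)
    (continuous_exp_smul (-r) hf).aestronglyMeasurable ?_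
  filter_upwards [ae_restrict_mem measurableSet_Ioi] with t ht
  exact norm_exp_smul_le (-r) hf (hx.trans (mem_Ioi.1 ht).le)

theorem hasDerivWithinAt_greenFwd (hf : IsDecaying η m f) {x : ℝ} (hx : 0 ≤ x) :
    HasDerivWithinAt (greenFwd r f) (f x - r * greenFwd r f x) (Ici 0) x := by
  have h1 := ((continuous_exp_smul r hf).integral_hasStrictDerivAt 0 x).hasDerivAt
  have h2 : HasDerivAt (fun x => Real.exp (-r * x)) (Real.exp (-r * x) * (-r * 1)) x :=
    ((hasDerivAt_id x).const_mul (-r)).exp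
  refine ((h2.smul h1).congr_deriv ?_).hasDerivWithinAt
  have h3 : Real.exp (-r * x) * Real.exp (r * x) = 1 := by rw [← Real.exp_add]; simp
  rw [smul_smul, h3, one_smul, max_eq_left hx, greenFwd]
  simp only [Complex.real_smul]
  push_cast
  ring

theorem hasDerivWithinAt_greenBwd (hr : 0 < r + η) (hf : IsDecaying η m f) {x : ℝ} (hx : 0 ≤ x) :
    HasDerivWithinAt (greenBwd r f) (r * greenBwd r f x - f x) (Ici 0) x := by
  have hint := integrableOn_greenBwd hr hf (le_refl (0 : ℝ))
  have heq : ∀ y, 0 ≤ y → greenBwd r f y = Real.exp (r * y) •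
      ((∫ t in Ioi (0 : ℝ), Real.exp (-r * t) • f (max t 0))
        - ∫ t in (0 : ℝ)..y, Real.exp (-r * t) • f (max t 0)) := fun y hy => by
    rw [← intervalIntegral.integral_Ioi_sub_Ioi hint hy, sub_sub_cancel, greenBwd]
  have h1 := ((continuous_exp_smul (-r) hf).integral_hasStrictDerivAt 0 x).hasDerivAt
  have h2 : HasDerivAt (fun x => Real.exp (r * x)) (Real.exp (r * x) * (r * 1)) x :=
    ((hasDerivAt_id x).const_mul r).exp
  refine ((h2.smul (h1.const_sub _)).congr_deriv ?_).hasDerivWithinAt.congr heq (heq x hx)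
  have h3 : Real.exp (r * x) * Real.exp (-r * x) = 1 := by rw [← Real.exp_add]; simp
  rw [smul_neg, smul_smul, h3, one_smul, max_eq_left hx, heq x hx]
  simp only [Complex.real_smul]
  push_cast
  ring

theorem norm_greenFwd_le (hr : η < r) (hf : IsDecaying η m f) {x : ℝ} (hx : 0 ≤ x) :
    ‖greenFwd r f x‖ ≤ m / (r - η) * Real.exp (-η * x) := by
  have hpos : 0 < r - η := by linarith
  have hd : ∀ t : ℝ, HasDerivAt (fun t => m / (r - η) * Real.exp ((r - η) * t))
      (m * Real.exp ((r - η) * t)) t := fun t => by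
    have := (((hasDerivAt_id t).const_mul (r - η)).exp).const_mul (m / (r - η))
    refine this.congr_deriv ?_
    simp only [id]
    field_simp
  have hc : Continuous fun t => m * Real.exp ((r - η) * t) := by fun_prop
  have h1 : ‖∫ t in (0 : ℝ)..x, Real.exp (r * t) • f (max t 0)‖
      ≤ m / (r - η) * Real.exp ((r - η) * x) := by
    refine (intervalIntegral.norm_integral_le_of_norm_le hx
      (g := fun t => m * Real.exp ((r - η) * t))
      (ae_of_all _ fun t ht => norm_exp_smul_le r hf ht.1.le) (hc.intervalIntegrable _ _)).trans ?_
    rw [intervalIntegral.integral_eq_sub_of_hasDerivAt (fun t _ => hd t)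
      (hc.intervalIntegrable _ _)]
    have := div_nonneg hf.nonneg hpos.le
    simp only [mul_zero, Real.exp_zero]
    linarith
  rw [greenFwd, norm_smul, Real.norm_eq_abs, Real.abs_exp]
  refine (mul_le_mul_of_nonneg_left h1 (Real.exp_nonneg _)).trans_eq ?_
  rw [mul_left_comm, ← Real.exp_add]
  ring_nf

theorem norm_greenBwd_le (hr : 0 < r + η) (hf : IsDecaying η m f) {x : ℝ} (hx : 0 ≤ x) :
    ‖greenBwd r f x‖ ≤ m / (r + η) * Real.exp (-η * x) := by
  have h1 : ‖∫ t in Ioi x, Real.exp (-r * t) • f (max t 0)‖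
      ≤ ∫ t in Ioi x, m * Real.exp ((-r - η) * t) :=
    norm_integral_le_of_norm_le
      ((integrableOn_exp_mul_Ioi (a := -r - η) (by linarith) x).const_mul m)
      ((ae_restrict_mem measurableSet_Ioi).mono fun t ht =>
        norm_exp_smul_le (-r) hf (hx.trans (mem_Ioi.1 ht).le))
  rw [integral_const_mul, integral_exp_mul_Ioi (by linarith)] at h1
  rw [greenBwd, norm_smul, Real.norm_eq_abs, Real.abs_exp]
  refine (mul_le_mul_of_nonneg_left h1 (Real.exp_nonneg _)).trans_eq ?_
  have h2 : Real.exp (-η * x) = Real.exp (r * x) * Real.exp ((-r - η) * x) := by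
    rw [← Real.exp_add]; ring_nf
  rw [h2, show -r - η = -(r + η) by ring, neg_div_neg_eq]
  ring

theorem greenFwd_sub (hf : IsDecaying η m f) (hg : IsDecaying η m' g) (x : ℝ) :
    greenFwd r (fun t => f t - g t) x = greenFwd r f x - greenFwd r g x := by
  simp only [greenFwd, smul_sub]
  rw [intervalIntegral.integral_sub ((continuous_exp_smul r hf).intervalIntegrable _ _)
    ((continuous_exp_smul r hg).intervalIntegrable _ _), smul_sub]

theorem greenBwd_sub (hr : 0 < r + η) (hf : IsDecaying η m f) (hg : IsDecaying η m' g) {x : ℝ}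
    (hx : 0 ≤ x) :
    greenBwd r (fun t => f t - g t) x = greenBwd r f x - greenBwd r g x := by
  simp only [greenBwd, smul_sub]
  rw [integral_sub (integrableOn_greenBwd hr hf hx) (integrableOn_greenBwd hr hg hx), smul_sub]

/-- The bounded solution of `r² u - u'' = f` with `u(0) = 0` (`τ = -1`) or `u'(0) = 0` (`τ = 1`). -/
def green (r τ : ℝ) (f : ℝ → ℂ) (x : ℝ) : ℂ :=
  (greenFwd r f x + greenBwd r f x + τ * (Real.exp (-r * x) * greenBwd r f 0)) / (2 * r)

/-- The derivative of `green`. -/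
def greenDeriv (r τ : ℝ) (f : ℝ → ℂ) (x : ℝ) : ℂ :=
  (-greenFwd r f x + greenBwd r f x - τ * (Real.exp (-r * x) * greenBwd r f 0)) / 2

theorem hasDerivWithinAt_green (τ : ℝ) (hr : 0 < r) (hη : 0 ≤ η) (hf : IsDecaying η m f) {x : ℝ}
    (hx : 0 ≤ x) :
    HasDerivWithinAt (green r τ f) (greenDeriv r τ f x) (Ici 0) x ∧
      HasDerivWithinAt (greenDeriv r τ f) (r ^ 2 * green r τ f x - f x) (Ici 0) x := by
  have hr' : (r : ℂ) ≠ 0 := Complex.ofReal_ne_zero.2 hr.ne'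
  have h1 := hasDerivWithinAt_greenFwd (r := r) hf hx
  have h2 := hasDerivWithinAt_greenBwd (r := r) (by linarith) hf hx
  have h3 : HasDerivWithinAt (fun x => ((Real.exp (-r * x) : ℝ) : ℂ))
      ((Real.exp (-r * x) * (-r * 1) : ℝ) : ℂ) (Ici 0) x :=
    (((hasDerivAt_id x).const_mul (-r)).exp).ofReal_comp.hasDerivWithinAt
  have h4 := (h3.mul_const (greenBwd r f 0)).const_mul (τ : ℂ)
  refine ⟨(((h1.add h2).add h4).div_const (2 * (r : ℂ))).congr_deriv ?_,
    (((h1.neg.add h2).sub h4).div_const 2).congr_deriv ?_⟩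
  · rw [greenDeriv]
    push_cast
    field_simp
    ring
  · rw [green]
    push_cast
    field_simp
    ring

theorem green_dirichlet : green r (-1) f 0 = 0 := by
  simp [green, greenFwd]

theorem greenDeriv_neumann : greenDeriv r 1 f 0 = 0 := by
  simp [greenDeriv, greenFwd]

theorem norm_green_le {τ : ℝ} (hτ : |τ| ≤ 1) (hη : 0 ≤ η) (hr : η + 1 ≤ r) (hf : IsDecaying η m f)
    {x : ℝ} (hx : 0 ≤ x) :
    ‖green r τ f x‖ ≤ 3 / (r - η) * m * Real.exp (-η * x) ∧
      ‖greenDeriv r τ f x‖ ≤ 3 / (r - η) * m * Real.exp (-η * x) := by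
  have hpos : 0 < r - η := by linarith
  set b := m / (r - η) * Real.exp (-η * x) with hb
  have hb0 : 0 ≤ b := mul_nonneg (div_nonneg hf.nonneg hpos.le) (Real.exp_nonneg _)
  have hm : m / (r + η) ≤ m / (r - η) :=
    div_le_div_of_nonneg_left hf.nonneg hpos (by linarith)
  have h1 : ‖greenFwd r f x‖ ≤ b := norm_greenFwd_le (by linarith) hf hx
  have h2 : ‖greenBwd r f x‖ ≤ b := (norm_greenBwd_le (by linarith) hf hx).trans
    (mul_le_mul_of_nonneg_right hm (Real.exp_nonneg _))
  have h3 : ‖(τ : ℂ) * ((Real.exp (-r * x) : ℝ) * greenBwd r f 0)‖ ≤ b := by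
    have h4 := norm_greenBwd_le (r := r) (by linarith) hf (le_refl (0 : ℝ))
    rw [mul_zero, Real.exp_zero, mul_one] at h4
    rw [norm_mul, norm_mul, Complex.norm_real, Complex.norm_real, Real.norm_eq_abs,
      Real.norm_eq_abs, Real.abs_exp]
    have h5 : Real.exp (-r * x) ≤ Real.exp (-η * x) := Real.exp_le_exp.2 (by nlinarith)
    calc |τ| * (Real.exp (-r * x) * ‖greenBwd r f 0‖)
        ≤ 1 * (Real.exp (-η * x) * (m / (r - η))) := by
          refine mul_le_mul hτ (mul_le_mul h5 (h4.trans hm) (norm_nonneg _) (Real.exp_nonneg _))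
            (by positivity) zero_le_one
      _ = b := by rw [hb]; ring
  have h6 : 3 / (r - η) * m * Real.exp (-η * x) = 3 * b := by rw [hb]; ring
  rw [h6]
  constructor
  · have h7 : ‖(2 * (r : ℂ))‖ = 2 * r := by
      rw [norm_mul, Complex.norm_real, Real.norm_eq_abs, abs_of_pos (by linarith)]; simp
    rw [green, norm_div, h7, div_le_iff₀ (by linarith)]
    refine (norm_add₃_le ..).trans ?_
    nlinarith
  · rw [greenDeriv, norm_div, Complex.norm_ofNat, div_le_iff₀ (by norm_num)]
    refine (norm_sub_le _ _).trans ((add_le_add_left (norm_add_le _ _) _).trans ?_)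
    rw [norm_neg]
    linarith

theorem green_sub (τ : ℝ) (hr : 0 < r) (hη : 0 ≤ η) (hf : IsDecaying η m f)
    (hg : IsDecaying η m' g) {x : ℝ} (hx : 0 ≤ x) :
    green r τ (fun t => f t - g t) x = green r τ f x - green r τ g x ∧
      greenDeriv r τ (fun t => f t - g t) x = greenDeriv r τ f x - greenDeriv r τ g x := by
  have h1 := greenFwd_sub (r := r) hf hg x
  have h2 := greenBwd_sub (r := r) (by linarith) hf hg hx
  have h3 := greenBwd_sub (r := r) (by linarith) hf hg (le_refl (0 : ℝ))
  simp only [green, greenDeriv]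
  rw [h1, h2, h3]
  constructor <;> ring

end Green

/-! ### Contractions in the weighted space -/

/-- The contraction principle for maps of decaying functions. -/
theorem exists_fixed_point {W : Type*} [NormedAddCommGroup W] [NormedSpace ℝ W] [CompleteSpace W]
    {η θ : ℝ} (hθ0 : 0 ≤ θ) (hθ : θ < 1) (T : (ℝ → W) → ℝ → W)
    (hT : ∀ v m, IsDecaying η m v → ∃ m', IsDecaying η m' (T v))
    (hcontr : ∀ v v' m m' M, IsDecaying η m v → IsDecaying η m' v' →
      (∀ x, 0 ≤ x → ‖v x - v' x‖ ≤ M * Real.exp (-η * x)) →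
      ∀ x, 0 ≤ x → ‖T v x - T v' x‖ ≤ θ * M * Real.exp (-η * x)) :
    ∃ v m, IsDecaying η m v ∧ ∀ x, 0 ≤ x → T v x = v x := by
  have hexp : ∀ x : ℝ, Real.exp (η * x) * Real.exp (-η * x) = 1 := fun x => by
    rw [← Real.exp_add]; simp
  set dec : BoundedContinuousFunction ℝ≥0 W → ℝ → W :=
    fun φ x => Real.exp (-η * x) • φ x.toNNReal with hdec
  have hdecd : ∀ φ, IsDecaying η ‖φ‖ (dec φ) := fun φ => by
    refine ⟨Continuous.continuousOn ?_, fun x hx => ?_⟩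
    · exact (by fun_prop : Continuous fun x => Real.exp (-η * x)).smul
        (φ.continuous.comp continuous_real_toNNReal)
    · rw [hdec, norm_smul, Real.norm_eq_abs, Real.abs_exp, mul_comm]
      exact mul_le_mul_of_nonneg_right (φ.norm_coe_le_norm _) (Real.exp_nonneg _)
  choose! mT hmT using hT
  have hcont : ∀ φ, Continuous fun x : ℝ≥0 => Real.exp (η * x) • T (dec φ) x := fun φ =>
    (by fun_prop : Continuous fun x : ℝ≥0 => Real.exp (η * x)).smul
      ((hmT _ _ (hdecd φ)).cont.comp_continuous NNReal.continuous_coe fun x => x.2)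
  have hbd : ∀ φ (x : ℝ≥0), ‖Real.exp (η * x) • T (dec φ) x‖ ≤ mT (dec φ) ‖φ‖ := fun φ x => by
    rw [norm_smul, Real.norm_eq_abs, Real.abs_exp]
    refine (mul_le_mul_of_nonneg_left ((hmT _ _ (hdecd φ)).bound x x.2)
      (Real.exp_nonneg _)).trans_eq ?_
    rw [mul_left_comm, hexp, mul_one]
  set Ψ : BoundedContinuousFunction ℝ≥0 W → BoundedContinuousFunction ℝ≥0 W :=
    fun φ => BoundedContinuousFunction.ofNormedAddCommGroup _ (hcont φ) _ (hbd φ) with hΨ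
  have hΨc : ContractingWith ⟨θ, hθ0⟩ Ψ := by
    refine ⟨by exact_mod_cast hθ, LipschitzWith.of_dist_le_mul fun φ ψ => ?_⟩
    refine (BoundedContinuousFunction.dist_le (by positivity)).2 fun x => ?_
    have h1 := hcontr _ _ _ _ (dist φ ψ) (hdecd φ) (hdecd ψ) (fun y hy => by
      simp only [hdec]
      rw [← smul_sub, norm_smul, Real.norm_eq_abs, Real.abs_exp, mul_comm, ← dist_eq_norm]
      exact mul_le_mul_of_nonneg_right (BoundedContinuousFunction.dist_coe_le_dist _)
        (Real.exp_nonneg _)) x x.2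
    simp only [hΨ, BoundedContinuousFunction.coe_ofNormedAddCommGroup]
    rw [dist_eq_norm, ← smul_sub, norm_smul, Real.norm_eq_abs, Real.abs_exp]
    refine (mul_le_mul_of_nonneg_left h1 (Real.exp_nonneg _)).trans_eq ?_
    rw [mul_left_comm, hexp, mul_one]
    rfl
  refine ⟨dec (hΨc.fixedPoint Ψ), _, hdecd _, fun x hx => ?_⟩
  have h1 := congrArg (fun φ : BoundedContinuousFunction ℝ≥0 W => φ x.toNNReal)
    hΨc.fixedPoint_isFixedPt
  simp only [hΨ, BoundedContinuousFunction.coe_ofNormedAddCommGroup, Real.coe_toNNReal x hx] at h1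
  simp only [hdec]
  conv_rhs => rw [← h1]
  rw [smul_smul, mul_comm, hexp, one_smul]

/-! ### Solvability of the resolvent equation -/

section Existence

variable {P : Params} {p₀ q₀ : ℝ} {bc : TubulinBC} {Ubar : ℝ → Fin 3 → ℝ} {Uplus : Fin 3 → ℝ}

theorem lowerOrder_sub (x : ℝ) (U V U₁ V₁ : Val) :
    lowerOrder P Ubar x (U - V) (U₁ - V₁)
      = lowerOrder P Ubar x U U₁ - lowerOrder P Ubar x V V₁ := by
  simp only [lowerOrder, WithLp.ofLp_sub, Matrix.mulVec_sub, ← WithLp.toLp_sub]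
  congr 1
  abel

theorem diffInv_sub (V W : Val) : diffInv P (V - W) = diffInv P V - diffInv P W := by
  ext i
  simp [diffInv, sub_div]

theorem continuousOn_apply {V : ℝ → Val} {s : Set ℝ} :
    ContinuousOn V s ↔ ∀ i, ContinuousOn (fun x => V x i) s := by
  constructor
  · exact fun h i => (EuclideanSpace.proj (𝕜 := ℂ) i).continuous.comp_continuousOn h
  · exact fun h => (PiLp.continuous_toLp 2 fun _ : Fin 3 => ℂ).comp_continuousOn
      (continuousOn_pi.2 h)

theorem IsSteadyState.continuousOn_lowerOrder (hU : IsSteadyState P p₀ q₀ bc Ubar Uplus)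
    {U U₁ : ℝ → Val} (h : ContinuousOn U (Ici 0)) (h₁ : ContinuousOn U₁ (Ici 0)) :
    ContinuousOn (fun x => lowerOrder P Ubar x (U x) (U₁ x)) (Ici 0) := by
  have hc := continuousOn_apply.1 h
  have hc₁ := continuousOn_apply.1 h₁
  have hp : ∀ (a : ℝ) i, ContinuousOn (fun x => ((a * Ubar x i : ℝ) : ℂ)) (Ici 0) := fun a i =>
    Complex.continuous_ofReal.comp_continuousOn ((hU.continuousOn i).const_smul a)
  have hp₁ : ∀ (a : ℝ) i, ContinuousOn (fun x => ((a * profileDeriv Ubar x i : ℝ) : ℂ)) (Ici 0) :=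
    fun a i => Complex.continuous_ofReal.comp_continuousOn ((hU.continuousOn_deriv i).const_smul a)
  refine continuousOn_apply.2 fun i => ?_
  fin_cases i
  · refine ContinuousOn.congr ?_ fun x _ => (lowerOrder_apply P Ubar x (U x) (U₁ x)).1
    exact ((((hp _ 2).neg.mul (hc₁ 0)).sub ((hp _ 0).mul (hc₁ 2)))).add
      ((((continuousOn_const.sub (hp₁ _ 2)).mul (hc 0)).add ((hp _ 2).mul (hc 1))).add
        (((hp _ 1).sub (hp₁ _ 0)).mul (hc 2)))
  · refine ContinuousOn.congr ?_ fun x _ => (lowerOrder_apply P Ubar x (U x) (U₁ x)).2.1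
    exact (continuousOn_const.mul (hc₁ 1)).add
      (((continuousOn_const.mul (hc 0)).sub ((hp _ 2).mul (hc 1))).sub ((hp _ 1).mul (hc 2)))
  · refine ContinuousOn.congr ?_ fun x _ => (lowerOrder_apply P Ubar x (U x) (U₁ x)).2.2
    refine (((hp _ 2).neg.mul (hc 0)).add (continuousOn_const.mul (hc 1))).sub
      (ContinuousOn.mul ?_ (hc 2))
    push_cast
    exact continuousOn_const.add (by simpa using hp P.u 0)

theorem IsClassicalSol.sub {η : ℝ} {z : ℂ} {F U U₁ G V V₁ : ℝ → Val}
    (h : IsClassicalSol P bc Ubar η z F U U₁) (h' : IsClassicalSol P bc Ubar η z G V V₁) :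
    IsClassicalSol P bc Ubar η z (fun x => F x - G x) (fun x => U x - V x)
      fun x => U₁ x - V₁ x where
  deriv x hx := (h.deriv x hx).sub (h'.deriv x hx)
  deriv₂ x hx := by
    refine ((h.deriv₂ x hx).sub (h'.deriv₂ x hx)).congr_deriv ?_
    rw [lowerOrder_sub, ← diffInv_sub, smul_sub]
    congr 1
    abel
  bc_pplus := by simp [h.bc_pplus, h'.bc_pplus]
  bc_pminus := by simp [h.bc_pminus, h'.bc_pminus]
  bc_c := by
    have h1 := h.bc_c
    have h2 := h'.bc_c
    cases bc with
    | dirichlet c => simp only at h1 h2 ⊢; simp [h1, h2]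
    | neumann => simp only at h1 h2 ⊢; simp [h1, h2]
  decay := by
    obtain ⟨M, hM⟩ := h.decay
    obtain ⟨M', hM'⟩ := h'.decay
    refine ⟨M + M', fun x hx => ⟨?_, ?_⟩⟩
    · rw [add_mul]
      exact (norm_sub_le _ _).trans (add_le_add (hM x hx).1 (hM' x hx).1)
    · rw [add_mul]
      exact (norm_sub_le _ _).trans (add_le_add (hM x hx).2 (hM' x hx).2)

theorem IsClassicalSol.exists_isDecaying {η : ℝ} {z : ℂ} {F U U₁ : ℝ → Val}
    (h : IsClassicalSol P bc Ubar η z F U U₁) : ∃ M, IsDecaying η M U ∧ IsDecaying η M U₁ := by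
  obtain ⟨M, hM⟩ := h.decay
  exact ⟨M, ⟨fun x hx => (h.deriv x hx).continuousWithinAt, fun x hx => (hM x hx).1⟩,
    ⟨fun x hx => (h.deriv₂ x hx).continuousWithinAt, fun x hx => (hM x hx).2⟩⟩

/-- The resolvent equation at `z` has a classical solution for every decaying right side. -/
def Solvable (P : Params) (bc : TubulinBC) (Ubar : ℝ → Fin 3 → ℝ) (η : ℝ) (z : ℂ) : Prop :=
  ∀ F m, IsDecaying η m F → ∃ U U₁, IsClassicalSol P bc Ubar η z F U U₁

/-- The sign of the reflected part of the Green function: `-1` for a Dirichlet condition, `1` for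
a Neumann condition. -/
def bcSign (bc : TubulinBC) : Fin 3 → ℝ :=
  ![-1, -1, match bc with
    | .dirichlet _ => -1
    | .neumann => 1]

theorem abs_bcSign_le (bc : TubulinBC) (i : Fin 3) : |bcSign bc i| ≤ 1 := by
  fin_cases i <;> cases bc <;> simp [bcSign]

/-- `(T - C ∂²)⁻¹ H` with its derivative. -/
def diagResolvent (P : Params) (bc : TubulinBC) (T : ℝ) (H : ℝ → Val) (x : ℝ) : Val × Val :=
  (WithLp.toLp 2 fun i => green √(T / diffusion P i) (bcSign bc i) (fun t => diffInv P (H t) i) x,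
    WithLp.toLp 2 fun i =>
      greenDeriv √(T / diffusion P i) (bcSign bc i) (fun t => diffInv P (H t) i) x)

theorem isDecaying_diffInv {η m : ℝ} {H : ℝ → Val} (hH : IsDecaying η m H) (i : Fin 3) :
    IsDecaying η (3 / min P.d P.D * m) fun t => diffInv P (H t) i := by
  refine ⟨?_, fun x hx => ?_⟩
  · have : (fun t => diffInv P (H t) i) = fun t => H t i / (diffusion P i : ℂ) := by
      ext t; simp [diffInv]
    rw [this]
    exact (continuousOn_apply.1 hH.cont i).div_const _
  · refine (norm_apply_le_norm _ i).trans ((norm_diffInv_le P _).trans ?_)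
    have := mul_le_mul_of_nonneg_left (hH.bound x hx) (div_nonneg zero_le_three P.delta_pos.le)
    calc 3 * (‖H x‖ / min P.d P.D) = 3 / min P.d P.D * ‖H x‖ := by ring
      _ ≤ _ := this
      _ = _ := by ring

theorem norm_diagResolvent_le {η T ρ m : ℝ} {H : ℝ → Val} (hη : 0 ≤ η) (hρ : 1 ≤ ρ)
    (hT : ∀ i, η + ρ ≤ √(T / diffusion P i)) (hH : IsDecaying η m H) {x : ℝ} (hx : 0 ≤ x) :
    ‖diagResolvent P bc T H x‖ ≤ 27 / (ρ * min P.d P.D) * m * Real.exp (-η * x) := by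
  have hδ := P.delta_pos
  have hm := hH.nonneg
  have key := fun i => norm_green_le (r := √(T / diffusion P i)) (abs_bcSign_le bc i) hη
    (by linarith [hT i]) (isDecaying_diffInv (P := P) hH i) hx
  have hle : ∀ i, 3 / (√(T / diffusion P i) - η) * (3 / min P.d P.D * m) * Real.exp (-η * x)
      ≤ 3 / ρ * (3 / min P.d P.D * m) * Real.exp (-η * x) := fun i => by
    have : 3 / (√(T / diffusion P i) - η) ≤ 3 / ρ :=
      div_le_div_of_nonneg_left zero_le_three (by linarith) (by linarith [hT i])
    gcongr
  have heq : 27 / (ρ * min P.d P.D) * m * Real.exp (-η * x)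
      = 3 * (3 / ρ * (3 / min P.d P.D * m) * Real.exp (-η * x)) := by
    field_simp
    ring
  rw [heq]
  exact max_le (norm_le_of_apply_le fun i => (key i).1.trans (hle i))
    (norm_le_of_apply_le fun i => (key i).2.trans (hle i))

theorem hasDerivWithinAt_diagResolvent {η T m : ℝ} {H : ℝ → Val} (hη : 0 ≤ η) (hT : 0 < T)
    (hH : IsDecaying η m H) {x : ℝ} (hx : 0 ≤ x) :
    HasDerivWithinAt (fun t => (diagResolvent P bc T H t).1) (diagResolvent P bc T H x).2
        (Ici 0) x ∧
      HasDerivWithinAt (fun t => (diagResolvent P bc T H t).2)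
        (diffInv P ((T : ℂ) • (diagResolvent P bc T H x).1 - H x)) (Ici 0) x := by
  have key := fun i => hasDerivWithinAt_green (bcSign bc i)
    (Real.sqrt_pos.2 (div_pos hT (diffusion_pos P i))) hη (isDecaying_diffInv (P := P) hH i) hx
  have hpi : ∀ {V : ℝ → Fin 3 → ℂ} {V' : Fin 3 → ℂ},
      (∀ i, HasDerivWithinAt (fun t => V t i) (V' i) (Ici 0) x) →
      HasDerivWithinAt (fun t => (WithLp.toLp 2 (V t) : Val)) (WithLp.toLp 2 V') (Ici 0) x :=
    fun h => ((PiLp.continuousLinearEquiv 2 ℝ fun _ : Fin 3 => ℂ).symm.hasFDerivAt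
      ).comp_hasDerivWithinAt x (hasDerivWithinAt_pi.2 h)
  refine ⟨hpi fun i => (key i).1, (hpi fun i => (key i).2).congr_deriv ?_⟩
  ext i
  have hd : (diffusion P i : ℂ) ≠ 0 := Complex.ofReal_ne_zero.2 (diffusion_pos P i).ne'
  have hs : ((√(T / diffusion P i) : ℝ) : ℂ) ^ 2 = T / diffusion P i := by
    rw [← Complex.ofReal_pow, Real.sq_sqrt (div_pos hT (diffusion_pos P i)).le]
    push_cast
    rfl
  simp only [diffInv, diagResolvent, PiLp.sub_apply, PiLp.smul_apply, smul_eq_mul]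
  rw [hs]
  field_simp

theorem diagResolvent_sub {η T m m' : ℝ} {H G : ℝ → Val} (hη : 0 ≤ η) (hT : 0 < T)
    (hH : IsDecaying η m H) (hG : IsDecaying η m' G) {x : ℝ} (hx : 0 ≤ x) :
    diagResolvent P bc T (fun t => H t - G t) x
      = diagResolvent P bc T H x - diagResolvent P bc T G x := by
  have key := fun i => green_sub (bcSign bc i)
    (Real.sqrt_pos.2 (div_pos hT (diffusion_pos P i))) hη (isDecaying_diffInv (P := P) hH i)
    (isDecaying_diffInv (P := P) hG i) hx
  refine Prod.ext ?_ ?_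
  · ext i
    simp only [diagResolvent, diffInv_sub, Prod.fst_sub, PiLp.sub_apply]
    exact (key i).1
  · ext i
    simp only [diagResolvent, diffInv_sub, Prod.snd_sub, PiLp.sub_apply]
    exact (key i).2

/-- Far to the right in the plane the lower order terms are a small perturbation of the diagonal
operator `T - C ∂²`. -/
theorem solvable_of_large (hU : IsSteadyState P p₀ q₀ bc Ubar Uplus) {η : ℝ} (hη : 0 ≤ η) (z : ℂ) :
    ∃ T₀ : ℝ, ∀ T : ℝ, T₀ ≤ T → Solvable P bc Ubar η (z + T) := by
  obtain ⟨S, hS0, hS⟩ := exists_bound_entries hU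
  have hδ := P.delta_pos
  -- a bound for the lower order terms
  set κ := 18 * S + ‖z‖ with hκ
  have hκ0 : 0 ≤ κ := by positivity
  -- the rate of the Green function exceeds `η` by `ρ`, large enough for a contraction
  set ρ := 27 * κ / min P.d P.D + 1 with hρ
  have hρ1 : 1 ≤ ρ := by
    rw [hρ]
    linarith [div_nonneg (mul_nonneg (by norm_num : (0 : ℝ) ≤ 27) hκ0) hδ.le]
  have hd := P.d_pos
  have hD := P.D_pos
  refine ⟨(P.d + P.D) * (η + ρ) ^ 2, fun T hT F m₀ hF => ?_⟩
  have hT0 : 0 < T := lt_of_lt_of_le (by positivity) hT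
  have hTi : ∀ i, η + ρ ≤ √(T / diffusion P i) := fun i => by
    refine Real.le_sqrt_of_sq_le ?_
    rw [le_div_iff₀ (diffusion_pos P i), mul_comm]
    have : diffusion P i ≤ P.d + P.D := by fin_cases i <;> simp [diffusion] <;> linarith
    exact (mul_le_mul_of_nonneg_right this (sq_nonneg _)).trans hT
  -- the right side of `(T - C ∂²) U = F + A U' + B U - z U`
  set H : (ℝ → Val × Val) → ℝ → Val :=
    fun v x => F x + lowerOrder P Ubar x (v x).1 (v x).2 - z • (v x).1 with hH
  have hlow : ∀ (x : ℝ), 0 ≤ x → ∀ v : Val × Val,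
      ‖lowerOrder P Ubar x v.1 v.2 - z • v.1‖ ≤ κ * ‖v‖ := by
    intro x hx v
    have h1 := norm_lowerOrder_le (hS x hx) v.1 v.2
    have h2 : ‖v.1‖ ≤ ‖v‖ := norm_fst_le v
    have h3 : ‖v.2‖ ≤ ‖v‖ := norm_snd_le v
    refine (norm_sub_le _ _).trans ?_
    rw [norm_smul, hκ]
    have h4 := mul_le_mul_of_nonneg_left (add_le_add h2 h3) (by positivity : 0 ≤ 9 * S)
    have h5 := mul_le_mul_of_nonneg_left h2 (norm_nonneg z)
    linarith
  have hHd : ∀ v m, IsDecaying η m v → IsDecaying η (m₀ + κ * m) (H v) := by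
    intro v m hv
    refine ⟨?_, fun x hx => ?_⟩
    · exact (hF.cont.add (hU.continuousOn_lowerOrder (continuous_fst.comp_continuousOn hv.cont)
        (continuous_snd.comp_continuousOn hv.cont))).sub
        ((continuous_fst.comp_continuousOn hv.cont).const_smul z)
    · simp only [hH]
      rw [add_sub_assoc, add_mul, mul_assoc]
      exact (norm_add_le _ _).trans (add_le_add (hF.bound x hx) ((hlow x hx _).trans
        (mul_le_mul_of_nonneg_left (hv.bound x hx) hκ0)))
  have hcontD : ∀ G m, IsDecaying η m G → ContinuousOn (diagResolvent P bc T G) (Ici 0) :=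
    fun G m hG => ContinuousOn.prodMk
      (fun x hx => (hasDerivWithinAt_diagResolvent hη hT0 hG hx).1.continuousWithinAt)
      (fun x hx => (hasDerivWithinAt_diagResolvent hη hT0 hG hx).2.continuousWithinAt)
  have hθ : 27 / (ρ * min P.d P.D) * κ < 1 := by
    rw [div_mul_eq_mul_div, div_lt_one (by positivity), hρ, add_mul, div_mul_cancel₀ _ hδ.ne']
    linarith
  obtain ⟨v, m, hv, hfix⟩ := exists_fixed_point (η := η) (θ := 27 / (ρ * min P.d P.D) * κ)
    (by positivity) hθ (fun v => diagResolvent P bc T (H v))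
    (fun v m hv => ⟨_, hcontD _ _ (hHd v m hv), fun x hx =>
      norm_diagResolvent_le hη hρ1 hTi (hHd v m hv) hx⟩)
    (fun v v' m m' M hv hv' hM x hx => by
      change ‖diagResolvent P bc T (H v) x - diagResolvent P bc T (H v') x‖ ≤ _
      rw [← diagResolvent_sub hη hT0 (hHd v m hv) (hHd v' m' hv') hx]
      refine (norm_diagResolvent_le (m := κ * M) hη hρ1 hTi
        ⟨(hHd v m hv).cont.sub (hHd v' m' hv').cont, fun y hy => ?_⟩ hx).trans_eq (by ring)
      have : H v y - H v' y
          = lowerOrder P Ubar y (v y - v' y).1 (v y - v' y).2 - z • (v y - v' y).1 := by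
        simp only [hH, Prod.fst_sub, Prod.snd_sub, lowerOrder_sub, smul_sub]
        abel
      change ‖H v y - H v' y‖ ≤ _
      rw [this, mul_assoc]
      exact (hlow y hy _).trans (mul_le_mul_of_nonneg_left (hM y hy) hκ0))
  have hfix1 : ∀ x, 0 ≤ x → (diagResolvent P bc T (H v) x).1 = (v x).1 := fun x hx => by
    rw [hfix x hx]
  have hfix2 : ∀ x, 0 ≤ x → (diagResolvent P bc T (H v) x).2 = (v x).2 := fun x hx => by
    rw [hfix x hx]
  refine ⟨fun x => (diagResolvent P bc T (H v) x).1, fun x => (diagResolvent P bc T (H v) x).2,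
    ⟨fun x hx => (hasDerivWithinAt_diagResolvent hη hT0 (hHd v m hv) hx).1, fun x hx => ?_,
    green_dirichlet, green_dirichlet, ?_, m, fun x hx => ?_⟩⟩
  · refine (hasDerivWithinAt_diagResolvent hη hT0 (hHd v m hv) hx).2.congr_deriv ?_
    simp only [hH]
    rw [hfix1 x hx, hfix2 x hx, add_smul]
    congr 1
    abel
  · cases bc with
    | dirichlet c => exact green_dirichlet
    | neumann => exact greenDeriv_neumann
  · rw [hfix1 x hx, hfix2 x hx]
    exact ⟨(norm_fst_le _).trans (hv.bound x hx), (norm_snd_le _).trans (hv.bound x hx)⟩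

/-- One step of the continuity method: `(z - t - L) U = F` is a fixed point problem for the
resolvent at `z`, and `K` bounds the norm of that resolvent. -/
theorem solvable_sub {η K t : ℝ} {z : ℂ} (hz : Solvable P bc Ubar η z)
    (hK : ∀ (F U U₁ : ℝ → Val) (m : ℝ), 0 ≤ m → (∀ x, 0 ≤ x → ‖F x‖ ≤ m * Real.exp (-η * x)) →
      IsClassicalSol P bc Ubar η z F U U₁ → ∀ x, 0 ≤ x → ‖U x‖ ≤ K * m * Real.exp (-η * x))
    (hK0 : 0 ≤ K) (ht : 0 ≤ t) (htK : K * t < 1) : Solvable P bc Ubar η (z - t) := by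
  intro F m₀ hF
  have hz' : ∀ G : ℝ → Val, (∃ m, IsDecaying η m G) →
      ∃ U U₁, IsClassicalSol P bc Ubar η z G U U₁ := fun G ⟨m, hG⟩ => hz G m hG
  choose! sol sol₁ hsol using hz'
  have hdata : ∀ v m, IsDecaying η m v → IsDecaying η (m₀ + t * m) fun x => F x + t • v x := by
    intro v m hv
    refine ⟨hF.cont.add (hv.cont.const_smul t), fun x hx => ?_⟩
    rw [add_mul, mul_assoc]
    refine (norm_add_le _ _).trans (add_le_add (hF.bound x hx) ?_)
    rw [norm_smul, Real.norm_eq_abs, abs_of_nonneg ht]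
    exact mul_le_mul_of_nonneg_left (hv.bound x hx) ht
  obtain ⟨v, m, hv, hfix⟩ := exists_fixed_point (W := Val) (η := η) (θ := K * t) (by positivity) htK
    (fun (v : ℝ → Val) => sol fun x => F x + t • v x)
    (fun v m hv => by
      obtain ⟨M, hM, -⟩ := (hsol _ ⟨_, hdata v m hv⟩).exists_isDecaying
      exact ⟨M, hM⟩)
    (fun v v' m m' M hv hv' hM x hx => by
      have hM0 : 0 ≤ M := by simpa using (norm_nonneg _).trans (hM 0 le_rfl)
      have h := hK _ _ _ (t * M) (by positivity) (fun y hy => ?_)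
        ((hsol _ ⟨_, hdata v m hv⟩).sub (hsol _ ⟨_, hdata v' m' hv'⟩)) x hx
      · exact h.trans_eq (by ring)
      · rw [add_sub_add_left_eq_sub, ← smul_sub, norm_smul, Real.norm_eq_abs, abs_of_nonneg ht,
          mul_assoc]
        exact mul_le_mul_of_nonneg_left (hM y hy) ht)
  have h := hsol _ ⟨_, hdata v m hv⟩
  refine ⟨_, _, h.deriv, fun x hx => (h.deriv₂ x hx).congr_deriv ?_, h.bc_pplus, h.bc_pminus,
    h.bc_c, h.decay⟩
  have hx' := hfix x hx
  rw [hx', sub_smul, Complex.coe_smul]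
  congr 1
  abel

/-- Existence at every point of the region: the a priori bound is uniform on bounded pieces of the
ray `z + [0, ∞)`, so finitely many steps of the continuity method lead back to `z`. -/
theorem exists_solvable (hU : IsSteadyState P p₀ q₀ bc Ubar Uplus) :
    ∃ η₀ : ℝ, 0 < η₀ ∧ ∀ η : ℝ, 0 < η → η < η₀ → ∀ z : ℂ,
      supNorm (coefA P Ubar) ^ 2 / min P.d P.D + supNorm (coefB P Ubar) < z.re + |z.im| →
      Solvable P bc Ubar η z ∧ ∃ K : ℝ, 0 ≤ K ∧ ∀ (F U U₁ : ℝ → Val) (m : ℝ), 0 ≤ m →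
        (∀ x, 0 ≤ x → ‖F x‖ ≤ m * Real.exp (-η * x)) → IsClassicalSol P bc Ubar η z F U U₁ →
        ∀ x, 0 ≤ x → ‖U x‖ ≤ K * m * Real.exp (-η * x) ∧ ‖U₁ x‖ ≤ K * m * Real.exp (-η * x) := by
  obtain ⟨η₀, hη₀, hap⟩ := exists_apriori hU
  refine ⟨η₀, hη₀, fun η hη hη' z hz => ?_⟩
  obtain ⟨T₀, hT₀⟩ := solvable_of_large hU hη.le z
  set T := max T₀ 0 with hT
  have hT0 : 0 ≤ T := le_max_right _ _
  obtain ⟨K, hK0, hK⟩ := hap η hη hη' (‖z‖ + T) (by positivity)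
  have hreg : ∀ s : ℝ, 0 ≤ s → s ≤ T → ∀ (F U U₁ : ℝ → Val) (m : ℝ), 0 ≤ m →
      (∀ x, 0 ≤ x → ‖F x‖ ≤ m * Real.exp (-η * x)) → IsClassicalSol P bc Ubar η (z + s) F U U₁ →
      ∀ x, 0 ≤ x → ‖U x‖ ≤ K * m * Real.exp (-η * x) ∧ ‖U₁ x‖ ≤ K * m * Real.exp (-η * x) := by
    intro s hs hsT F U U₁ m hm hF hsol
    refine hK (z + s) ?_ ?_ F U U₁ m hm hF hsol
    · simp only [Complex.add_re, Complex.ofReal_re, Complex.add_im, Complex.ofReal_im, add_zero]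
      linarith
    · refine (norm_add_le _ _).trans ?_
      rw [Complex.norm_real, Real.norm_eq_abs, abs_of_nonneg hs]
      linarith
  obtain ⟨N, hN⟩ := exists_nat_gt (K * T)
  have hN0 : (0 : ℝ) < N := lt_of_le_of_lt (mul_nonneg hK0 hT0) hN
  have hstep : ∀ n : ℕ, n ≤ N → Solvable P bc Ubar η (z + ((T - n * (T / N) : ℝ) : ℂ)) := by
    intro n
    induction n with
    | zero => exact fun _ => by simpa using hT₀ T (le_max_left _ _)
    | succ n ih =>
      intro hn
      have hn1 : (n : ℝ) + 1 ≤ N := by exact_mod_cast hn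
      have h1 : (n : ℝ) * (T / N) ≤ T := by
        rw [mul_div_assoc', div_le_iff₀ hN0, mul_comm]
        exact mul_le_mul_of_nonneg_left (by linarith) hT0
      have h2 : 0 ≤ (n : ℝ) * (T / N) := by positivity
      have h3 := solvable_sub (t := T / N) (ih (Nat.le_of_succ_le hn))
        (fun F U U₁ m hm hF hs x hx =>
          (hreg _ (by linarith) (by linarith) F U U₁ m hm hF hs x hx).1)
        hK0 (by positivity) (by rw [mul_div_assoc', div_lt_one hN0]; exact hN)
      convert h3 using 1
      push_cast
      ring
  refine ⟨?_, K, hK0, ?_⟩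
  · have := hstep N le_rfl
    rwa [mul_div_cancel₀ _ hN0.ne', sub_self, Complex.ofReal_zero, add_zero] at this
  · simpa using hreg 0 le_rfl hT0

end Existence

/-! ### Weak derivatives on the half-line -/

section WeakDeriv

variable {f f' g g' : ℝ → Val}

theorem ae_halfLine_iff {p : ℝ → Prop} :
    (∀ᵐ x ∂halfLine, p x) ↔ ∀ᵐ x, 0 < x → p x :=
  ae_restrict_iff' measurableSet_Ioi

theorem ae_halfLine_of_forall {p : ℝ → Prop} (h : ∀ x, 0 < x → p x) : ∀ᵐ x ∂halfLine, p x :=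
  ae_halfLine_iff.2 (ae_of_all _ h)

/-- An inequality between continuous functions that holds almost everywhere holds everywhere, up
to the boundary point. -/
theorem le_of_ae_le {a b : ℝ → ℝ} (ha : ContinuousOn a (Ici 0)) (hb : ContinuousOn b (Ici 0))
    (h : ∀ᵐ x ∂halfLine, a x ≤ b x) {x : ℝ} (hx : 0 ≤ x) : a x ≤ b x := by
  have hd : Dense {y : ℝ | 0 < y → a y ≤ b y} := Measure.dense_of_ae (ae_halfLine_iff.1 h)
  have hcl : x ∈ closure (Ioi 0 ∩ {y : ℝ | 0 < y → a y ≤ b y}) := by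
    have h1 := hd.open_subset_closure_inter (isOpen_Ioi (a := (0 : ℝ)))
    have h2 := closure_minimal h1 isClosed_closure
    rw [closure_Ioi] at h2
    exact h2 hx
  have hsub : Ioi 0 ∩ {y : ℝ | 0 < y → a y ≤ b y} ⊆ Ici 0 := fun y hy => (mem_Ioi.1 hy.1).le
  exact ContinuousWithinAt.closure_le hcl ((ha x hx).mono hsub) ((hb x hx).mono hsub)
    fun y hy => hy.2 hy.1

theorem eq_of_ae_eq {E : Type*} [NormedAddCommGroup E] {a b : ℝ → E}
    (ha : ContinuousOn a (Ici 0)) (hb : ContinuousOn b (Ici 0))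
    (h : a =ᵐ[halfLine] b) {x : ℝ} (hx : 0 ≤ x) : a x = b x := by
  have := le_of_ae_le (ha.sub hb).norm continuousOn_const
    (b := fun _ => 0) (h.mono fun y hy => by simp [hy]) hx
  exact sub_eq_zero.1 (norm_le_zero_iff.1 this)

theorem IsWeakDeriv.congr (h : IsWeakDeriv f g) (hf : f =ᵐ[halfLine] f') (hg : g =ᵐ[halfLine] g') :
    IsWeakDeriv f' g' := by
  have hloc : ∀ {a b : ℝ → Val}, a =ᵐ[halfLine] b → LocallyIntegrableOn a (Ioi 0) →
      LocallyIntegrableOn b (Ioi 0) := fun {a b} hab ha => by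
    rw [locallyIntegrableOn_iff isOpen_Ioi.isLocallyClosed] at ha ⊢
    intro k hk hkc
    refine (ha k hk hkc).congr ?_
    exact ae_mono (Measure.restrict_mono hk le_rfl) hab
  refine ⟨hloc hf h.1, hloc hg h.2.1, fun φ h1 h2 h3 => ?_⟩
  have key := h.2.2 φ h1 h2 h3
  have e1 : ∫ x, deriv φ x • f x ∂halfLine = ∫ x, deriv φ x • f' x ∂halfLine :=
    integral_congr_ae (hf.mono fun x hx => by simp only [hx])
  have e2 : ∫ x, φ x • g x ∂halfLine = ∫ x, φ x • g' x ∂halfLine :=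
    integral_congr_ae (hg.mono fun x hx => by simp only [hx])
  rwa [e1, e2] at key

/-- A function that is locally integrable on the half-line is integrable against continuous
functions with compact support in the open half-line. -/
theorem integrable_smul_of_tsupport (hf : LocallyIntegrableOn f (Ioi 0)) {φ : ℝ → ℝ}
    (hφ : Continuous φ) (hc : HasCompactSupport φ) (hs : tsupport φ ⊆ Ioi 0) :
    Integrable (fun x => φ x • f x) halfLine := by
  have h1 : IntegrableOn f (tsupport φ) := hf.integrableOn_compact_subset hs hc
  have h2 : IntegrableOn (fun x => φ x • f x) (tsupport φ) :=
    h1.continuousOn_smul hφ.continuousOn hc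
  have h3 : Integrable fun x => φ x • f x :=
    (integrableOn_iff_integrable_of_support_subset
      ((Function.support_smul_subset_left φ f).trans (subset_tsupport φ))).1 h2
  exact h3.restrict

theorem contDiff_deriv {φ : ℝ → ℝ} (hφ : ContDiff ℝ (⊤ : ℕ∞) φ) :
    ContDiff ℝ (⊤ : ℕ∞) (deriv φ) := (contDiff_infty_iff_deriv.1 hφ).2

theorem IsWeakDeriv.add (h : IsWeakDeriv f g) (h' : IsWeakDeriv f' g') :
    IsWeakDeriv (fun x => f x + f' x) fun x => g x + g' x := by
  refine ⟨h.1.add h'.1, h.2.1.add h'.2.1, fun φ h1 h2 h3 => ?_⟩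
  have hi := integrable_smul_of_tsupport h.2.1 h1.continuous h2 h3
  have hi' := integrable_smul_of_tsupport h'.2.1 h1.continuous h2 h3
  have hd := (contDiff_deriv h1).continuous
  have hj := integrable_smul_of_tsupport h.1 hd h2.deriv (tsupport_deriv_subset.trans h3)
  have hj' := integrable_smul_of_tsupport h'.1 hd h2.deriv (tsupport_deriv_subset.trans h3)
  simp only [smul_add]
  rw [integral_add hi hi', integral_add hj hj', h.2.2 φ h1 h2 h3, h'.2.2 φ h1 h2 h3, neg_add]

theorem IsWeakDeriv.const_smul (c : ℂ) (h : IsWeakDeriv f g) :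
    IsWeakDeriv (fun x => c • f x) fun x => c • g x := by
  refine ⟨h.1.smul c, h.2.1.smul c, fun φ h1 h2 h3 => ?_⟩
  have key := h.2.2 φ h1 h2 h3
  simp only [smul_comm _ c]
  rw [integral_smul, integral_smul, key, smul_neg]

theorem IsWeakDeriv.unique (h : IsWeakDeriv f g) (h' : IsWeakDeriv f g') : g =ᵐ[halfLine] g' := by
  have := isOpen_Ioi.ae_eq_zero_of_integral_contDiff_smul_eq_zero (U := Ioi (0 : ℝ))
    (f := fun x => g x - g' x) (μ := volume.restrict (Ioi 0))
    (fun x hx => by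
      obtain ⟨s, hs, h1⟩ := h.2.1.sub h'.2.1 x hx
      exact ⟨s, hs, h1.mono_measure Measure.restrict_le_self⟩)
    (fun φ h1 h2 h3 => by
      have hi := integrable_smul_of_tsupport h.2.1 h1.continuous h2 h3
      have hi' := integrable_smul_of_tsupport h'.2.1 h1.continuous h2 h3
      have h4 := h.2.2 φ h1 h2 h3
      rw [h'.2.2 φ h1 h2 h3, neg_inj] at h4
      simp only [smul_sub]
      have h5 := integral_sub hi hi'
      rw [halfLine] at h5 h4
      rw [h5, h4, sub_self])
  have h6 : ∀ᵐ x ∂halfLine, 0 < x := ae_restrict_mem measurableSet_Ioi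
  filter_upwards [this, h6] with x hx hx0
  exact sub_eq_zero.1 (hx hx0)

/-- The product rule for an exponential weight. -/
theorem IsWeakDeriv.exp_smul (a : ℝ) (h : IsWeakDeriv f g) :
    IsWeakDeriv (fun x => Real.exp (a * x) • f x)
      fun x => Real.exp (a * x) • (g x + a • f x) := by
  have hexp : ContDiff ℝ (⊤ : ℕ∞) fun x => Real.exp (a * x) := by fun_prop
  have hloc : ∀ {b : ℝ → Val}, LocallyIntegrableOn b (Ioi 0) →
      LocallyIntegrableOn (fun x => Real.exp (a * x) • b x) (Ioi 0) := fun {b} hb =>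
    hb.continuousOn_smul isOpen_Ioi.isLocallyClosed hexp.continuous.continuousOn
  refine ⟨hloc h.1, hloc (h.2.1.add (h.1.smul a)), fun φ h1 h2 h3 => ?_⟩
  set ψ : ℝ → ℝ := fun x => Real.exp (a * x) * φ x with hψ
  have hψ1 : ContDiff ℝ (⊤ : ℕ∞) ψ := hexp.mul h1
  have hψ2 : HasCompactSupport ψ := h2.mul_left
  have hψ3 : tsupport ψ ⊆ Ioi 0 := (tsupport_mul_subset_right).trans h3
  have hψd : ∀ x, deriv ψ x = a * ψ x + Real.exp (a * x) * deriv φ x := fun x => by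
    have e1 : HasDerivAt (fun x => Real.exp (a * x)) (Real.exp (a * x) * (a * 1)) x :=
      ((hasDerivAt_id x).const_mul a).exp
    have e2 := (h1.differentiable (by simp) x).hasDerivAt
    have e3 : HasDerivAt ψ (Real.exp (a * x) * (a * 1) * φ x + Real.exp (a * x) * deriv φ x) x :=
      e1.mul e2
    rw [e3.deriv]
    simp only [hψ]
    ring
  have key := h.2.2 ψ hψ1 hψ2 hψ3
  have hi := integrable_smul_of_tsupport h.2.1 hψ1.continuous hψ2 hψ3
  have hi' := integrable_smul_of_tsupport h.1 hψ1.continuous hψ2 hψ3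
  have hj := integrable_smul_of_tsupport h.1 (contDiff_deriv hψ1).continuous hψ2.deriv
    (tsupport_deriv_subset.trans hψ3)
  have e1 : ∀ x, deriv φ x • Real.exp (a * x) • f x = deriv ψ x • f x - a • (ψ x • f x) := by
    intro x
    rw [hψd, smul_smul, smul_smul, ← sub_smul]
    congr 1
    ring
  have e2 : ∀ x, φ x • Real.exp (a * x) • (g x + a • f x) = ψ x • g x + a • (ψ x • f x) := by
    intro x
    rw [smul_smul, mul_comm (φ x), smul_add, smul_comm a]
  simp only [e1, e2]
  have hi'' : Integrable (fun x => a • (ψ x • f x)) halfLine := hi'.smul a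
  rw [integral_sub hj hi'', integral_add hi hi'', key]
  abel

/-- A bounded function differs on a null set from a measurable function bounded everywhere. -/
theorem exists_bounded_rep {M : ℝ} (hM : 0 ≤ M) (hg : LocallyIntegrableOn g (Ioi 0))
    (h : ∀ᵐ x ∂halfLine, ‖g x‖ ≤ M) :
    ∃ g₀ : ℝ → Val, StronglyMeasurable g₀ ∧ (∀ x, ‖g₀ x‖ ≤ M) ∧ g =ᵐ[halfLine] g₀ := by
  have hm : AEStronglyMeasurable g halfLine := hg.aestronglyMeasurable
  refine ⟨{x | ‖hm.mk g x‖ ≤ M}.indicator (hm.mk g),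
    hm.stronglyMeasurable_mk.indicator
      (measurableSet_le hm.stronglyMeasurable_mk.norm.measurable measurable_const), fun x => ?_, ?_⟩
  · by_cases hx : ‖hm.mk g x‖ ≤ M
    · rwa [indicator_of_mem (by exact hx)]
    · rwa [indicator_of_notMem (by exact hx), norm_zero]
  · filter_upwards [hm.ae_eq_mk, h] with x h1 h2
    rw [indicator_of_mem (by rw [mem_ofPred_eq, ← h1]; exact h2), h1]

theorem locallyIntegrable_of_bounded {g₀ : ℝ → Val} {M : ℝ} (hm : AEStronglyMeasurable g₀)
    (hM : ∀ x, ‖g₀ x‖ ≤ M) : LocallyIntegrable g₀ :=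
  (locallyIntegrable_const M).mono hm (ae_of_all _ fun x => (hM x).trans (le_abs_self M))

theorem intervalIntegrable_of_locallyIntegrable {g₀ : ℝ → Val} (h : LocallyIntegrable g₀)
    (a b : ℝ) : IntervalIntegrable g₀ volume a b :=
  intervalIntegrable_iff.2 ((h.integrableOn_isCompact isCompact_uIcc).mono_set uIoc_subset_uIcc)

theorem lipschitzWith_primitive {g₀ : ℝ → Val} {M : ℝ} (hm : AEStronglyMeasurable g₀)
    (hM : ∀ x, ‖g₀ x‖ ≤ M) :
    LipschitzWith M.toNNReal fun x => ∫ t in (0 : ℝ)..x, g₀ t := by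
  have hM0 : 0 ≤ M := (norm_nonneg _).trans (hM 0)
  have hi := intervalIntegrable_of_locallyIntegrable (locallyIntegrable_of_bounded hm hM)
  refine LipschitzWith.of_dist_le_mul fun x y => ?_
  rw [dist_eq_norm, intervalIntegral.integral_interval_sub_left (hi _ _) (hi _ _),
    Real.coe_toNNReal _ hM0, Real.dist_eq]
  exact intervalIntegral.norm_integral_le_of_norm_le_const fun t _ => hM t

/-- The primitive of a bounded measurable function has that function as weak derivative. -/
theorem isWeakDeriv_primitive {g₀ : ℝ → Val} {M : ℝ} (hm : AEStronglyMeasurable g₀)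
    (hM : ∀ x, ‖g₀ x‖ ≤ M) : IsWeakDeriv (fun x => ∫ t in (0 : ℝ)..x, g₀ t) g₀ := by
  have hloc := locallyIntegrable_of_bounded hm hM
  have hlip := lipschitzWith_primitive hm hM
  set G : ℝ → Val := fun x => ∫ t in (0 : ℝ)..x, g₀ t with hG
  refine ⟨hlip.continuous.continuousOn.locallyIntegrableOn measurableSet_Ioi,
    hloc.locallyIntegrableOn _, fun φ h1 h2 h3 => ?_⟩
  have hφc := h1.continuous
  have hdc := (contDiff_deriv h1).continuous
  have hφ0 : φ 0 = 0 := image_eq_zero_of_notMem_tsupport fun h => lt_irrefl _ (mem_Ioi.1 (h3 h))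
  obtain ⟨b, hb⟩ := h2.isBounded.bddAbove
  set B := max b 0 + 1 with hB
  have hB0 : 0 < B := by rw [hB]; positivity
  have hout : ∀ x, B ≤ x → x ∉ tsupport φ := fun x hx h => by
    have := hb h
    rw [hB] at hx
    linarith [le_max_left b 0]
  have hφB : φ B = 0 := image_eq_zero_of_notMem_tsupport (hout B le_rfl)
  set h : ℝ → Val := fun x => φ x • g₀ x + deriv φ x • G x with hh
  have hhloc : LocallyIntegrable h :=
    (hloc.continuous_smul hφc).add (hdc.smul hlip.continuous).locallyIntegrable
  -- `φ G` and the primitive of `h` are absolutely continuous with the same derivative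
  have hcompl : ∀ᵐ x, HasDerivAt (fun x => φ x • G x) (h x) x := by
    filter_upwards [LocallyIntegrable.ae_hasDerivAt_integral hloc] with x hx
    exact ((h1.differentiable (by simp) x).hasDerivAt.smul (hx 0))
  obtain ⟨S, hS⟩ : ∃ S, ∀ x ∈ uIcc 0 B, ‖h x‖ ≤ S := by
    obtain ⟨S₁, hS₁⟩ := isCompact_uIcc.exists_bound_of_continuousOn
      (hφc.continuousOn (s := uIcc 0 B))
    obtain ⟨S₂, hS₂⟩ := isCompact_uIcc.exists_bound_of_continuousOn
      ((hdc.smul hlip.continuous).continuousOn (s := uIcc 0 B))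
    refine ⟨S₁ * M + S₂, fun x hx => (norm_add_le _ _).trans (add_le_add ?_ (hS₂ x hx))⟩
    rw [norm_smul]
    exact mul_le_mul (hS₁ x hx) (hM x) (norm_nonneg _) ((norm_nonneg _).trans (hS₁ x hx))
  have hac : AbsolutelyContinuousOnInterval
      (φ • G - fun x => ∫ t in (0 : ℝ)..x, h t) 0 B := by
    refine AbsolutelyContinuousOnInterval.sub ?_ ?_
    · exact ((h1.of_le (by simp)).contDiffOn.absolutelyContinuousOnInterval).smul
        (hlip.lipschitzOnWith.absolutelyContinuousOnInterval)
    · refine LipschitzOnWith.absolutelyContinuousOnInterval (K := S.toNNReal) ?_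
      refine LipschitzOnWith.of_dist_le_mul fun x hx y hy => ?_
      have hi := intervalIntegrable_of_locallyIntegrable hhloc
      rw [dist_eq_norm, intervalIntegral.integral_interval_sub_left (hi _ _) (hi _ _),
        Real.dist_eq]
      refine intervalIntegral.norm_integral_le_of_norm_le_const fun t ht => ?_
      exact (hS t ((uIcc_subset_uIcc hy hx) (uIoc_subset_uIcc ht))).trans (Real.le_coe_toNNReal S)
  obtain ⟨c, hc⟩ := hac.const_of_ae_hasDerivAt_zero (by
    filter_upwards [hcompl, LocallyIntegrable.ae_hasDerivAt_integral hhloc] with x hx hx' _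
    exact (hx.sub (hx' 0)).congr_deriv (sub_self _))
  have hc0 := hc 0 left_mem_uIcc
  have hcB := hc B right_mem_uIcc
  simp only [Pi.sub_apply, Pi.smul_apply', hφ0, hφB, zero_smul, intervalIntegral.integral_same,
    sub_zero] at hc0 hcB
  rw [← hc0, zero_sub, neg_eq_zero] at hcB
  have hint : ∫ x, h x ∂halfLine = 0 := by
    rw [halfLine, setIntegral_eq_of_subset_of_forall_sdiff_eq_zero measurableSet_Ioi
      (s := Ioc 0 B) (fun x hx => hx.1), ← intervalIntegral.integral_of_le hB0.le, hcB]
    intro x hx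
    have hxB : B ≤ x := by
      by_contra hlt
      exact hx.2 ⟨hx.1, (not_le.1 hlt).le⟩
    have e1 := hout x hxB
    simp only [hh]
    rw [image_eq_zero_of_notMem_tsupport e1,
      image_eq_zero_of_notMem_tsupport fun h => e1 (tsupport_deriv_subset h)]
    simp
  have hi := integrable_smul_of_tsupport (hloc.locallyIntegrableOn (Ioi 0)) hφc h2 h3
  have hj := integrable_smul_of_tsupport
    (hlip.continuous.continuousOn.locallyIntegrableOn measurableSet_Ioi) hdc h2.deriv
    (tsupport_deriv_subset.trans h3)
  rw [hh, integral_add hi hj] at hint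
  exact eq_neg_of_add_eq_zero_right hint

end WeakDeriv

/-! ### Representatives of functions with a bounded weak derivative -/

section Representatives

variable {f g : ℝ → Val}

theorem isWeakDeriv_const (c : Val) : IsWeakDeriv (fun _ => c) fun _ => 0 := by
  refine ⟨locallyIntegrableOn_const c, locallyIntegrableOn_const 0, fun φ h1 h2 h3 => ?_⟩
  have hφ0 : φ 0 = 0 := image_eq_zero_of_notMem_tsupport fun h => lt_irrefl _ (mem_Ioi.1 (h3 h))
  have h4 := h2.integral_Ioi_deriv_eq (h1.of_le (by simp)) 0
  rw [integral_smul_const, halfLine, h4, hφ0]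
  simp

/-- The lemma of du Bois-Reymond. -/
theorem IsWeakDeriv.ae_eq_const (h : IsWeakDeriv f fun _ => 0) :
    ∃ c : Val, f =ᵐ[halfLine] fun _ => c := by
  -- a test function with integral `1`; the constant is the mean of `f` with this density
  obtain ⟨ρ, hρ1, hρ2, hρ3, hρ4⟩ : ∃ ρ : ℝ → ℝ, ContDiff ℝ (⊤ : ℕ∞) ρ ∧ HasCompactSupport ρ ∧
      tsupport ρ ⊆ Ioi 0 ∧ ∫ x, ρ x = 1 := by
    let b : ContDiffBump (1 : ℝ) := ⟨1 / 4, 1 / 2, by norm_num, by norm_num⟩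
    refine ⟨b.normed volume, b.contDiff_normed, b.hasCompactSupport_normed, ?_, b.integral_normed⟩
    rw [b.tsupport_normed_eq, Real.closedBall_eq_Icc]
    intro x hx
    have : (1 : ℝ) - 1 / 2 ≤ x := hx.1
    exact mem_Ioi.2 (by linarith)
  have hres : ∀ {ψ : ℝ → ℝ}, tsupport ψ ⊆ Ioi 0 → ∫ x, ψ x ∂halfLine = ∫ x, ψ x := fun {ψ} hψ =>
    setIntegral_eq_integral_of_forall_compl_eq_zero fun x hx =>
      image_eq_zero_of_notMem_tsupport fun h => hx (hψ h)
  set c := ∫ x, ρ x • f x ∂halfLine with hc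
  refine ⟨c, ?_⟩
  have key := isOpen_Ioi.ae_eq_zero_of_integral_contDiff_smul_eq_zero (U := Ioi (0 : ℝ))
    (f := fun x => f x - c) (μ := volume.restrict (Ioi 0))
    (fun x hx => by
      obtain ⟨s, hs, h1⟩ := h.1.sub (locallyIntegrableOn_const c) x hx
      exact ⟨s, hs, h1.mono_measure Measure.restrict_le_self⟩)
    (fun ψ h1 h2 h3 => ?_)
  · have h6 : ∀ᵐ x ∂halfLine, 0 < x := ae_restrict_mem measurableSet_Ioi
    filter_upwards [key, h6] with x hx hx0
    exact sub_eq_zero.1 (hx hx0)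
  -- `ψ - (∫ ψ) ρ` is the derivative of a test function
  set m := ∫ x, ψ x with hm
  set χ : ℝ → ℝ := fun x => ψ x - m * ρ x with hχ
  have hχ1 : ContDiff ℝ (⊤ : ℕ∞) χ := h1.sub (contDiff_const.mul hρ1)
  have hχc := hχ1.continuous
  have hχ2 : HasCompactSupport χ := h2.sub hρ2.mul_left
  have hχ3 : tsupport χ ⊆ Ioi 0 := (tsupport_sub _ _).trans
    (union_subset h3 (tsupport_mul_subset_right.trans hρ3))
  have hχi : Integrable χ := hχc.integrable_of_hasCompactSupport hχ2
  have hχ4 : ∫ x, χ x = 0 := by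
    rw [hχ, integral_sub (h1.continuous.integrable_of_hasCompactSupport h2)
      ((hρ1.continuous.integrable_of_hasCompactSupport hρ2).const_mul m), integral_const_mul, hρ4]
    simp [hm]
  set φ : ℝ → ℝ := fun x => ∫ t in (0 : ℝ)..x, χ t with hφ
  have hφd : ∀ x, HasDerivAt φ (χ x) x := fun x =>
    (hχc.integral_hasStrictDerivAt 0 x).hasDerivAt
  have hφd' : deriv φ = χ := funext fun x => (hφd x).deriv
  have hφ1 : ContDiff ℝ (⊤ : ℕ∞) φ :=
    contDiff_infty_iff_deriv.2 ⟨fun x => (hφd x).differentiableAt, hφd' ▸ hχ1⟩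
  obtain ⟨a, ha0, b, hab⟩ : ∃ a, 0 < a ∧ ∃ b, tsupport χ ⊆ Ioc a b := by
    rcases (tsupport χ).eq_empty_or_nonempty with he | hne
    · exact ⟨1, one_pos, 1, by simp [he]⟩
    · have hpos : 0 < sInf (tsupport χ) := hχ3 (hχ2.sInf_mem hne)
      exact ⟨_, half_pos hpos, _, fun x hx => ⟨(half_lt_self hpos).trans_le
        (csInf_le hχ2.bddBelow hx), le_csSup hχ2.bddAbove hx⟩⟩
  have hφl : ∀ x, x ≤ a → φ x = 0 := by
    intro x hx
    have hz : ∀ t ∈ uIcc 0 x, χ t = 0 := fun t ht => image_eq_zero_of_notMem_tsupport fun h =>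
      absurd (hab h).1 (not_lt.2 ((mem_uIcc.1 ht).elim (fun h => h.2.trans hx)
        fun h => h.2.trans ha0.le))
    rw [hφ]
    simp only
    rw [intervalIntegral.integral_congr (g := fun _ => (0 : ℝ)) hz]
    simp
  have hφr : ∀ x, b < x → φ x = 0 := by
    intro x hx
    rcases le_or_gt x a with hxa | hxa
    · exact hφl x hxa
    rw [hφ]
    simp only
    rw [intervalIntegral.integral_of_le (ha0.trans hxa).le,
      setIntegral_eq_integral_of_forall_compl_eq_zero, hχ4]
    intro t ht
    refine image_eq_zero_of_notMem_tsupport fun h => ht ?_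
    exact ⟨ha0.trans (hab h).1, (hab h).2.trans hx.le⟩
  have hφs : tsupport φ ⊆ Icc a b := by
    refine closure_minimal (fun x hx => ?_) isClosed_Icc
    by_contra hx'
    rw [mem_Icc, not_and_or, not_le, not_le] at hx'
    exact hx (hx'.elim (fun h => hφl x h.le) (hφr x))
  have hφ2 : HasCompactSupport φ := isCompact_Icc.of_isClosed_subset (isClosed_tsupport _) hφs
  have hweak := h.2.2 φ hφ1 hφ2 (hφs.trans fun x hx => ha0.trans_le hx.1)
  rw [hφd'] at hweak
  have i1 := integrable_smul_of_tsupport h.1 h1.continuous h2 h3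
  have i2 := integrable_smul_of_tsupport h.1 hρ1.continuous hρ2 hρ3
  have i3 := integrable_smul_of_tsupport (locallyIntegrableOn_const c) h1.continuous h2 h3
  have e1 : ∀ x, χ x • f x = ψ x • f x - m • (ρ x • f x) := fun x => by
    rw [hχ, sub_smul, mul_smul]
  have i2' : Integrable (fun x => m • (ρ x • f x)) halfLine := i2.smul m
  simp only [e1, smul_zero, integral_zero, neg_zero] at hweak
  rw [integral_sub i1 i2', integral_smul, ← hc, sub_eq_zero] at hweak
  simp only [smul_sub]
  have e2 := integral_sub i1 i3
  rw [hweak, integral_smul_const, hres h3, ← hm, sub_self] at e2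
  exact e2

/-- A function with bounded weak derivative is the primitive of that derivative. -/
theorem IsWeakDeriv.exists_eq_primitive {g₀ : ℝ → Val} {M : ℝ} (h : IsWeakDeriv f g)
    (hg : g =ᵐ[halfLine] g₀) (hm : AEStronglyMeasurable g₀) (hM : ∀ x, ‖g₀ x‖ ≤ M) :
    ∃ c : Val, f =ᵐ[halfLine] fun x => c + ∫ t in (0 : ℝ)..x, g₀ t := by
  have h1 := (h.congr EventuallyEq.rfl hg).add ((isWeakDeriv_primitive hm hM).const_smul (-1))
  obtain ⟨c, hc⟩ := (h1.congr EventuallyEq.rfl (g' := fun _ => 0)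
    (ae_of_all _ fun x => by simp)).ae_eq_const
  refine ⟨c, hc.mono fun x hx => ?_⟩
  simp only [neg_smul, one_smul] at hx
  rw [← hx]
  exact (neg_add_cancel_right _ _).symm

theorem IsWeakDeriv.exists_continuous_rep {M : ℝ} (h : IsWeakDeriv f g)
    (hM : ∀ᵐ x ∂halfLine, ‖g x‖ ≤ M) : ∃ f₀ : ℝ → Val, Continuous f₀ ∧ f =ᵐ[halfLine] f₀ := by
  obtain ⟨g₀, hg1, hg2, hg3⟩ := exists_bounded_rep (le_max_right M 0) h.2.1
    (hM.mono fun x hx => hx.trans (le_max_left M 0))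
  obtain ⟨c, hc⟩ := h.exists_eq_primitive hg3 hg1.aestronglyMeasurable hg2
  exact ⟨_, continuous_const.add (lipschitzWith_primitive hg1.aestronglyMeasurable hg2).continuous,
    hc⟩

theorem IsWeakDeriv.exists_differentiable_rep {g₁ : ℝ → Val} {M : ℝ} (h : IsWeakDeriv f g)
    (hg : g =ᵐ[halfLine] g₁) (hg₁ : ContinuousOn g₁ (Ici 0)) (hM : ∀ᵐ x ∂halfLine, ‖g x‖ ≤ M) :
    ∃ f₀ : ℝ → Val, (∀ x, 0 ≤ x → HasDerivWithinAt f₀ (g₁ x) (Ici 0) x) ∧ f =ᵐ[halfLine] f₀ := by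
  have hM' : ∀ x, ‖g₁ (max x 0)‖ ≤ M := fun x => le_of_ae_le hg₁.norm continuousOn_const
    (b := fun _ => M) (by filter_upwards [hM, hg] with y h1 h2; rwa [← h2]) (le_max_right x 0)
  have hc := continuous_extend hg₁
  obtain ⟨c, hfc⟩ := h.exists_eq_primitive (hg.trans (ae_halfLine_of_forall fun x hx => by
    simp only [max_eq_left hx.le])) hc.aestronglyMeasurable hM'
  refine ⟨_, fun x hx => ?_, hfc⟩
  have := ((hc.integral_hasStrictDerivAt 0 x).hasDerivAt.const_add c)
  rw [max_eq_left hx] at this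
  exact this.hasDerivWithinAt

/-- A bounded classical derivative is a weak derivative. -/
theorem isWeakDeriv_of_hasDerivWithinAt {M : ℝ}
    (h : ∀ x, 0 ≤ x → HasDerivWithinAt f (g x) (Ici 0) x) (hg : ContinuousOn g (Ici 0))
    (hM : ∀ x, 0 ≤ x → ‖g x‖ ≤ M) : IsWeakDeriv f g := by
  have hc := continuous_extend hg
  have h1 := (isWeakDeriv_const (f 0)).add
    (isWeakDeriv_primitive hc.aestronglyMeasurable fun x => hM _ (le_max_right x 0))
  refine h1.congr (ae_halfLine_of_forall fun x hx => ?_) (ae_halfLine_of_forall fun x hx => ?_)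
  · have hsub : Icc 0 x ⊆ Ici 0 := fun y hy => hy.1
    change f 0 + ∫ t in (0 : ℝ)..x, g (max t 0) = f x
    rw [intervalIntegral.integral_eq_sub_of_hasDeriv_right_of_le hx.le (f := f)
      (fun y hy => (h y hy.1).continuousWithinAt.mono hsub) (fun y hy => ?_)
      (hc.intervalIntegrable _ _)]
    · exact add_sub_cancel _ _
    · rw [max_eq_left hy.1.le]
      exact (h y hy.1.le).mono fun t ht => hy.1.le.trans (mem_Ioi.1 ht).le
  · simp [max_eq_left hx.le]

end Representatives

/-! ### The weighted space -/

section Weighted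

variable {η : ℝ} {F U U₁ V : ℝ → Val}

theorem w1infNorm_le {f g : ℝ → Val} {M M' : ℝ} (h : IsWeakDeriv f g)
    (hf : ∀ᵐ x ∂halfLine, ‖f x‖ ≤ M) (hg : ∀ᵐ x ∂halfLine, ‖g x‖ ≤ M') :
    w1infNorm f ≤ ENNReal.ofReal M + ENNReal.ofReal M' := by
  refine (iInf₂_le g h).trans (add_le_add ?_ ?_)
  · rw [eLpNorm_exponent_top]; exact eLpNormEssSup_le_of_ae_bound hf
  · rw [eLpNorm_exponent_top]; exact eLpNormEssSup_le_of_ae_bound hg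

theorem ae_norm_le_of_eLpNorm_le {f : ℝ → Val} {N : ℝ≥0∞} (hN : N < ∞)
    (h : eLpNorm f ∞ halfLine ≤ N) : ∀ᵐ x ∂halfLine, ‖f x‖ ≤ N.toReal := by
  rw [eLpNorm_exponent_top] at h
  filter_upwards [ae_le_eLpNormEssSup (f := f) (μ := halfLine)] with x hx
  rw [← toReal_enorm]
  exact ENNReal.toReal_mono hN.ne (hx.trans h)

theorem ae_norm_le_w1infNorm {f : ℝ → Val} (h : w1infNorm f < ∞) :
    ∀ᵐ x ∂halfLine, ‖f x‖ ≤ (w1infNorm f).toReal :=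
  ae_norm_le_of_eLpNorm_le h (le_iInf₂ fun _ _ => le_self_add)

theorem exists_weakDeriv_bounded {f : ℝ → Val} (h : w1infNorm f < ∞) :
    ∃ g, IsWeakDeriv f g ∧ ∃ M, ∀ᵐ x ∂halfLine, ‖g x‖ ≤ M := by
  obtain ⟨g, hg⟩ := iInf_lt_iff.1 h
  obtain ⟨hg, hlt⟩ := iInf_lt_iff.1 hg
  exact ⟨g, hg, _, ae_norm_le_of_eLpNorm_le hlt le_add_self⟩

theorem exp_mul_exp_neg (η x : ℝ) : Real.exp (η * x) * Real.exp (-η * x) = 1 := by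
  rw [← Real.exp_add]; simp

theorem exp_smul_exp_smul (η x : ℝ) (V : Val) :
    Real.exp (-η * x) • Real.exp (η * x) • V = V := by
  rw [smul_smul, mul_comm, exp_mul_exp_neg, one_smul]

theorem norm_exp_smul_le_iff {x M : ℝ} {V : Val} :
    ‖Real.exp (η * x) • V‖ ≤ M ↔ ‖V‖ ≤ M * Real.exp (-η * x) := by
  rw [norm_smul, Real.norm_eq_abs, Real.abs_exp, neg_mul, Real.exp_neg, ← div_eq_mul_inv,
    le_div_iff₀ (Real.exp_pos _), mul_comm]

/-- Elements of the weighted space have a continuous representative that decays with the constant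
given by the norm. -/
theorem MemWeighted.exists_rep (h : MemWeighted η F) :
    ∃ F₀, IsDecaying η (weightedNorm η F).toReal F₀ ∧ F =ᵐ[halfLine] F₀ := by
  obtain ⟨g, hg, M, hM⟩ := exists_weakDeriv_bounded h
  obtain ⟨f₀, hf, hff⟩ := hg.exists_continuous_rep hM
  have hexp : Continuous fun x => Real.exp (-η * x) := by fun_prop
  refine ⟨fun x => Real.exp (-η * x) • f₀ x, ⟨(hexp.smul hf).continuousOn, fun x hx => ?_⟩,
    hff.mono fun x hx => ?_⟩
  · rw [norm_smul, Real.norm_eq_abs, Real.abs_exp, mul_comm]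
    refine mul_le_mul_of_nonneg_right ?_ (Real.exp_nonneg _)
    refine le_of_ae_le hf.continuousOn.norm continuousOn_const
      (b := fun _ => (weightedNorm η F).toReal) ?_ hx
    filter_upwards [ae_norm_le_w1infNorm h, hff] with y h1 h2
    rw [← h2]
    exact h1
  · simp only
    rw [← hx, exp_smul_exp_smul]

theorem MemWeighted.ae_norm_le (h : MemWeighted η F) :
    ∃ M, ∀ᵐ x ∂halfLine, ‖F x‖ ≤ M * Real.exp (-η * x) :=
  ⟨_, (ae_norm_le_w1infNorm h).mono fun _ hx => norm_exp_smul_le_iff.1 hx⟩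

theorem MemWeighted.smul_sub (hU : MemWeighted η U) (hF : MemWeighted η F) (z : ℂ) :
    MemWeighted η fun x => z • U x - F x := by
  obtain ⟨g, hg, M, hM⟩ := exists_weakDeriv_bounded hU
  obtain ⟨g', hg', M', hM'⟩ := exists_weakDeriv_bounded hF
  have h := (hg.const_smul z).add (hg'.const_smul (-1))
  refine (w1infNorm_le (M := ‖z‖ * (weightedNorm η U).toReal + (weightedNorm η F).toReal)
    (M' := ‖z‖ * M + M') (h.congr (ae_of_all _ fun x => ?_) EventuallyEq.rfl) ?_ ?_).trans_lt
    (by simp)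
  · simp only [neg_smul, one_smul, _root_.smul_sub, ← sub_eq_add_neg]
    rw [smul_comm]
  · filter_upwards [ae_norm_le_w1infNorm hU, ae_norm_le_w1infNorm hF] with x h1 h2
    rw [_root_.smul_sub, smul_comm]
    refine (norm_sub_le _ _).trans (add_le_add ?_ h2)
    rw [norm_smul]
    exact mul_le_mul_of_nonneg_left h1 (norm_nonneg z)
  · filter_upwards [hM, hM'] with x h1 h2
    rw [neg_smul, one_smul, ← sub_eq_add_neg]
    refine (norm_sub_le _ _).trans (add_le_add ?_ h2)
    rw [norm_smul]
    exact mul_le_mul_of_nonneg_left h1 (norm_nonneg z)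

/-- A decaying function with decaying derivative lies in the weighted space. -/
theorem weightedNorm_le {M : ℝ} (hη : 0 ≤ η)
    (h : ∀ x, 0 ≤ x → HasDerivWithinAt U (U₁ x) (Ici 0) x) (hU : IsDecaying η M U)
    (hU₁ : IsDecaying η M U₁) : weightedNorm η U ≤ ENNReal.ofReal ((2 + η) * M) := by
  have hM := hU.nonneg
  have hexp : Continuous fun x => Real.exp (η * x) := by fun_prop
  have hM1 : ∀ x, 0 ≤ x → ‖Real.exp (η * x) • (U₁ x + η • U x)‖ ≤ M + η * M := fun x hx => by
    rw [smul_add, smul_comm (Real.exp (η * x)) η]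
    refine (norm_add_le _ _).trans
      (add_le_add (norm_exp_smul_le_iff.2 (hU₁.bound x hx)) ?_)
    rw [norm_smul, Real.norm_eq_abs, abs_of_nonneg hη]
    exact mul_le_mul_of_nonneg_left (norm_exp_smul_le_iff.2 (hU.bound x hx)) hη
  have hw : IsWeakDeriv (fun x => Real.exp (η * x) • U x)
      fun x => Real.exp (η * x) • (U₁ x + η • U x) := by
    refine isWeakDeriv_of_hasDerivWithinAt (fun x hx => ?_)
      (hexp.continuousOn.smul (hU₁.cont.add (hU.cont.const_smul η))) hM1
    have e1 : HasDerivAt (fun x => Real.exp (η * x)) (Real.exp (η * x) * (η * 1)) x :=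
      ((hasDerivAt_id x).const_mul η).exp
    refine (e1.hasDerivWithinAt.smul (h x hx)).congr_deriv ?_
    rw [smul_add, smul_smul, mul_one]
  refine (w1infNorm_le hw (ae_halfLine_of_forall fun x hx =>
    norm_exp_smul_le_iff.2 (hU.bound x hx.le)) (ae_halfLine_of_forall fun x hx =>
    hM1 x hx.le)).trans_eq ?_
  rw [← ENNReal.ofReal_add hM (by positivity)]
  congr 1
  ring

/-- The weak derivative of an element of the weighted space decays as well. -/
theorem MemWeighted.ae_norm_weakDeriv_le (h : MemWeighted η V) {V₁ : ℝ → Val}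
    (hV : IsWeakDeriv V V₁) : ∃ M, ∀ᵐ x ∂halfLine, ‖V₁ x‖ ≤ M * Real.exp (-η * x) := by
  obtain ⟨g, hg, M, hM⟩ := exists_weakDeriv_bounded h
  have h1 := ((hV.exp_smul η).unique hg)
  refine ⟨M + |η| * (weightedNorm η V).toReal, ?_⟩
  filter_upwards [h1, hM, ae_norm_le_w1infNorm h] with x e1 e2 e3
  rw [← norm_exp_smul_le_iff]
  have e4 : Real.exp (η * x) • V₁ x = g x - η • (Real.exp (η * x) • V x) := by
    rw [← e1, smul_add, smul_comm η, add_sub_cancel_right]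
  rw [e4]
  refine (norm_sub_le _ _).trans (add_le_add e2 ?_)
  rw [norm_smul, Real.norm_eq_abs]
  exact mul_le_mul_of_nonneg_left e3 (abs_nonneg η)

end Weighted

/-! ### Solutions in the weighted space are classical -/

section Regularity

variable {P : Params} {p₀ q₀ : ℝ} {bc : TubulinBC} {Ubar : ℝ → Fin 3 → ℝ} {Uplus : Fin 3 → ℝ}
  {η : ℝ} {z : ℂ} {F : ℝ → Val}

/-- The trace can be read off any continuous representative. -/
theorem zeroTrace_iff {V R : ℝ → Val} (hR : ContinuousOn R (Ici 0)) (h : V =ᵐ[halfLine] R)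
    (i : Fin 3) : ZeroTrace (fun x => V x i) ↔ R 0 i = 0 := by
  have hRi := continuousOn_apply.1 hR i
  have hi : (fun x => V x i) =ᵐ[halfLine] fun x => R x i := h.mono fun x hx => by simp only [hx]
  constructor
  · rintro ⟨g, hg, hgV, hg0⟩
    rw [← eq_of_ae_eq hg hRi (hgV.trans hi) le_rfl, hg0]
  · exact fun h0 => ⟨_, hRi, hi.symm, h0⟩

/-- The equation `L U = G` solved for the second derivative. -/
theorem eq_diffInv_iff {x : ℝ} {U U₁ U₂ G : Val} :
    G.ofLp = (coefA P Ubar x).map Complex.ofReal *ᵥ U₁.ofLp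
          + (coefB P Ubar x).map Complex.ofReal *ᵥ U.ofLp
          + (matC P).map Complex.ofReal *ᵥ U₂.ofLp ↔
      U₂ = diffInv P (G - lowerOrder P Ubar x U U₁) := by
  have hC : (matC P).map Complex.ofReal *ᵥ U₂.ofLp = fun i => (diffusion P i : ℂ) * U₂ i := by
    ext i
    fin_cases i <;> simp [matC, diffusion, Matrix.mulVec, dotProduct, Fin.sum_univ_three]
  have hd : ∀ i, (diffusion P i : ℂ) ≠ 0 := fun i =>
    Complex.ofReal_ne_zero.2 (diffusion_pos P i).ne'
  rw [hC]
  constructor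
  · intro h
    ext i
    have hi := congrFun h i
    simp only [Pi.add_apply] at hi
    simp only [diffInv, lowerOrder, PiLp.sub_apply, Pi.add_apply]
    rw [eq_div_iff (hd i), hi]
    ring
  · intro h
    ext i
    rw [h]
    simp only [diffInv, lowerOrder, PiLp.sub_apply, Pi.add_apply]
    rw [mul_div_cancel₀ _ (hd i)]
    ring

theorem continuous_diffInv (P : Params) : Continuous (diffInv P) := by
  refine (PiLp.continuous_toLp 2 fun _ : Fin 3 => ℂ).comp (continuous_pi fun i => ?_)
  exact ((EuclideanSpace.proj (𝕜 := ℂ) i).continuous).div_const _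

theorem IsSteadyState.continuousOn_deriv₂ (hU : IsSteadyState P p₀ q₀ bc Ubar Uplus)
    {U U₁ : ℝ → Val} (hF : ContinuousOn F (Ici 0)) (h : ContinuousOn U (Ici 0))
    (h₁ : ContinuousOn U₁ (Ici 0)) :
    ContinuousOn (fun x => diffInv P (z • U x - F x - lowerOrder P Ubar x (U x) (U₁ x)))
      (Ici 0) :=
  (continuous_diffInv P).comp_continuousOn
    (((h.const_smul z).sub hF).sub (hU.continuousOn_lowerOrder h h₁))

/-- The second derivative of a solution is controlled by the data, the solution and its first
derivative, uniformly on the half-line. -/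
theorem exists_bound_deriv₂ (hU : IsSteadyState P p₀ q₀ bc Ubar Uplus) (z : ℂ) :
    ∃ S, 0 ≤ S ∧ ∀ x, 0 ≤ x → ∀ V V₁ W : Val, ∀ r, ‖V‖ ≤ r → ‖V₁‖ ≤ r → ‖W‖ ≤ r →
      ‖diffInv P (z • V - W - lowerOrder P Ubar x V V₁)‖ ≤ S * r := by
  obtain ⟨K, hK0, hK⟩ := exists_bound_entries hU
  have hδ := P.delta_pos
  refine ⟨3 / min P.d P.D * (‖z‖ + 1 + 18 * K), by positivity, fun x hx V V₁ W r h1 h2 h3 => ?_⟩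
  refine (norm_diffInv_le P _).trans ?_
  have h4 := norm_lowerOrder_le (hK x hx) V V₁
  have h5 : ‖z • V - W - lowerOrder P Ubar x V V₁‖ ≤ (‖z‖ + 1 + 18 * K) * r := by
    refine (norm_sub_le _ _).trans ((add_le_add_left (norm_sub_le _ _) _).trans ?_)
    rw [norm_smul]
    have := mul_le_mul_of_nonneg_left h1 (norm_nonneg z)
    have := mul_le_mul_of_nonneg_left (add_le_add h1 h2) (by positivity : 0 ≤ 9 * K)
    linarith
  have := mul_le_mul_of_nonneg_left h5 (by positivity : 0 ≤ 3 / min P.d P.D)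
  calc 3 * (‖z • V - W - lowerOrder P Ubar x V V₁‖ / min P.d P.D)
      = 3 / min P.d P.D * ‖z • V - W - lowerOrder P Ubar x V V₁‖ := by ring
    _ ≤ _ := this
    _ = _ := by ring

/-- Elliptic regularity: a solution of the resolvent equation in the weighted space agrees almost
everywhere with a classical solution. -/
theorem SolvesResolvent.exists_classical (hU : IsSteadyState P p₀ q₀ bc Ubar Uplus)
    (hη : 0 ≤ η) {F₀ V : ℝ → Val} {m : ℝ} (hF₀ : IsDecaying η m F₀) (hF : F =ᵐ[halfLine] F₀)
    (h : SolvesResolvent P bc Ubar η z V F) :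
    ∃ R R₁, IsClassicalSol P bc Ubar η z F₀ R R₁ ∧ V =ᵐ[halfLine] R := by
  obtain ⟨G, ⟨hV, -, V₁, V₂, hV₁, hV₂, heq, ht0, ht1, ht2⟩, hFG⟩ := h
  obtain ⟨M, hM⟩ := hV.ae_norm_le
  obtain ⟨M', hM'⟩ := hV.ae_norm_weakDeriv_le hV₁
  obtain ⟨S, hS0, hS⟩ := exists_bound_deriv₂ hU z
  have hpos : ∀ᵐ x ∂halfLine, 0 < x := ae_restrict_mem measurableSet_Ioi
  set r := max (max M M') m with hr
  have hr0 : 0 ≤ r := hF₀.nonneg.trans (le_max_right _ _)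
  have hle : ∀ {a x : ℝ}, a ≤ r → a * Real.exp (-η * x) ≤ r * Real.exp (-η * x) := fun h =>
    mul_le_mul_of_nonneg_right h (Real.exp_nonneg _)
  have hexp1 : ∀ x, 0 < x → Real.exp (-η * x) ≤ 1 := fun x hx =>
    Real.exp_le_one_iff.2 (by nlinarith)
  have hV₁b : ∀ᵐ x ∂halfLine, ‖V₁ x‖ ≤ r * Real.exp (-η * x) := hM'.mono fun x hx =>
    hx.trans (hle ((le_max_right _ _).trans (le_max_left _ _)))
  have hVb : ∀ᵐ x ∂halfLine, ‖V x‖ ≤ r * Real.exp (-η * x) := hM.mono fun x hx =>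
    hx.trans (hle ((le_max_left _ _).trans (le_max_left _ _)))
  have hV₂eq : ∀ᵐ x ∂halfLine,
      V₂ x = diffInv P (z • V x - F₀ x - lowerOrder P Ubar x (V x) (V₁ x)) := by
    filter_upwards [heq, hFG, hF] with x h1 h2 h3
    rw [eq_diffInv_iff.1 h1, ← h3, h2, sub_sub_cancel]
  have hone : ∀ {f : ℝ → Val}, (∀ᵐ x ∂halfLine, ‖f x‖ ≤ r * Real.exp (-η * x)) →
      ∀ᵐ x ∂halfLine, ‖f x‖ ≤ r := fun {f} hf => by
    filter_upwards [hf, hpos] with x h1 h2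
    exact h1.trans (mul_le_of_le_one_right hr0 (hexp1 x h2))
  have hV₂b : ∀ᵐ x ∂halfLine, ‖V₂ x‖ ≤ S * r := by
    filter_upwards [hV₂eq, hone hVb, hone hV₁b, hpos] with x h1 h2 h3 h4
    rw [h1]
    refine hS x h4.le _ _ _ r h2 h3 ((hF₀.bound x h4.le).trans ?_)
    exact (hle (le_max_right _ _)).trans (mul_le_of_le_one_right hr0 (hexp1 x h4))
  -- continuity of the representatives makes the right side of the equation for `V₂` continuous
  obtain ⟨R, hR, hVR⟩ := hV₁.exists_continuous_rep (hone hV₁b)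
  obtain ⟨Q, hQ, hVQ⟩ := hV₂.exists_continuous_rep hV₂b
  obtain ⟨R₁, hR₁, hVR₁⟩ := hV₂.exists_differentiable_rep
    (g₁ := fun x => diffInv P (z • R x - F₀ x - lowerOrder P Ubar x (R x) (Q x)))
    (by filter_upwards [hV₂eq, hVR, hVQ] with x h1 h2 h3; rw [h1, h2, h3])
    (hU.continuousOn_deriv₂ hF₀.cont hR.continuousOn hQ.continuousOn) hV₂b
  have hR₁c : ContinuousOn R₁ (Ici 0) := fun x hx => (hR₁ x hx).continuousWithinAt
  have hQR : ∀ x, 0 ≤ x → Q x = R₁ x := fun x hx =>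
    eq_of_ae_eq hQ.continuousOn hR₁c (hVQ.symm.trans hVR₁) hx
  obtain ⟨R₀, hR₀, hVR₀⟩ := hV₁.exists_differentiable_rep hVR₁ hR₁c (hone hV₁b)
  have hR₀c : ContinuousOn R₀ (Ici 0) := fun x hx => (hR₀ x hx).continuousWithinAt
  have hRR : ∀ x, 0 ≤ x → R x = R₀ x := fun x hx =>
    eq_of_ae_eq hR.continuousOn hR₀c (hVR.symm.trans hVR₀) hx
  have hexpc : ContinuousOn (fun x => r * Real.exp (-η * x)) (Ici 0) := by fun_prop
  refine ⟨R₀, R₁, ⟨hR₀, fun x hx => ?_, (zeroTrace_iff hR₀c hVR₀ 0).1 ht0,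
    (zeroTrace_iff hR₀c hVR₀ 1).1 ht1, ?_, r, fun x hx => ⟨?_, ?_⟩⟩, hVR₀⟩
  · have := hR₁ x hx
    rwa [hRR x hx, hQR x hx] at this
  · cases bc with
    | dirichlet c => exact (zeroTrace_iff hR₀c hVR₀ 2).1 ht2
    | neumann => exact (zeroTrace_iff hR₁c hVR₁ 2).1 ht2
  · exact le_of_ae_le hR₀c.norm hexpc
      (by filter_upwards [hVb, hVR₀] with y h1 h2; rwa [← h2]) hx
  · exact le_of_ae_le hR₁c.norm hexpc
      (by filter_upwards [hV₁b, hVR₁] with y h1 h2; rwa [← h2]) hx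

/-- Conversely a classical solution solves the resolvent equation in the weighted space. -/
theorem IsClassicalSol.solvesResolvent (hU : IsSteadyState P p₀ q₀ bc Ubar Uplus)
    (hη : 0 ≤ η) {F₀ U U₁ : ℝ → Val} {m : ℝ} (hF₀ : IsDecaying η m F₀) (hF : F =ᵐ[halfLine] F₀)
    (hFm : MemWeighted η F) (h : IsClassicalSol P bc Ubar η z F₀ U U₁) :
    SolvesResolvent P bc Ubar η z U F := by
  obtain ⟨M, hMU, hMU₁⟩ := h.exists_isDecaying
  obtain ⟨S, hS0, hS⟩ := exists_bound_deriv₂ hU z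
  have hUm : MemWeighted η U := (weightedNorm_le hη h.deriv hMU hMU₁).trans_lt ENNReal.ofReal_lt_top
  have hexp1 : ∀ x, 0 ≤ x → Real.exp (-η * x) ≤ 1 := fun x hx =>
    Real.exp_le_one_iff.2 (by nlinarith)
  have hb : ∀ {f : ℝ → Val} {a : ℝ}, IsDecaying η a f → ∀ x, 0 ≤ x → ‖f x‖ ≤ a := fun hf x hx =>
    (hf.bound x hx).trans (mul_le_of_le_one_right hf.nonneg (hexp1 x hx))
  refine ⟨fun x => z • U x - F x, ⟨hUm, hUm.smul_sub hFm z, U₁,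
    fun x => diffInv P (z • U x - F₀ x - lowerOrder P Ubar x (U x) (U₁ x)),
    isWeakDeriv_of_hasDerivWithinAt h.deriv hMU₁.cont (hb hMU₁),
    isWeakDeriv_of_hasDerivWithinAt h.deriv₂ (hU.continuousOn_deriv₂ hF₀.cont hMU.cont hMU₁.cont)
      (M := S * max M m) (fun x hx => hS x hx _ _ _ _ ((hb hMU x hx).trans (le_max_left _ _))
        ((hb hMU₁ x hx).trans (le_max_left _ _)) ((hb hF₀ x hx).trans (le_max_right _ _))),
    ?_, (zeroTrace_iff hMU.cont EventuallyEq.rfl 0).2 h.bc_pplus,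
    (zeroTrace_iff hMU.cont EventuallyEq.rfl 1).2 h.bc_pminus, ?_⟩, ?_⟩
  · filter_upwards [hF] with x hx
    rw [eq_diffInv_iff, hx]
  · have hc := h.bc_c
    cases bc with
    | dirichlet c => exact (zeroTrace_iff hMU.cont EventuallyEq.rfl 2).2 hc
    | neumann => exact (zeroTrace_iff hMU₁.cont EventuallyEq.rfl 2).2 hc
  · exact ae_of_all _ fun x => by simp

/-- The resolvent is bounded wherever the equation is solvable with an a priori estimate. -/
theorem hasBoundedInverse_of_apriori (hU : IsSteadyState P p₀ q₀ bc Ubar Uplus) (hη : 0 ≤ η)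
    {K : ℝ} (hK0 : 0 ≤ K) (hsol : Solvable P bc Ubar η z)
    (hK : ∀ (F U U₁ : ℝ → Val) (m : ℝ), 0 ≤ m → (∀ x, 0 ≤ x → ‖F x‖ ≤ m * Real.exp (-η * x)) →
      IsClassicalSol P bc Ubar η z F U U₁ →
        ∀ x, 0 ≤ x → ‖U x‖ ≤ K * m * Real.exp (-η * x) ∧ ‖U₁ x‖ ≤ K * m * Real.exp (-η * x)) :
    HasBoundedInverse P bc Ubar η z := by
  refine ⟨((2 + η) * K).toNNReal, fun F hF => ?_⟩
  obtain ⟨F₀, hF₀, hFF⟩ := hF.exists_rep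
  obtain ⟨U, U₁, hsolU⟩ := hsol F₀ _ hF₀
  refine ⟨U, hsolU.solvesResolvent hU hη hF₀ hFF hF, ?_, fun V hV => ?_⟩
  · have hb := hK F₀ U U₁ _ hF₀.nonneg hF₀.bound hsolU
    obtain ⟨M, hMU, hMU₁⟩ := hsolU.exists_isDecaying
    refine (weightedNorm_le hη hsolU.deriv ⟨hMU.cont, fun x hx => (hb x hx).1⟩
      ⟨hMU₁.cont, fun x hx => (hb x hx).2⟩).trans_eq ?_
    rw [← mul_assoc, ENNReal.ofReal_mul (by positivity), ENNReal.ofReal_toReal hF.ne]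
    rfl
  · obtain ⟨R, R₁, hR, hVR⟩ := hV.exists_classical hU hη hF₀ hFF
    refine hVR.trans (ae_halfLine_of_forall fun x hx => ?_)
    have := (hK _ _ _ 0 le_rfl (fun y _ => by simp) (hR.sub hsolU) x hx.le).1
    simp only [mul_zero, zero_mul] at this
    exact sub_eq_zero.1 (norm_le_zero_iff.1 this)

end Regularity

end Microtubule

end

theorem mainTheorem8 (P : Microtubule.Params) (p₀ q₀ : ℝ) (bc : Microtubule.TubulinBC)
    (Ubar : ℝ → Fin 3 → ℝ) (Uplus : Fin 3 → ℝ)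
    (hU : Microtubule.IsSteadyState P p₀ q₀ bc Ubar Uplus) :
    BddAbove (Set.range fun x : Set.Ici (0 : ℝ) =>
        Microtubule.opNorm (Microtubule.coefA P Ubar x)) ∧
    BddAbove (Set.range fun x : Set.Ici (0 : ℝ) =>
        Microtubule.opNorm (Microtubule.coefB P Ubar x)) ∧
    ∃ η₀ : ℝ, 0 < η₀ ∧ ∀ η : ℝ, 0 < η → η < η₀ → ∀ z : ℂ,
      (Microtubule.supNorm (Microtubule.coefA P Ubar)) ^ 2 / min P.d P.D
          + Microtubule.supNorm (Microtubule.coefB P Ubar) < z.re + |z.im| →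
        z ∉ Microtubule.spectrumL P bc Ubar η := by
  obtain ⟨S, -, hS⟩ := Microtubule.exists_bound_entries hU
  refine ⟨?_, ?_, ?_⟩
  · exact Microtubule.bddAbove_opNorm fun x hx i j => (hS x hx i j).1
  · exact Microtubule.bddAbove_opNorm fun x hx i j => (hS x hx i j).2
  · obtain ⟨η₀, hη₀, h⟩ := Microtubule.exists_solvable hU
    refine ⟨η₀, hη₀, fun η hη hη' z hz hspec => ?_⟩
    obtain ⟨hsol, K, hK0, hK⟩ := h η hη hη' z hz
    exact hspec (Microtubule.hasBoundedInverse_of_apriori hU hη.le hK0 hsol hK)
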